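/- Let $q\in L^1(\mathbb R;\mathbb C)$ and write $j=\sqrt{-1}$. For $\operatorname{Im}\lambda\ge 0$ let $v(t,\lambda)\in\mathbb C^2$ be the (continuous, integrated-form) solution of the Zakharov–Shabat system $$v_t=\begin{pmatrix}-j\lambda & q(t)\\ -\overline{q(t)} & j\lambda\end{pmatrix}v,\qquad v(t,\lambda)\,e^{j\lambda t}\to\begin{pmatrix}1\\0\end{pmatrix}\quad(t\to-\infty),$$ and put $u_1=v_1e^{j\lambda t}$, $u_2=v_2e^{-j\lambda t}$, $a(\lambda)=\lim_{t\to\infty}u_1(t,\lambda)$, and $b(\lambda)=\lim_{t\to\infty}u_2(t,\lambda)$ wherever this limit exists. The continuous spectrum is $Q_c(\lambda)=b(\lambda)/a(\lambda)$, $\lambda\in\mathbb R$ (with value $0$ by convention if $a(\lambda)=0$). The eigenvalues are the zeros $\lambda_k$ of $a$ with $\operatorname{Im}\lambda_k>0$, and the multiplicity $L_k$ is the order of the zero. Put $b^{(n)}(\lambda_k)=\lim_{t\to\infty}\partial_\lambda^n u_2(t,\lambda_k)$ for $0\le n<L_k$, let $b_k(\lambda)=\sum_{n<L_k}\frac{b^{(n)}(\lambda_k)}{n!}(\lambda-\lambda_k)^n$,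 and define $r_{k,\ell}$ ($0\le\ell<L_k$) by the principal part $$\frac{b_k(\lambda)}{a(\lambda)}=\frac{r_{k,L_k-1}}{(\lambda-\lambda_k)^{L_k}}+\dots+\frac{r_{k,0}}{\lambda-\lambda_k}+O(1)\qquad(\lambda\to\lambda_k).$$ The norming constants are $Q_{k,\ell}=j^\ell r_{k,\ell}$. Write $\mathrm{GNFT}\{q\}=(Q_c,\{\lambda_k\},\{Q_{k\ell}\})$. Then the following hold. 0. (Well-definedness.) $v(\cdot,\lambda)$ exists and is unique for $\operatorname{Im}\lambda\ge0$; the limit $a(\lambda)$ exists for $\operatorname{Im}\lambda\ge 0$ and $b(\lambda)$ exists for $\lambda\in\mathbb R$; $a$ and each $u_2(t,\cdot)$ are analytic in the open upper half plane; each eigenvalue has a finite multiplicity $L_k\ge1$; the limits $b^{(n)}(\lambda_k)$, $n<L_k$, and the expansion above exist. If $u_2(t,\cdot)\to b$ locally uniformly on an open neighbourhood of $\lambda_k$, then also $b(\lambda)/a(\lambda)=\sum_{\ell<L_k} r_{k,\ell}(\lambda-\lambda_k)^{-\ell-1}+O(1)$. 1. (Phase shift.) For $\phi_0\in\mathbb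 R$: $\mathrm{GNFT}\{q(t)e^{j\phi_0}\}=(Q_c(\lambda)e^{-j\phi_0},\{\lambda_k\},\{Q_{k\ell}e^{-j\phi_0}\})$. 2. (Time shift.) For $t_0\in\mathbb R$, the transform $(Q_c',\{\lambda_k'\},\{Q_{k\ell}'\})$ of $q(t-t_0)$ satisfies $Q_c'(\lambda)=Q_c(\lambda)e^{-2j\lambda t_0}$, $\lambda_k'=\lambda_k$, and $$[Q_{k,L_k-1}'\ \cdots\ Q_{k0}']=[Q_{k,L_k-1}\ \cdots\ Q_{k0}]\,e^{2\Lambda_kt_0},$$ where $\Lambda_k$ is the $L_k\times L_k$ matrix with $-j\lambda_k$ on the diagonal, $-1$ on the first superdiagonal and $0$ elsewhere. 3. (Frequency shift.) For $\omega_0\in\mathbb R$: $\mathrm{GNFT}\{q(t)e^{-2j\omega_0t}\}=(Q_c(\lambda-\omega_0),\{\lambda_k+\omega_0\},\{Q_{k\ell}\})$. 4. (Time dilation.) For $T>0$: $\mathrm{GNFT}\{\frac1Tq(\frac tT)\}=(Q_c(T\lambda),\{\lambda_k/T\},\{Q_{k\ell}/T^{\ell+1}\})$. In 1–4 the multiplicities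 of corresponding eigenvalues are equal. 5. (Parseval.) If moreover $q\in L^2(\mathbb R)$ and $a(\lambda)\ne0$ for all $\lambda\in\mathbb R$, then there are only finitely many eigenvalues, $\log(1+|Q_c|^2)$ is integrable on $\mathbb R$, and $$\int_{-\infty}^\infty|q(t)|^2\,dt=\frac1\pi\int_{-\infty}^\infty\log\bigl(1+|Q_c(\lambda)|^2\bigr)\,d\lambda+4\sum_kL_k\operatorname{Im}\lambda_k.$$ -/

import Mathlib

open Complex Filter Topology MeasureTheory Asymptotics Matrix

noncomputable section

namespace GNFT

/-- The coefficient matrix of the Zakharov-Shabat system at spectral parameter `lam`. -/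
def zsMatrix (q : ℝ → ℂ) (lam : ℂ) (t : ℝ) : Matrix (Fin 2) (Fin 2) ℂ :=
  !![-I * lam, q t; -(starRingEnd ℂ) (q t), I * lam]

/-- `v` solves `v_t = zsMatrix q lam t *ᵥ v` (in integrated form, so that `q` need only be locally
integrable) with the boundary condition `v → (1, 0) e^{-i lam t}` as `t → -∞`. -/
structure IsJost (q : ℝ → ℂ) (lam : ℂ) (v : ℝ → Fin 2 → ℂ) : Prop where
  cont : Continuous v
  eqn : ∀ s t : ℝ, v t - v s = ∫ τ in s..t, zsMatrix q lam τ *ᵥ v τ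
  bc : Tendsto (fun t : ℝ => exp (I * lam * t) • v t) atBot (𝓝 ![1, 0])

open Classical in
/-- The solution of the Zakharov-Shabat system normalised at `-∞`. -/
def jost (q : ℝ → ℂ) (lam : ℂ) : ℝ → Fin 2 → ℂ :=
  if h : ∃ v, IsJost q lam v then h.choose else 0

/-- `u₁(t, lam) = v₁(t, lam) e^{i lam t}`. -/
def u1 (q : ℝ → ℂ) (t : ℝ) (lam : ℂ) : ℂ := jost q lam t 0 * exp (I * lam * t)

/-- `u₂(t, lam) = v₂(t, lam) e^{-i lam t}`. -/
def u2 (q : ℝ → ℂ) (t : ℝ) (lam : ℂ) : ℂ := jost q lam t 1 * exp (-I * lam * t)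

/-- The spectral function `a(lam) = lim_{t → ∞} u₁(t, lam)`. -/
def a (q : ℝ → ℂ) (lam : ℂ) : ℂ := limUnder atTop (fun t : ℝ => u1 q t lam)

/-- The spectral function `b(lam) = lim_{t → ∞} u₂(t, lam)`. -/
def b (q : ℝ → ℂ) (lam : ℂ) : ℂ := limUnder atTop (fun t : ℝ => u2 q t lam)

/-- The continuous spectrum `Q_c = b / a` on the real line. -/
def Qc (q : ℝ → ℂ) (lam : ℝ) : ℂ := b q lam / a q lam

/-- The eigenvalues: the zeros of `a` in the open upper half plane. -/
def eigenvalues (q : ℝ → ℂ) : Set ℂ := {lam | 0 < lam.im ∧ a q lam = 0}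

/-- The multiplicity of an eigenvalue: its order as a zero of `a`. -/
def mult (q : ℝ → ℂ) (lam : ℂ) : ℕ := analyticOrderNatAt (a q) lam

/-- `b^{(n)}(lam) = lim_{t → ∞} ∂ⁿu₂/∂lamⁿ (t, lam)`. At an eigenvalue of multiplicity `L` of an
integrable signal this limit exists for every `n < L`, also where `u₂(t, ·)` itself has no limit at
the neighbouring points (as happens for solitons). -/
def bDeriv (q : ℝ → ℂ) (lam : ℂ) (n : ℕ) : ℂ :=
  limUnder atTop (fun t : ℝ => iteratedDeriv n (u2 q t) lam)

/-- The Taylor polynomial of `b` at the eigenvalue `lamk`, to the order `mult q lamk` which is all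
that the principal part of `b / a` at `lamk` depends on. -/
def bTaylor (q : ℝ → ℂ) (lamk lam : ℂ) : ℂ :=
  ∑ n ∈ Finset.range (mult q lamk),
    bDeriv q lamk n / (n.factorial : ℂ) * (lam - lamk) ^ n

/-- `f(z) = r_{L-1} / (z - z₀)^L + ⋯ + r₀ / (z - z₀) + O(1)` as `z → z₀`. -/
def IsPrincipalPart (f : ℂ → ℂ) (z₀ : ℂ) (L : ℕ) (r : ℕ → ℂ) : Prop :=
  (fun z => f z - ∑ l ∈ Finset.range L, r l / (z - z₀) ^ (l + 1)) =O[𝓝[≠] z₀]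
    (fun _ => (1 : ℝ))

open Classical in
/-- The coefficients `r_l`, `l < L`, of the principal part of `b / a` at the eigenvalue `lamk` of
multiplicity `L` (they are unique when they exist). -/
def residueCoeff (q : ℝ → ℂ) (lamk : ℂ) : ℕ → ℂ :=
  if h : ∃ r, IsPrincipalPart (fun z => bTaylor q lamk z / a q z) lamk (mult q lamk) r
  then h.choose else 0

/-- The norming constants `Q_{k,l} = i^l r_{k,l}`, `l < L_k`. -/
def norming (q : ℝ → ℂ) (lamk : ℂ) (l : ℕ) : ℂ := I ^ l * residueCoeff q lamk l

/-- The row vector `[Q_{k,L-1} ⋯ Q_{k,0}]`. -/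
def normingRow (q : ℝ → ℂ) (lamk : ℂ) (L : ℕ) : Fin L → ℂ :=
  fun i => norming q lamk (L - 1 - i)

/-- The `L × L` Jordan-type block with `-i lam` on the diagonal and `-1` on the superdiagonal. -/
def LambdaBlock (lam : ℂ) (L : ℕ) : Matrix (Fin L) (Fin L) ℂ :=
  Matrix.of fun i j =>
    if i = j then -I * lam else if (i : ℕ) + 1 = (j : ℕ) then -1 else 0

end GNFT

end

/-! Put `x = e^{iλt} v₁` and `w = e^{iλt} v₂`. Variation of constants turns the system with its
condition at `-∞` into Volterra equations, whose kernel `e^{2iλ(t-s)}`, `s ≤ t`, is bounded by one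
exactly because `Im λ ≥ 0`. The `n`-th term of the Neumann series is at most `(∫_{-∞}^t |q|)^n /
n!`, which yields existence, uniqueness, bounds uniform in `λ`, and holomorphy (`isVolterra_jost`,
`IsVolterra.unique`, `hol_a`, `hol_u2`).

At an eigenvalue `λ_k` the factor `e^{-2iλt}` in `u₂` grows, so the limits `b^{(n)}(λ_k)` need a
cancellation. Let `y`, `z` come from the solution normalised at `+∞`. The Wronskian `x y - w z` is
the constant `a`, whence `(u₂ / y)' = -a e^{-2iλt} conj q / y²`. Thus `u₂ = y c - a h` with `c`
independent of `t` (`exists_u2_decomposition`). The term `a h` vanishes to order `L_k` at `λ_k`, and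
`y → 1` uniformly; so the derivatives of order below `L_k` converge to those of `c`.

Rules 1-4 are cases of `q'(t) = α⁻¹ q(t/α + τ) e^{-2iωt + iφ}`. Uniqueness shows that `u₂` for `q'`
at `λ` is `E(λ)` times `u₂` for `q` at `αλ - αω` and the transformed time (`SpectralMap.of_eq`).
Norming constants follow by multiplying a principal part by the Taylor series of `E`; for time
shifts these coefficients are the entries of the exponential of a Jordan block.

For Parseval, `|a|² + |b|² = 1` on the real line gives `log (1 + |Q_c|²) = -2 log |a|`. A Blaschke
product removes the zeros of `a` without changing `|a|` on the line, and the Poisson formula at `iy`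
expresses `y (log |a(iy)| + log |B(iy)|)` through `log |a|` on the line. As `y → ∞` the first term
tends to `-‖q‖₂² / 2` (`tendsto_mul_log_norm_a`), the second to `2 Σ L_k Im λ_k`
(`tendsto_mul_log_norm_blaschke`), and the Poisson side becomes the integral in the formula. -/

noncomputable section

namespace GNFT

variable {q : ℝ → ℂ}

/-! ### Calculus for absolutely continuous primitives, as `q` is merely integrable. -/

/-- `F` is absolutely continuous on `[a, b]` with almost everywhere derivative `f`. -/
structure IsPrim (F f : ℝ → ℂ) (a b : ℝ) : Prop where
  ac : AbsolutelyContinuousOnInterval F a b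
  deriv : ∀ᵐ x, x ∈ Set.uIcc a b → HasDerivAt F (f x) x
  int : IntervalIntegrable f volume a b

theorem absolutelyContinuousOnInterval_of_dist_le {X Y : Type*} [PseudoMetricSpace X]
    [PseudoMetricSpace Y] {F : ℝ → X} {G : ℝ → Y} {a b K : ℝ}
    (hG : AbsolutelyContinuousOnInterval G a b)
    (h : ∀ x ∈ Set.uIcc a b, ∀ y ∈ Set.uIcc a b, dist (F x) (F y) ≤ K * dist (G x) (G y)) :
    AbsolutelyContinuousOnInterval F a b := by
  unfold AbsolutelyContinuousOnInterval at hG ⊢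
  refine squeeze_zero' ?_ ?_ (by simpa using hG.const_mul K)
  · exact Eventually.of_forall fun _ => Finset.sum_nonneg fun _ _ => dist_nonneg
  · rw [eventually_inf_principal]
    refine Eventually.of_forall fun E hE => ?_
    rw [Finset.mul_sum]
    exact Finset.sum_le_sum fun i hi => h _ (hE.1 i hi).1 _ (hE.1 i hi).2

theorem ae_norm_integral_sub {f : ℝ → ℂ} {a b : ℝ} (hf : IntervalIntegrable f volume a b)
    {x y : ℝ} (hx : x ∈ Set.uIcc a b) (hy : y ∈ Set.uIcc a b) :
    dist (∫ s in a..x, f s) (∫ s in a..y, f s) ≤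
      dist (∫ s in a..x, ‖f s‖) (∫ s in a..y, ‖f s‖) := by
  have hax : IntervalIntegrable f volume a x :=
    hf.mono_set (Set.uIcc_subset_uIcc Set.left_mem_uIcc hx)
  have hay : IntervalIntegrable f volume a y :=
    hf.mono_set (Set.uIcc_subset_uIcc Set.left_mem_uIcc hy)
  rw [dist_eq_norm, Real.dist_eq, intervalIntegral.integral_interval_sub_left hax hay,
    intervalIntegral.integral_interval_sub_left hax.norm hay.norm]
  exact intervalIntegral.norm_integral_le_abs_integral_norm

theorem IsPrim.of_primitive {F f : ℝ → ℂ} {a b : ℝ} (hf : IntervalIntegrable f volume a b)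
    (h : ∀ t ∈ Set.uIcc a b, F t - F a = ∫ s in a..t, f s)
    (hF : ∀ᵐ x, x ∈ Set.uIcc a b → HasDerivAt F (f x) x) : IsPrim F f a b := by
  refine ⟨?_, hF, hf⟩
  refine absolutelyContinuousOnInterval_of_dist_le (K := 1)
    (hf.norm.absolutelyContinuousOnInterval_intervalIntegral (c := a) Set.left_mem_uIcc) ?_
  intro x hx y hy
  rw [one_mul, ← dist_sub_right (F x) (F y) (F a), h x hx, h y hy]
  exact ae_norm_integral_sub hf hx hy

/-- A function with `F t - F s = ∫ s..t, f` for all `s`, `t` is a primitive of `f`. -/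
theorem IsPrim.of_forall {F f : ℝ → ℂ} {a b : ℝ} (hf : IntervalIntegrable f volume a b)
    (h : ∀ s t, F t - F s = ∫ r in s..t, f r) : IsPrim F f a b := by
  refine IsPrim.of_primitive hf (fun t _ => h a t) ?_
  filter_upwards [hf.ae_hasDerivAt_integral] with x hx hm
  refine ((hx hm a Set.left_mem_uIcc).const_add (F a)).congr_of_eventuallyEq
    (Eventually.of_forall fun t => ?_)
  simp [← h a t]

theorem IsPrim.congr_deriv {F f g : ℝ → ℂ} {a b : ℝ} (h : IsPrim F f a b)
    (hfg : ∀ x ∈ Set.uIcc a b, f x = g x) : IsPrim F g a b := by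
  refine ⟨h.ac, h.deriv.mono fun x hx hm => hfg x hm ▸ hx hm, h.int.congr ?_⟩
  exact fun x hx => hfg x (Set.uIoc_subset_uIcc hx)

/-- Subtracting `∫ f` from `F` leaves an absolutely continuous function with derivative zero almost
everywhere, hence a constant. -/
theorem IsPrim.sub_eq {F f : ℝ → ℂ} {a b : ℝ} (h : IsPrim F f a b) :
    F b - F a = ∫ s in a..b, f s := by
  have hG : AbsolutelyContinuousOnInterval (fun t => ∫ s in a..t, f s) a b :=
    absolutelyContinuousOnInterval_of_dist_le (K := 1)
      (h.int.norm.absolutelyContinuousOnInterval_intervalIntegral (c := a) Set.left_mem_uIcc)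
      (by intro x hx y hy; rw [one_mul]; exact ae_norm_integral_sub h.int hx hy)
  obtain ⟨C, hC⟩ := (h.ac.sub hG).const_of_ae_hasDerivAt_zero (by
    filter_upwards [h.deriv, h.int.ae_hasDerivAt_integral] with x h1 h2 hm
    simpa using (h1 hm).sub (h2 hm a Set.left_mem_uIcc))
  have h1 := hC a Set.left_mem_uIcc
  have h2 := hC b Set.right_mem_uIcc
  simp only [Pi.sub_apply, intervalIntegral.integral_same, sub_zero] at h1 h2
  rw [h1, ← h2]; ring

theorem IsPrim.mul {F f G g : ℝ → ℂ} {a b : ℝ} (hF : IsPrim F f a b) (hG : IsPrim G g a b) :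
    IsPrim (fun t => F t * G t) (fun t => f t * G t + F t * g t) a b := by
  refine ⟨hF.ac.smul hG.ac, ?_, ?_⟩
  · filter_upwards [hF.deriv, hG.deriv] with x h1 h2 hm
    exact (h1 hm).mul (h2 hm)
  · exact (hF.int.mul_continuousOn hG.ac.continuousOn).add
      (hG.int.continuousOn_mul hF.ac.continuousOn)

theorem IsPrim.add {F f G g : ℝ → ℂ} {a b : ℝ} (hF : IsPrim F f a b) (hG : IsPrim G g a b) :
    IsPrim (fun t => F t + G t) (fun t => f t + g t) a b := by
  refine ⟨hF.ac.add hG.ac, ?_, hF.int.add hG.int⟩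
  filter_upwards [hF.deriv, hG.deriv] with x h1 h2 hm
  exact (h1 hm).add (h2 hm)

theorem IsPrim.sub {F f G g : ℝ → ℂ} {a b : ℝ} (hF : IsPrim F f a b) (hG : IsPrim G g a b) :
    IsPrim (fun t => F t - G t) (fun t => f t - g t) a b := by
  refine ⟨hF.ac.sub hG.ac, ?_, hF.int.sub hG.int⟩
  filter_upwards [hF.deriv, hG.deriv] with x h1 h2 hm
  exact (h1 hm).sub (h2 hm)

theorem IsPrim.conj {F f : ℝ → ℂ} {a b : ℝ} (hF : IsPrim F f a b) :
    IsPrim (fun t => (starRingEnd ℂ) (F t)) (fun t => (starRingEnd ℂ) (f t)) a b := by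
  refine ⟨absolutelyContinuousOnInterval_of_dist_le (K := 1) hF.ac ?_, ?_, ?_⟩
  · intro x _ y _
    simp [dist_eq_norm, ← map_sub]
  · filter_upwards [hF.deriv] with x h1 hm
    exact (Complex.conjCLE.toContinuousLinearMap.hasFDerivAt.comp_hasDerivAt x (h1 hm))
  · have := hF.int
    rw [intervalIntegrable_iff] at this ⊢
    exact Complex.conjCLE.toContinuousLinearMap.integrable_comp this

/-- Inversion is Lipschitz on the image of a compact interval on which `F` has no zero, so absolute
continuity passes to `F⁻¹`. -/
theorem IsPrim.inv {F f : ℝ → ℂ} {a b : ℝ} (hF : IsPrim F f a b)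
    (h0 : ∀ x ∈ Set.uIcc a b, F x ≠ 0) :
    IsPrim (fun t => (F t)⁻¹) (fun t => -f t / F t ^ 2) a b := by
  have hc : ContinuousOn (fun t => (F t)⁻¹) (Set.uIcc a b) := hF.ac.continuousOn.inv₀ h0
  obtain ⟨C, hC⟩ := isCompact_uIcc.exists_bound_of_continuousOn hc
  refine ⟨absolutelyContinuousOnInterval_of_dist_le (K := C * C) hF.ac ?_, ?_, ?_⟩
  · intro x hx y hy
    have h1 : (F x)⁻¹ - (F y)⁻¹ = (F x)⁻¹ * (F y)⁻¹ * (F y - F x) := by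
      have := h0 x hx
      have := h0 y hy
      field_simp
    rw [dist_eq_norm, h1, dist_comm, dist_eq_norm, norm_mul, norm_mul]
    gcongr
    · exact (norm_nonneg _).trans (hC x hx)
    · exact hC x hx
    · exact hC y hy
  · filter_upwards [hF.deriv] with x h1 hm
    exact (h1 hm).inv (h0 x hm)
  · have := hF.int.neg.mul_continuousOn (hc.pow 2)
    refine this.congr fun x _ => ?_
    simp [div_eq_mul_inv]

theorem IsPrim.of_hasDerivAt {F f : ℝ → ℂ} (h : ∀ x, HasDerivAt F (f x) x) (hf : Continuous f)
    (a b : ℝ) : IsPrim F f a b := by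
  refine IsPrim.of_forall (hf.intervalIntegrable _ _) fun s t => ?_
  rw [intervalIntegral.integral_eq_sub_of_hasDerivAt (fun x _ => h x) (hf.intervalIntegrable _ _)]

theorem isPrim_exp (c : ℂ) (a b : ℝ) :
    IsPrim (fun t : ℝ => exp (c * t)) (fun t : ℝ => c * exp (c * t)) a b := by
  refine IsPrim.of_hasDerivAt (fun x => ?_) (by fun_prop) a b
  have h : HasDerivAt (fun z : ℂ => exp (c * z)) (exp (c * x) * (c * 1)) (x : ℂ) :=
    ((hasDerivAt_id (x : ℂ)).const_mul c).cexp
  convert h.comp_ofReal using 1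
  ring

/-! ### Holomorphy in the upper half plane with continuity up to the real line. -/

/-- Continuous on the closed upper half plane and holomorphic in the open one. -/
structure Hol (f : ℂ → ℂ) : Prop where
  cont : ContinuousOn f {z | 0 ≤ z.im}
  diff : DifferentiableOn ℂ f {z | 0 < z.im}

theorem isOpen_upper : IsOpen {z : ℂ | 0 < z.im} := isOpen_lt continuous_const Complex.continuous_im

theorem upper_mem_nhds {z : ℂ} (hz : 0 < z.im) : {z : ℂ | 0 < z.im} ∈ 𝓝 z :=
  isOpen_upper.mem_nhds hz

theorem Hol.of_differentiable {f : ℂ → ℂ} (hf : Differentiable ℂ f) : Hol f :=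
  ⟨hf.continuous.continuousOn, hf.differentiableOn⟩

theorem Hol.const (c : ℂ) : Hol fun _ => c := .of_differentiable (differentiable_const c)

theorem Hol.add {f g : ℂ → ℂ} (hf : Hol f) (hg : Hol g) : Hol fun z => f z + g z :=
  ⟨hf.cont.add hg.cont, hf.diff.add hg.diff⟩

theorem Hol.mul {f g : ℂ → ℂ} (hf : Hol f) (hg : Hol g) : Hol fun z => f z * g z :=
  ⟨hf.cont.mul hg.cont, hf.diff.mul hg.diff⟩

theorem Hol.congr {f g : ℂ → ℂ} (hf : Hol f) (h : ∀ z : ℂ, 0 ≤ z.im → g z = f z) : Hol g :=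
  ⟨hf.cont.congr h, hf.diff.congr fun z hz => h z (le_of_lt hz)⟩

theorem Hol.differentiableAt {f : ℂ → ℂ} (hf : Hol f) {z : ℂ} (hz : 0 < z.im) :
    DifferentiableAt ℂ f z := hf.diff.differentiableAt (upper_mem_nhds hz)

theorem Hol.analyticOnNhd {f : ℂ → ℂ} (hf : Hol f) : AnalyticOnNhd ℂ f {z | 0 < z.im} :=
  hf.diff.analyticOnNhd isOpen_upper

theorem Hol.analyticAt {f : ℂ → ℂ} (hf : Hol f) {z : ℂ} (hz : 0 < z.im) :
    AnalyticAt ℂ f z := hf.analyticOnNhd z hz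

theorem Hol.tsum {f : ℕ → ℂ → ℂ} {u : ℕ → ℝ} (hf : ∀ n, Hol (f n)) (hu : Summable u)
    (h : ∀ n z, 0 ≤ z.im → ‖f n z‖ ≤ u n) : Hol fun z => ∑' n, f n z :=
  ⟨continuousOn_tsum (fun n => (hf n).cont) hu h,
    differentiableOn_tsum_of_summable_norm hu (fun n => (hf n).diff) isOpen_upper
      fun n z hz => h n z (le_of_lt hz)⟩

/-- Cauchy's estimate on a disc of radius `r`, which stays inside the half plane. -/
theorem Hol.norm_deriv_le {f : ℂ → ℂ} (hf : Hol f) {C : ℝ} (hC : ∀ z, 0 ≤ z.im → ‖f z‖ ≤ C)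
    {z : ℂ} {r : ℝ} (hr : 0 < r) (hz : r < z.im) : ‖deriv f z‖ ≤ C / r := by
  have hsub : ∀ w ∈ Metric.closedBall z r, 0 < w.im := by
    intro w hw
    have h1 := (Complex.abs_im_le_norm (w - z)).trans (mem_closedBall_iff_norm.1 hw)
    rw [Complex.sub_im, abs_le] at h1
    linarith [h1.1]
  refine norm_deriv_le_of_forall_mem_sphere_norm_le hr ?_ fun w hw =>
    hC w (hsub w (Metric.sphere_subset_closedBall hw)).le
  refine DifferentiableOn.diffContOnCl ?_
  rw [closure_ball z hr.ne']
  exact hf.diff.mono hsub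

/-- A single integrable bound on `F` suffices: Cauchy's estimate converts it into the bound on the
derivative needed to differentiate under the integral. -/
theorem Hol.integral {μ : Measure ℝ} {F : ℝ → ℂ → ℂ} {g : ℝ → ℝ}
    (hm : ∀ z : ℂ, 0 ≤ z.im → AEStronglyMeasurable (fun s => F s z) μ)
    (hb : ∀ᵐ s ∂μ, ∀ z : ℂ, 0 ≤ z.im → ‖F s z‖ ≤ g s) (hg : Integrable g μ)
    (hF : ∀ᵐ s ∂μ, Hol (F s)) : Hol fun z => ∫ s, F s z ∂μ := by
  constructor
  · exact continuousOn_of_dominated (fun z hz => hm z hz)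
      (fun z hz => hb.mono fun s hs => hs z hz) hg (hF.mono fun s hs => hs.cont)
  · intro z₀ hz₀
    have hz₀' : 0 < z₀.im := hz₀
    -- Points of the ball of this radius have imaginary part above `z₀.im / 4`, so a Cauchy disc of
    -- the same radius about each of them fits in the half plane.
    have hr : 0 < z₀.im / 4 := by linarith
    have hball : ∀ z ∈ Metric.ball z₀ (z₀.im / 4), z₀.im / 4 < z.im := by
      intro w hw
      have h1 := (Complex.abs_im_le_norm (w - z₀)).trans (mem_ball_iff_norm.1 hw).le
      rw [Complex.sub_im, abs_le] at h1
      linarith [h1.1]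
    -- The derivative is a limit of difference quotients along the real steps `1 / (n + 1)`, which
    -- never leave the half plane where measurability is assumed.
    have hmd : AEStronglyMeasurable (fun s => deriv (F s) z₀) μ := by
      have hlim : Tendsto (fun n : ℕ => (1 : ℂ) / ((n : ℂ) + 1)) atTop (𝓝[≠] 0) := by
        refine tendsto_nhdsWithin_iff.2 ⟨tendsto_one_div_add_atTop_nhds_zero_nat, ?_⟩
        exact Eventually.of_forall fun n => one_div_ne_zero (Nat.cast_add_one_ne_zero n)
      have hev : ∀ᶠ n : ℕ in atTop, 0 ≤ (z₀ + (1 : ℂ) / ((n : ℂ) + 1)).im := by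
        refine Eventually.of_forall fun n => ?_
        have : (1 : ℂ) / ((n : ℂ) + 1) = ((1 / ((n : ℝ) + 1) : ℝ) : ℂ) := by push_cast; rfl
        rw [this]
        simpa using hz₀'.le
      obtain ⟨N, hN⟩ := eventually_atTop.1 hev
      refine aestronglyMeasurable_of_tendsto_ae atTop
        (f := fun (n : ℕ) s => ((1 : ℂ) / (((n + N : ℕ) : ℂ) + 1))⁻¹ •
          (F s (z₀ + (1 : ℂ) / (((n + N : ℕ) : ℂ) + 1)) - F s z₀)) (fun n => ?_) ?_
      · exact AEStronglyMeasurable.const_smul (𝕜 := ℂ)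
          ((hm _ (hN (n + N) (by lia))).sub (hm _ hz₀'.le)) _
      · filter_upwards [hF] with s hs
        have hd := (hs.differentiableAt hz₀').hasDerivAt
        rw [hasDerivAt_iff_tendsto_slope_zero] at hd
        exact (hd.comp hlim).comp (tendsto_add_atTop_nat N)
    have := hasDerivAt_integral_of_dominated_loc_of_deriv_le (μ := μ) (F := fun z s => F s z)
      (F' := fun z s => deriv (F s) z) (bound := fun s => g s / (z₀.im / 4))
      (Metric.ball_mem_nhds z₀ hr)
      (by
        filter_upwards [Metric.ball_mem_nhds z₀ hr] with z hz
        exact hm z (hr.trans (hball z hz)).le)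
      (hg.mono' (hm z₀ hz₀'.le) (hb.mono fun s hs => hs z₀ hz₀'.le))
      hmd
      (by
        filter_upwards [hb, hF] with s h1 h2 z hz
        exact h2.norm_deriv_le h1 hr (hball z hz))
      (hg.div_const _)
      (by
        filter_upwards [hF] with s h2 z hz
        exact (h2.differentiableAt (hr.trans (hball z hz))).hasDerivAt)
    exact this.2.differentiableAt.differentiableWithinAt

/-! ### Integrals over left half-lines -/

section Iic

variable {E : Type*} [NormedAddCommGroup E]

theorem setIntegral_Iic_sub [NormedSpace ℝ E] {h : ℝ → E}
    (hh : ∀ T, IntegrableOn h (Set.Iic T)) (s t : ℝ) :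
    (∫ r in Set.Iic t, h r) - ∫ r in Set.Iic s, h r = ∫ r in s..t, h r :=
  intervalIntegral.integral_Iic_sub_Iic (hh s) (hh t)

theorem intervalIntegrable_of_Iic {h : ℝ → E} (hh : ∀ T, IntegrableOn h (Set.Iic T)) (s t : ℝ) :
    IntervalIntegrable h volume s t :=
  ((hh (max s t)).mono_set fun _ hx => hx.2).intervalIntegrable

theorem continuous_setIntegral_Iic [NormedSpace ℝ E] {h : ℝ → E}
    (hh : ∀ T, IntegrableOn h (Set.Iic T)) :
    Continuous fun t => ∫ r in Set.Iic t, h r := by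
  have : (fun t => ∫ r in Set.Iic t, h r) =
      fun t => (∫ r in Set.Iic 0, h r) + ∫ r in (0 : ℝ)..t, h r := by
    ext t
    rw [← setIntegral_Iic_sub hh 0 t]; abel
  rw [this]
  exact continuous_const.add
    (intervalIntegral.continuous_primitive (intervalIntegrable_of_Iic hh) 0)

end Iic

theorem isPrim_setIntegral_Iic {h : ℝ → ℂ} (hh : ∀ T, IntegrableOn h (Set.Iic T)) (a b : ℝ) :
    IsPrim (fun t => ∫ r in Set.Iic t, h r) h a b :=
  IsPrim.of_forall (intervalIntegrable_of_Iic hh a b) fun s t => setIntegral_Iic_sub hh s t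

/-! ### The running `L¹` norm of `q`, source of the factorials. -/

/-- `∫_{-∞}^t |q|`. -/
def cumNorm (q : ℝ → ℂ) (t : ℝ) : ℝ := ∫ s in Set.Iic t, ‖q s‖

section cumNorm

theorem cumNorm_nonneg (q : ℝ → ℂ) (t : ℝ) : 0 ≤ cumNorm q t :=
  integral_nonneg fun _ => norm_nonneg _

theorem cumNorm_le (hq : Integrable q volume) (t : ℝ) : cumNorm q t ≤ ∫ s, ‖q s‖ :=
  setIntegral_le_integral hq.norm (Eventually.of_forall fun _ => norm_nonneg _)

theorem continuous_cumNorm (hq : Integrable q volume) : Continuous (cumNorm q) :=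
  continuous_setIntegral_Iic fun _ => hq.norm.integrableOn

theorem isPrim_cumNorm (hq : Integrable q volume) (a b : ℝ) :
    IsPrim (fun t => (cumNorm q t : ℂ)) (fun t => (‖q t‖ : ℂ)) a b := by
  have e : (fun t => (cumNorm q t : ℂ)) = fun t => ∫ r in Set.Iic t, (‖q r‖ : ℂ) :=
    funext fun t => integral_ofReal.symm
  rw [e]
  exact isPrim_setIntegral_Iic (fun T => hq.norm.ofReal.integrableOn) a b

theorem isPrim_cumNorm_pow (hq : Integrable q volume) (n : ℕ) (a b : ℝ) :
    IsPrim (fun t => (cumNorm q t : ℂ) ^ (n + 1))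
      (fun t => (n + 1) * ((‖q t‖ : ℂ) * (cumNorm q t : ℂ) ^ n)) a b := by
  induction n with
  | zero => simpa using isPrim_cumNorm hq a b
  | succ n ih =>
    have := ih.mul (isPrim_cumNorm hq a b)
    simp only [← pow_succ] at this
    refine this.congr_deriv fun x _ => ?_
    push_cast
    ring

theorem integrable_norm_mul_cumNorm_pow (hq : Integrable q volume) (n : ℕ) :
    Integrable (fun s => ‖q s‖ * cumNorm q s ^ n) volume := by
  refine (hq.norm.mul_const ((∫ s, ‖q s‖) ^ n)).mono'
    (hq.norm.1.mul ((continuous_cumNorm hq).pow n).aestronglyMeasurable) ?_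
  refine Eventually.of_forall fun s => ?_
  rw [norm_mul, norm_norm, norm_pow, Real.norm_of_nonneg (cumNorm_nonneg q s)]
  gcongr
  · exact cumNorm_nonneg q s
  · exact cumNorm_le hq s

/-- The integrand is the derivative of `cumNorm q ^ (n + 1) / (n + 1)`. Each integration against
`|q|` thus raises the power by one and contributes one factor of the factorial. -/
theorem setIntegral_norm_mul_cumNorm_pow_le (hq : Integrable q volume) (n : ℕ) (t : ℝ) :
    ∫ s in Set.Iic t, ‖q s‖ * cumNorm q s ^ n ≤ cumNorm q t ^ (n + 1) / (n + 1) := by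
  refine le_of_tendsto (intervalIntegral_tendsto_integral_Iic t
    (integrable_norm_mul_cumNorm_pow hq n).integrableOn tendsto_id)
    (Eventually.of_forall fun a => ?_)
  have h := (isPrim_cumNorm_pow hq n a t).sub_eq
  have h2 : ((cumNorm q t ^ (n + 1) - cumNorm q a ^ (n + 1) : ℝ) : ℂ) =
      ((∫ s in a..t, (n + 1) * (‖q s‖ * cumNorm q s ^ n) : ℝ) : ℂ) := by
    rw [← intervalIntegral.integral_ofReal]
    push_cast
    exact h
  rw [Complex.ofReal_inj, intervalIntegral.integral_const_mul] at h2
  rw [id, le_div_iff₀ (by positivity), mul_comm, ← h2]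
  linarith [pow_nonneg (cumNorm_nonneg q a) (n + 1)]

end cumNorm

/-! ### The Volterra system and uniqueness of its solution. -/

theorem norm_exp_two_I_mul (lam : ℂ) (r : ℝ) :
    ‖exp (2 * I * lam * r)‖ = Real.exp (-2 * lam.im * r) := by
  rw [Complex.norm_exp]
  congr 1
  simp [Complex.mul_re, Complex.mul_im]

theorem norm_exp_two_I_mul_le {lam : ℂ} (hl : 0 ≤ lam.im) {s t : ℝ} (h : s ≤ t) :
    ‖exp (2 * I * lam * (t - s))‖ ≤ 1 := by
  rw [← Complex.ofReal_sub, norm_exp_two_I_mul, Real.exp_le_one_iff]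
  nlinarith [sub_nonneg.2 h, mul_nonneg hl (sub_nonneg.2 h)]

theorem norm_exp_neg_two_I_mul_le {lam : ℂ} (hl : 0 ≤ lam.im) {s t : ℝ} (h : s ≤ t) :
    ‖exp (-2 * I * lam * s)‖ ≤ Real.exp (2 * lam.im * t) := by
  have : -2 * I * lam * s = 2 * I * lam * ((-s : ℝ) : ℂ) := by push_cast; ring
  rw [this, norm_exp_two_I_mul, Real.exp_le_exp]
  nlinarith

theorem integrableOn_Iic_mul {p φ : ℝ → ℂ} (hp : Integrable p volume) (hφ : Continuous φ)
    {C T : ℝ} (hC : ∀ t ≤ T, ‖φ t‖ ≤ C) : IntegrableOn (fun s => p s * φ s) (Set.Iic T) := by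
  refine (hp.norm.integrableOn.mul_const C).mono'
    (hp.1.restrict.mul hφ.aestronglyMeasurable) ?_
  filter_upwards [ae_restrict_mem measurableSet_Iic] with s hs
  rw [norm_mul]
  gcongr
  exact hC s hs

theorem integrableOn_Iic_exp_mul {g : ℝ → ℂ} {lam : ℂ} (hl : 0 ≤ lam.im) {T : ℝ}
    (hg : IntegrableOn g (Set.Iic T)) :
    IntegrableOn (fun s : ℝ => exp (-2 * I * lam * s) * g s) (Set.Iic T) := by
  refine (hg.norm.const_mul (Real.exp (2 * lam.im * T))).mono'
    ((by fun_prop : Continuous fun s : ℝ => exp (-2 * I * lam * s)).aestronglyMeasurable.mul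
      hg.1) ?_
  filter_upwards [ae_restrict_mem measurableSet_Iic] with s hs
  rw [norm_mul]
  gcongr
  exact norm_exp_neg_two_I_mul_le hl hs

/-- Separating the factor that depends on `t` leaves a fixed integrand, to which continuity of
primitives and additivity apply. -/
theorem setIntegral_exp_sub_mul (g : ℝ → ℂ) (lam : ℂ) (t : ℝ) :
    ∫ s in Set.Iic t, exp (2 * I * lam * (t - s)) * g s =
      exp (2 * I * lam * t) * ∫ s in Set.Iic t, exp (-2 * I * lam * s) * g s := by
  rw [← integral_const_mul]
  congr 1 with s
  rw [← mul_assoc, ← Complex.exp_add]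
  ring_nf

theorem continuous_setIntegral_exp_mul {g : ℝ → ℂ} {lam : ℂ} (hl : 0 ≤ lam.im)
    (hg : ∀ T, IntegrableOn g (Set.Iic T)) :
    Continuous fun t : ℝ => ∫ s in Set.Iic t, exp (2 * I * lam * (t - s)) * g s := by
  simp only [setIntegral_exp_sub_mul]
  exact (by fun_prop : Continuous fun t : ℝ => exp (2 * I * lam * t)).mul
    (continuous_setIntegral_Iic fun T => integrableOn_Iic_exp_mul hl (hg T))

/-- The system of Volterra equations satisfied by `e^{i lam t} v` for the Jost solution `v`. -/
structure IsVolterra (q : ℝ → ℂ) (lam : ℂ) (x w : ℝ → ℂ) : Prop where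
  cont_x : Continuous x
  cont_w : Continuous w
  bdd : ∀ T, ∃ C, ∀ t ≤ T, ‖x t‖ ≤ C ∧ ‖w t‖ ≤ C
  eq_x : ∀ t : ℝ, x t = 1 + ∫ s in Set.Iic t, q s * w s
  eq_w : ∀ t : ℝ, w t =
    -∫ s in Set.Iic t, exp (2 * I * lam * (t - s)) * ((starRingEnd ℂ) (q s) * x s)

theorem integrable_conj (hq : Integrable q volume) :
    Integrable (fun s => (starRingEnd ℂ) (q s)) volume :=
  Complex.conjCLE.toContinuousLinearMap.integrable_comp hq

theorem norm_setIntegral_Iic_le (hq : Integrable q volume) {h : ℝ → ℂ} {t C : ℝ} {n : ℕ}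
    (hh : ∀ s ≤ t, ‖h s‖ ≤ C * (‖q s‖ * cumNorm q s ^ n)) (hC : 0 ≤ C) :
    ‖∫ s in Set.Iic t, h s‖ ≤ C * (cumNorm q t ^ (n + 1) / (n + 1)) := by
  refine (norm_integral_le_of_norm_le
    (((integrable_norm_mul_cumNorm_pow hq n).const_mul C).integrableOn) ?_).trans ?_
  · filter_upwards [ae_restrict_mem measurableSet_Iic] with s hs using hh s hs
  · rw [integral_const_mul]
    exact mul_le_mul_of_nonneg_left (setIntegral_norm_mul_cumNorm_pow_le hq n t) hC

theorem div_factorial_succ (c : ℝ) (n : ℕ) :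
    1 / (n.factorial : ℝ) * (c / (n + 1)) = c / ((n + 1).factorial : ℝ) := by
  rw [Nat.factorial_succ]
  push_cast
  field_simp

/-- Inserting the equations into themselves `n` times bounds the difference of two solutions by a
constant times `cumNorm q ^ n / n!`, which tends to zero. Boundedness on left half-lines starts the
iteration. -/
theorem IsVolterra.unique (hq : Integrable q volume) {lam : ℂ} (hl : 0 ≤ lam.im)
    {x w x' w' : ℝ → ℂ} (h : IsVolterra q lam x w) (h' : IsVolterra q lam x' w') :
    x = x' ∧ w = w' := by
  have key : ∀ T : ℝ, x T = x' T ∧ w T = w' T := by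
    intro T
    obtain ⟨C, hC⟩ := h.bdd T
    obtain ⟨C', hC'⟩ := h'.bdd T
    have hCn : 0 ≤ C + C' := add_nonneg ((norm_nonneg _).trans (hC T le_rfl).1)
      ((norm_nonneg _).trans (hC' T le_rfl).1)
    have hb : ∀ n : ℕ, ∀ t ≤ T, ‖x t - x' t‖ ≤ (C + C') * (cumNorm q t ^ n / n.factorial) ∧
        ‖w t - w' t‖ ≤ (C + C') * (cumNorm q t ^ n / n.factorial) := by
      intro n
      induction n with
      | zero =>
        intro t ht
        simp only [pow_zero, Nat.factorial_zero, Nat.cast_one, div_one, mul_one]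
        exact ⟨(norm_sub_le _ _).trans (add_le_add (hC t ht).1 (hC' t ht).1),
          (norm_sub_le _ _).trans (add_le_add (hC t ht).2 (hC' t ht).2)⟩
      | succ n ih =>
        intro t ht
        obtain ⟨D, hD⟩ := h.bdd t
        obtain ⟨D', hD'⟩ := h'.bdd t
        rw [← div_factorial_succ, ← mul_assoc]
        constructor
        · rw [h.eq_x, h'.eq_x, add_sub_add_left_eq_sub, ← integral_sub
            (integrableOn_Iic_mul hq h.cont_w fun s hs => (hD s hs).2)
            (integrableOn_Iic_mul hq h'.cont_w fun s hs => (hD' s hs).2)]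
          refine norm_setIntegral_Iic_le hq (fun s hs => ?_) (by positivity)
          rw [← mul_sub, norm_mul]
          calc ‖q s‖ * ‖w s - w' s‖
              ≤ ‖q s‖ * ((C + C') * (cumNorm q s ^ n / n.factorial)) := by
                gcongr; exact (ih s (hs.trans ht)).2
            _ = _ := by ring
        · rw [h.eq_w, h'.eq_w, setIntegral_exp_sub_mul, setIntegral_exp_sub_mul, neg_sub_neg,
            ← mul_sub, ← integral_sub
              (integrableOn_Iic_exp_mul hl (integrableOn_Iic_mul (integrable_conj hq) h'.cont_x
                fun s hs => (hD' s hs).1))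
              (integrableOn_Iic_exp_mul hl (integrableOn_Iic_mul (integrable_conj hq) h.cont_x
                fun s hs => (hD s hs).1)),
            ← integral_const_mul]
          refine norm_setIntegral_Iic_le hq (fun s hs => ?_) (by positivity)
          have e : exp (2 * I * lam * t) *
              (exp (-2 * I * lam * s) * ((starRingEnd ℂ) (q s) * x' s) -
                exp (-2 * I * lam * s) * ((starRingEnd ℂ) (q s) * x s)) =
              exp (2 * I * lam * (t - s)) * (starRingEnd ℂ (q s) * (x' s - x s)) := by
            have : exp (2 * I * lam * (t - s)) =
                exp (2 * I * lam * t) * exp (-2 * I * lam * s) := by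
              rw [← Complex.exp_add]; ring_nf
            rw [this]; ring
          rw [e, norm_mul, norm_mul, RCLike.norm_conj, norm_sub_rev]
          calc ‖exp (2 * I * lam * (t - s))‖ * (‖q s‖ * ‖x s - x' s‖)
              ≤ 1 * (‖q s‖ * ((C + C') * (cumNorm q s ^ n / n.factorial))) := by
                gcongr
                · exact norm_exp_two_I_mul_le hl hs
                · exact (ih s (hs.trans ht)).1
            _ = _ := by ring
    have hlim : Tendsto (fun n : ℕ => (C + C') * (cumNorm q T ^ n / n.factorial)) atTop (𝓝 0) := by
      simpa using (FloorSemiring.tendsto_pow_div_factorial_atTop (cumNorm q T)).const_mul (C + C')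
    constructor
    · refine sub_eq_zero.1 (norm_le_zero_iff.1 (ge_of_tendsto' hlim fun n => (hb n T le_rfl).1))
    · refine sub_eq_zero.1 (norm_le_zero_iff.1 (ge_of_tendsto' hlim fun n => (hb n T le_rfl).2))
  exact ⟨funext fun t => (key t).1, funext fun t => (key t).2⟩

/-! ### The Neumann series -/

/-- The alternating kernels of the Volterra system. -/
def volterraKernel (q : ℝ → ℂ) (k : ℕ) (lam : ℂ) (t s : ℝ) : ℂ :=
  -- Even terms of the series belong to `x` and odd ones to `w`, so an even `k` calls for the kernel
  -- of the equation for `w`.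
  if Even k then -(exp (2 * I * lam * (t - s)) * (starRingEnd ℂ) (q s)) else q s

/-- The terms of the Neumann series of the Volterra system. -/
def jostSeries (q : ℝ → ℂ) : ℕ → ℝ → ℂ → ℂ
  | 0, _, _ => 1
  | k + 1, t, lam => ∫ s in Set.Iic t, volterraKernel q k lam t s * jostSeries q k s lam

theorem norm_volterraKernel_le (q : ℝ → ℂ) (k : ℕ) {lam : ℂ} (hl : 0 ≤ lam.im) {s t : ℝ}
    (h : s ≤ t) : ‖volterraKernel q k lam t s‖ ≤ ‖q s‖ := by
  unfold volterraKernel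
  split_ifs
  · rw [norm_neg, norm_mul, RCLike.norm_conj]
    exact mul_le_of_le_one_left (norm_nonneg _) (norm_exp_two_I_mul_le hl h)
  · exact le_rfl

theorem aestronglyMeasurable_volterraKernel (hq : Integrable q volume) (k : ℕ) (lam : ℂ) (t : ℝ) :
    AEStronglyMeasurable (volterraKernel q k lam t) volume := by
  unfold volterraKernel
  split_ifs
  · exact ((by fun_prop : Continuous fun s : ℝ =>
      exp (2 * I * lam * (t - s))).aestronglyMeasurable.mul (integrable_conj hq).1).neg
  · exact hq.1

theorem hol_volterraKernel (q : ℝ → ℂ) (k : ℕ) (t s : ℝ) :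
    Hol fun lam => volterraKernel q k lam t s := by
  unfold volterraKernel
  split_ifs
  · exact .of_differentiable (by fun_prop)
  · exact .const _

theorem continuous_volterraKernel_integral (hq : Integrable q volume) (k : ℕ) {lam : ℂ}
    (hl : 0 ≤ lam.im) {φ : ℝ → ℂ} (hφ : Continuous φ) {C : ℝ} (hC : ∀ t, ‖φ t‖ ≤ C) :
    Continuous fun t => ∫ s in Set.Iic t, volterraKernel q k lam t s * φ s := by
  unfold volterraKernel
  split_ifs
  · have := (continuous_setIntegral_exp_mul hl fun T =>
      integrableOn_Iic_mul (T := T) (integrable_conj hq) hφ fun s _ => hC s).neg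
    simp only [neg_mul, mul_assoc, integral_neg] at this ⊢
    exact this
  · exact continuous_setIntegral_Iic fun T => integrableOn_Iic_mul hq hφ fun s _ => hC s

/-- The three properties are proved together because holomorphy of the next term uses continuity of
the present one for measurability and its bound for domination. -/
theorem jostSeries_spec (hq : Integrable q volume) (k : ℕ) :
    (∀ lam : ℂ, 0 ≤ lam.im → Continuous fun t => jostSeries q k t lam) ∧
    (∀ (t : ℝ) (lam : ℂ), 0 ≤ lam.im →
      ‖jostSeries q k t lam‖ ≤ cumNorm q t ^ k / k.factorial) ∧
    ∀ t, Hol fun lam => jostSeries q k t lam := by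
  induction k with
  | zero => simpa [jostSeries] using ⟨fun _ _ => continuous_const, Hol.const 1⟩
  | succ k ih =>
    obtain ⟨h1, h2, h3⟩ := ih
    have hb : ∀ (t : ℝ) (lam : ℂ), 0 ≤ lam.im → ∀ s ≤ t,
        ‖volterraKernel q k lam t s * jostSeries q k s lam‖ ≤
          1 / (k.factorial : ℝ) * (‖q s‖ * cumNorm q s ^ k) := by
      intro t lam hl s hs
      rw [norm_mul]
      calc _ ≤ ‖q s‖ * (cumNorm q s ^ k / k.factorial) := by
            gcongr
            · exact norm_volterraKernel_le q k hl hs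
            · exact h2 s lam hl
        _ = _ := by ring
    refine ⟨fun lam hl => ?_, fun t lam hl => ?_, fun t => ?_⟩
    · refine continuous_volterraKernel_integral hq k hl (h1 lam hl)
        (C := (∫ s, ‖q s‖) ^ k / k.factorial) fun t => (h2 t lam hl).trans ?_
      gcongr
      · exact cumNorm_nonneg q t
      · exact cumNorm_le hq t
    · rw [← div_factorial_succ]
      exact norm_setIntegral_Iic_le hq (hb t lam hl) (by positivity)
    · refine Hol.integral (fun z hz => ?_) ?_
        (((integrable_norm_mul_cumNorm_pow hq k).const_mul (1 / (k.factorial : ℝ))).integrableOn) ?_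
      · exact (aestronglyMeasurable_volterraKernel hq k z t).restrict.mul
          (h1 z hz).aestronglyMeasurable
      · filter_upwards [ae_restrict_mem measurableSet_Iic] with s hs z hz using hb t z hz s hs
      · exact Eventually.of_forall fun s => (hol_volterraKernel q k t s).mul (h3 s)

theorem norm_jostSeries_le (hq : Integrable q volume) (k : ℕ) (t : ℝ) {lam : ℂ}
    (hl : 0 ≤ lam.im) : ‖jostSeries q k t lam‖ ≤ (∫ s, ‖q s‖) ^ k / k.factorial := by
  refine ((jostSeries_spec hq k).2.1 t lam hl).trans ?_
  gcongr
  · exact cumNorm_nonneg q t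
  · exact cumNorm_le hq t

/-- The first component of `e^{i lam t} v(t, lam)`. -/
def jostX (q : ℝ → ℂ) (t : ℝ) (lam : ℂ) : ℂ := ∑' n : ℕ, jostSeries q (2 * n) t lam

/-- The second component of `e^{i lam t} v(t, lam)`. -/
def jostW (q : ℝ → ℂ) (t : ℝ) (lam : ℂ) : ℂ := ∑' n : ℕ, jostSeries q (2 * n + 1) t lam

theorem summable_even (c : ℝ) : Summable fun n : ℕ => c ^ (2 * n) / (2 * n).factorial :=
  (Real.summable_pow_div_factorial c).comp_injective
    (i := fun n : ℕ => 2 * n) fun _ _ h => by simpa using h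

theorem summable_odd (c : ℝ) : Summable fun n : ℕ => c ^ (2 * n + 1) / (2 * n + 1).factorial :=
  (Real.summable_pow_div_factorial c).comp_injective
    (i := fun n : ℕ => 2 * n + 1) fun _ _ h => by simpa using h

theorem hol_jostX (hq : Integrable q volume) (t : ℝ) : Hol (jostX q t) :=
  Hol.tsum (fun n => (jostSeries_spec hq (2 * n)).2.2 t) (summable_even _)
    fun n _ hz => norm_jostSeries_le hq (2 * n) t hz

theorem hol_jostW (hq : Integrable q volume) (t : ℝ) : Hol (jostW q t) :=
  Hol.tsum (fun n => (jostSeries_spec hq (2 * n + 1)).2.2 t) (summable_odd _)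
    fun n _ hz => norm_jostSeries_le hq (2 * n + 1) t hz

theorem continuous_jostX (hq : Integrable q volume) {lam : ℂ} (hl : 0 ≤ lam.im) :
    Continuous fun t => jostX q t lam :=
  continuous_tsum (fun n => (jostSeries_spec hq (2 * n)).1 lam hl) (summable_even _)
    fun n t => norm_jostSeries_le hq (2 * n) t hl

theorem continuous_jostW (hq : Integrable q volume) {lam : ℂ} (hl : 0 ≤ lam.im) :
    Continuous fun t => jostW q t lam :=
  continuous_tsum (fun n => (jostSeries_spec hq (2 * n + 1)).1 lam hl) (summable_odd _)
    fun n t => norm_jostSeries_le hq (2 * n + 1) t hl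

theorem norm_tsum_jostSeries_le (hq : Integrable q volume) {i : ℕ → ℕ} (hi : i.Injective) (t : ℝ)
    {lam : ℂ} (hl : 0 ≤ lam.im) :
    ‖∑' n, jostSeries q (i n) t lam‖ ≤ Real.exp (∫ s, ‖q s‖) := by
  have hs := Real.summable_pow_div_factorial (∫ s, ‖q s‖)
  refine (tsum_of_norm_bounded (hs.comp_injective hi).hasSum fun n =>
    norm_jostSeries_le hq (i n) t hl).trans ?_
  rw [Real.exp_eq_exp_ℝ, NormedSpace.exp_eq_tsum_div]
  exact tsum_comp_le_tsum_of_inj hs (fun n => by positivity) hi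

theorem norm_jostX_le (hq : Integrable q volume) (t : ℝ) {lam : ℂ} (hl : 0 ≤ lam.im) :
    ‖jostX q t lam‖ ≤ Real.exp (∫ s, ‖q s‖) :=
  norm_tsum_jostSeries_le hq (i := fun n : ℕ => 2 * n) (fun _ _ h => by simpa using h) t hl

theorem norm_jostW_le (hq : Integrable q volume) (t : ℝ) {lam : ℂ} (hl : 0 ≤ lam.im) :
    ‖jostW q t lam‖ ≤ Real.exp (∫ s, ‖q s‖) :=
  norm_tsum_jostSeries_le hq (i := fun n : ℕ => 2 * n + 1) (fun _ _ h => by simpa using h) t hl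

/-- Termwise integration is allowed since the `L¹` norms are dominated by a subseries of an
exponential series. The injection `i` selects the even or the odd indices. -/
theorem hasSum_integral_jostSeries (hq : Integrable q volume) {i : ℕ → ℕ} (hi : i.Injective)
    (t : ℝ) {lam : ℂ} (hl : 0 ≤ lam.im) {K : ℝ → ℂ} (hK : AEStronglyMeasurable K volume)
    (hKb : ∀ s ≤ t, ‖K s‖ ≤ ‖q s‖) :
    HasSum (fun n => ∫ s in Set.Iic t, K s * jostSeries q (i n) s lam)
      (∫ s in Set.Iic t, K s * ∑' n, jostSeries q (i n) s lam) := by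
  simp only [← tsum_mul_left]
  have hb : ∀ n, ∀ᵐ s ∂(volume.restrict (Set.Iic t)), ‖K s * jostSeries q (i n) s lam‖ ≤
      ‖q s‖ * ((∫ s, ‖q s‖) ^ (i n) / (i n).factorial) := by
    intro n
    filter_upwards [ae_restrict_mem measurableSet_Iic] with s hs
    rw [norm_mul]
    gcongr
    · exact hKb s hs
    · exact norm_jostSeries_le hq (i n) s hl
  have hint : ∀ n, IntegrableOn (fun s => K s * jostSeries q (i n) s lam) (Set.Iic t) := fun n =>
    (hq.norm.integrableOn.mul_const _).mono'
      (hK.restrict.mul ((jostSeries_spec hq (i n)).1 lam hl).aestronglyMeasurable) (hb n)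
  refine hasSum_integral_of_summable_integral_norm hint ?_
  refine Summable.of_nonneg_of_le (fun n => integral_nonneg fun _ => norm_nonneg _) (fun n => ?_)
    (((Real.summable_pow_div_factorial (∫ s, ‖q s‖)).comp_injective hi).mul_left (cumNorm q t))
  refine (integral_mono_ae (hint n).norm (hq.norm.integrableOn.mul_const _) (hb n)).trans ?_
  rw [integral_mul_const]
  exact le_rfl

theorem isVolterra_jost (hq : Integrable q volume) {lam : ℂ} (hl : 0 ≤ lam.im) :
    IsVolterra q lam (fun t => jostX q t lam) (fun t => jostW q t lam) := by
  refine ⟨continuous_jostX hq hl, continuous_jostW hq hl, fun T => ⟨_, fun t _ =>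
    ⟨norm_jostX_le hq t hl, norm_jostW_le hq t hl⟩⟩, fun t => ?_, fun t => ?_⟩
  · have h := hasSum_integral_jostSeries hq (i := fun n : ℕ => 2 * n + 1)
      (fun _ _ h => by simpa using h) t hl hq.1 fun s _ => le_rfl
    have hs : Summable fun n : ℕ => jostSeries q (2 * n) t lam :=
      Summable.of_norm_bounded (summable_even _) fun n => norm_jostSeries_le hq (2 * n) t hl
    -- The term of index zero is the inhomogeneity `1`; every later even term is the integral of `q`
    -- against the preceding odd term.
    rw [jostX, hs.tsum_eq_zero_add]
    congr 1
    refine Eq.trans ?_ h.tsum_eq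
    refine tsum_congr fun n => ?_
    rw [show 2 * (n + 1) = (2 * n + 1) + 1 by ring, jostSeries]
    simp [volterraKernel]
  · have h := hasSum_integral_jostSeries hq (i := fun n : ℕ => 2 * n)
      (fun _ _ h => by simpa using h) t hl (aestronglyMeasurable_volterraKernel hq 0 lam t)
      fun s hs => norm_volterraKernel_le q 0 hl hs
    rw [jostW]
    simp only [jostSeries]
    have e : ∀ n s, volterraKernel q (2 * n) lam t s = volterraKernel q 0 lam t s := by
      intro n s; simp [volterraKernel]
    simp only [e]
    rw [h.tsum_eq, ← integral_neg]
    congr 1 with s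
    simp [volterraKernel, jostX, mul_assoc]

/-! ### The Volterra system and the Zakharov-Shabat system -/

theorem IsVolterra.isPrim_x (hq : Integrable q volume) {lam : ℂ} {x w : ℝ → ℂ}
    (h : IsVolterra q lam x w) (a b : ℝ) : IsPrim x (fun t => q t * w t) a b := by
  have hint : ∀ T, IntegrableOn (fun s => q s * w s) (Set.Iic T) := fun T => by
    obtain ⟨C, hC⟩ := h.bdd T
    exact integrableOn_Iic_mul hq h.cont_w fun t ht => (hC t ht).2
  refine IsPrim.of_forall (intervalIntegrable_of_Iic hint a b) fun s t => ?_
  rw [h.eq_x, h.eq_x s, add_sub_add_left_eq_sub, setIntegral_Iic_sub hint]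

/-- The factor `e^{-2iλt}` cancels the `t`-dependence of the kernel, so that `u₂` is a plain
primitive, unlike `w`. -/
theorem IsVolterra.eq_u {lam : ℂ} {x w : ℝ → ℂ} (h : IsVolterra q lam x w) (t : ℝ) :
    exp (-2 * I * lam * t) * w t =
      ∫ s in Set.Iic t, -(exp (-2 * I * lam * s) * ((starRingEnd ℂ) (q s) * x s)) := by
  rw [h.eq_w, setIntegral_exp_sub_mul, integral_neg, mul_neg, ← mul_assoc, ← Complex.exp_add]
  ring_nf
  simp

theorem IsVolterra.integrableOn_u (hq : Integrable q volume) {lam : ℂ} (hl : 0 ≤ lam.im)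
    {x w : ℝ → ℂ} (h : IsVolterra q lam x w) (T : ℝ) :
    IntegrableOn (fun s : ℝ => -(exp (-2 * I * lam * s) * ((starRingEnd ℂ) (q s) * x s)))
      (Set.Iic T) := by
  obtain ⟨C, hC⟩ := h.bdd T
  exact (integrableOn_Iic_exp_mul hl
    (integrableOn_Iic_mul (integrable_conj hq) h.cont_x fun t ht => (hC t ht).1)).neg

theorem IsVolterra.isPrim_u (hq : Integrable q volume) {lam : ℂ} (hl : 0 ≤ lam.im)
    {x w : ℝ → ℂ} (h : IsVolterra q lam x w) (a b : ℝ) :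
    IsPrim (fun t : ℝ => exp (-2 * I * lam * t) * w t)
      (fun s => -(exp (-2 * I * lam * s) * ((starRingEnd ℂ) (q s) * x s))) a b := by
  have hint := h.integrableOn_u hq hl
  refine IsPrim.of_forall (intervalIntegrable_of_Iic hint a b) fun s t => ?_
  rw [h.eq_u, h.eq_u s, setIntegral_Iic_sub hint]

theorem zsMatrix_mulVec (q : ℝ → ℂ) (lam : ℂ) (t : ℝ) (v : Fin 2 → ℂ) :
    zsMatrix q lam t *ᵥ v =
      ![-I * lam * v 0 + q t * v 1, -(starRingEnd ℂ) (q t) * v 0 + I * lam * v 1] := by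
  ext i
  fin_cases i <;> simp [zsMatrix, Matrix.mulVec, dotProduct, Fin.sum_univ_two]

theorem intervalIntegral_pair {f g : ℝ → ℂ} {s t : ℝ} (hf : IntervalIntegrable f volume s t)
    (hg : IntervalIntegrable g volume s t) :
    ∫ r in s..t, ![f r, g r] = ![∫ r in s..t, f r, ∫ r in s..t, g r] := by
  have hi : IntervalIntegrable (fun r => ![f r, g r]) volume s t := by
    rw [intervalIntegrable_iff] at *
    refine Integrable.of_eval fun i => ?_
    fin_cases i
    exacts [hf, hg]
  ext i
  have := (ContinuousLinearMap.proj (R := ℂ) (φ := fun _ : Fin 2 => ℂ) i).intervalIntegral_comp_comm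
    hi
  refine this.symm.trans ?_
  fin_cases i <;> rfl

theorem intervalIntegrable_zs (hq : Integrable q volume) (lam : ℂ) {v : ℝ → Fin 2 → ℂ}
    (hv : Continuous v) (s t : ℝ) :
    IntervalIntegrable (fun r => -I * lam * v r 0 + q r * v r 1) volume s t ∧
    IntervalIntegrable (fun r => -(starRingEnd ℂ) (q r) * v r 0 + I * lam * v r 1) volume s t := by
  have h0 : Continuous fun r => v r 0 := (continuous_apply 0).comp hv
  have h1 : Continuous fun r => v r 1 := (continuous_apply 1).comp hv
  exact ⟨((continuous_const.mul h0).intervalIntegrable _ _).add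
      (hq.intervalIntegrable.mul_continuousOn h1.continuousOn),
    ((integrable_conj hq).intervalIntegrable.neg.mul_continuousOn h0.continuousOn).add
      ((continuous_const.mul h1).intervalIntegrable _ _)⟩

theorem exists_bound_of_tendsto_atBot {f : ℝ → ℂ} (hf : Continuous f) {c : ℂ}
    (h : Tendsto f atBot (𝓝 c)) (T : ℝ) : ∃ C, ∀ t ≤ T, ‖f t‖ ≤ C := by
  obtain ⟨A, hA⟩ := eventually_atBot.1
    (h.norm.eventually (ge_mem_nhds (lt_add_one ‖c‖)))
  obtain ⟨C, hC⟩ := (isCompact_Icc (a := A) (b := T)).exists_bound_of_continuousOn hf.continuousOn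
  refine ⟨max C (‖c‖ + 1), fun t ht => ?_⟩
  rcases le_total t A with h1 | h1
  · exact (hA t h1).trans (le_max_right _ _)
  · exact (hC t ⟨h1, ht⟩).trans (le_max_left _ _)

/-- Multiply the components by the integrating factors `e^{iλt}` and `e^{-iλt}`, integrate over `[s,
t]` and let `s → -∞`. In the equation for `w` the boundary term disappears because `e^{2iλ(t-s)}` is
bounded by one while `e^{iλs} v₂(s) → 0`. -/
theorem IsJost.isVolterra (hq : Integrable q volume) {lam : ℂ} (hl : 0 ≤ lam.im)
    {v : ℝ → Fin 2 → ℂ} (h : IsJost q lam v) :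
    IsVolterra q lam (fun t => exp (I * lam * t) * v t 0) (fun t => exp (I * lam * t) * v t 1) := by
  have c0 : Continuous fun t => v t 0 := (continuous_apply 0).comp h.cont
  have c1 : Continuous fun t => v t 1 := (continuous_apply 1).comp h.cont
  have ce : Continuous fun t : ℝ => exp (I * lam * t) := by fun_prop
  have hb0 : Tendsto (fun t : ℝ => exp (I * lam * t) * v t 0) atBot (𝓝 1) :=
    (tendsto_pi_nhds.1 h.bc) 0
  have hb1 : Tendsto (fun t : ℝ => exp (I * lam * t) * v t 1) atBot (𝓝 0) :=
    (tendsto_pi_nhds.1 h.bc) 1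
  have hB : ∀ T : ℝ, ∃ C, ∀ t : ℝ, t ≤ T → ‖exp (I * lam * t) * v t 0‖ ≤ C ∧
      ‖exp (I * lam * t) * v t 1‖ ≤ C := fun T => by
    obtain ⟨C, hC⟩ := exists_bound_of_tendsto_atBot (ce.mul c0) hb0 T
    obtain ⟨D, hD⟩ := exists_bound_of_tendsto_atBot (ce.mul c1) hb1 T
    exact ⟨max C D, fun t ht => ⟨(hC t ht).trans (le_max_left _ _),
      (hD t ht).trans (le_max_right _ _)⟩⟩
  have heq : ∀ s t, v t 0 - v s 0 = (∫ r in s..t, -I * lam * v r 0 + q r * v r 1) ∧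
      v t 1 - v s 1 = ∫ r in s..t, -(starRingEnd ℂ) (q r) * v r 0 + I * lam * v r 1 := by
    intro s t
    have h1 := h.eqn s t
    simp only [zsMatrix_mulVec] at h1
    rw [intervalIntegral_pair (intervalIntegrable_zs hq lam h.cont s t).1
      (intervalIntegrable_zs hq lam h.cont s t).2] at h1
    exact ⟨congrFun h1 0, congrFun h1 1⟩
  have p0 : ∀ s t, IsPrim (fun t => v t 0) _ s t := fun s t =>
    IsPrim.of_forall (intervalIntegrable_zs hq lam h.cont s t).1 fun s t => (heq s t).1
  have p1 : ∀ s t, IsPrim (fun t => v t 1) _ s t := fun s t =>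
    IsPrim.of_forall (intervalIntegrable_zs hq lam h.cont s t).2 fun s t => (heq s t).2
  refine ⟨ce.mul c0, ce.mul c1, hB, fun t => ?_, fun t => ?_⟩
  · obtain ⟨C, hC⟩ := hB t
    have hint : IntegrableOn (fun s => q s * (exp (I * lam * s) * v s 1)) (Set.Iic t) :=
      integrableOn_Iic_mul hq (ce.mul c1) fun s hs => (hC s hs).2
    have l1 := intervalIntegral_tendsto_integral_Iic t hint tendsto_id
    have l2 := hb0.const_sub (exp (I * lam * t) * v t 0)
    have := tendsto_nhds_unique (l1.congr fun s => ?_) l2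
    · rw [this]; ring
    · rw [id, ((isPrim_exp (I * lam) s t).mul (p0 s t)).sub_eq]
      congr 1 with r
      ring
  · obtain ⟨C, hC⟩ := hB t
    have hint : IntegrableOn (fun s : ℝ => exp (-2 * I * lam * s) *
        ((starRingEnd ℂ) (q s) * (exp (I * lam * s) * v s 0))) (Set.Iic t) :=
      integrableOn_Iic_exp_mul hl (integrableOn_Iic_mul (integrable_conj hq)
        (ce.mul c0) fun s hs => (hC s hs).1)
    have l1 := (intervalIntegral_tendsto_integral_Iic t hint tendsto_id).const_mul
      (exp (2 * I * lam * t))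
    have l2 : Tendsto (fun s : ℝ => -(exp (I * lam * t) * v t 1 -
        exp (2 * I * lam * (t - s)) * (exp (I * lam * s) * v s 1))) atBot
        (𝓝 (-(exp (I * lam * t) * v t 1 - 0))) := by
      refine (Tendsto.const_sub _ ?_).neg
      refine squeeze_zero_norm' (a := fun s : ℝ => ‖exp (I * lam * s) * v s 1‖) ?_
        (by simpa using hb1.norm)
      filter_upwards [eventually_le_atBot t] with s hs
      rw [norm_mul]
      exact mul_le_of_le_one_left (norm_nonneg _) (norm_exp_two_I_mul_le hl hs)
    have := tendsto_nhds_unique (l1.congr fun s => ?_) l2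
    · rw [setIntegral_exp_sub_mul, this]; ring
    · have h1 := ((isPrim_exp (-I * lam) s t).mul (p1 s t)).sub_eq
      have e : ∀ r : ℝ, exp (-2 * I * lam * r) * ((starRingEnd ℂ) (q r) *
          (exp (I * lam * r) * v r 0)) = -(-I * lam * exp (-I * lam * r) * v r 1 +
            exp (-I * lam * r) * (-(starRingEnd ℂ) (q r) * v r 0 + I * lam * v r 1)) := by
        intro r
        have : exp (-I * lam * r) = exp (-2 * I * lam * r) * exp (I * lam * r) := by
          rw [← Complex.exp_add]; ring_nf
        rw [this]; ring
      simp only [id, e, intervalIntegral.integral_neg]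
      rw [← h1]
      have e1 : exp (I * lam * t) = exp (2 * I * lam * t) * exp (-I * lam * t) := by
        rw [← Complex.exp_add]; ring_nf
      have e2 : exp (2 * I * lam * (t - s)) * exp (I * lam * s) =
          exp (2 * I * lam * t) * exp (-I * lam * s) := by
        rw [← Complex.exp_add, ← Complex.exp_add]; ring_nf
      rw [← mul_assoc (exp (2 * I * lam * (t - s))), e2, e1]
      ring

theorem tendsto_cumNorm_atBot (q : ℝ → ℂ) : Tendsto (cumNorm q) atBot (𝓝 0) :=
  tendsto_integral_Iic_zero (f := fun s => ‖q s‖) tendsto_id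

theorem IsVolterra.tendsto_w (hq : Integrable q volume) {lam : ℂ} (hl : 0 ≤ lam.im)
    {x w : ℝ → ℂ} (h : IsVolterra q lam x w) : Tendsto w atBot (𝓝 0) := by
  obtain ⟨C, hC⟩ := h.bdd 0
  have hC0 : 0 ≤ C := (norm_nonneg _).trans (hC 0 le_rfl).1
  refine squeeze_zero_norm' (a := fun t => C * (cumNorm q t ^ (0 + 1) / (((0 : ℕ) : ℝ) + 1))) ?_ ?_
  · filter_upwards [eventually_le_atBot 0] with t ht
    rw [h.eq_w, norm_neg]
    refine norm_setIntegral_Iic_le hq (fun s hs => ?_) hC0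
    rw [norm_mul, norm_mul, RCLike.norm_conj, pow_zero, mul_one]
    calc _ ≤ 1 * (‖q s‖ * C) := by
          gcongr
          · exact norm_exp_two_I_mul_le hl hs
          · exact (hC s (hs.trans ht)).1
      _ = _ := by ring
  · simpa using (tendsto_cumNorm_atBot q).const_mul C

theorem IsVolterra.isJost (hq : Integrable q volume) {lam : ℂ} (hl : 0 ≤ lam.im)
    {x w : ℝ → ℂ} (h : IsVolterra q lam x w) :
    IsJost q lam fun t => exp (-I * lam * t) • ![x t, w t] := by
  have ce : Continuous fun t : ℝ => exp (-I * lam * t) := by fun_prop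
  have cv : Continuous fun t : ℝ => exp (-I * lam * t) • ![x t, w t] := by
    refine ce.smul (continuous_pi fun i => ?_)
    fin_cases i
    exacts [h.cont_x, h.cont_w]
  refine ⟨cv, fun s t => ?_, ?_⟩
  · simp only [zsMatrix_mulVec]
    rw [intervalIntegral_pair (intervalIntegrable_zs hq lam cv s t).1
      (intervalIntegrable_zs hq lam cv s t).2]
    have h0 := ((isPrim_exp (-I * lam) s t).mul (h.isPrim_x hq s t)).sub_eq
    have h1 := ((isPrim_exp (I * lam) s t).mul (h.isPrim_u hq hl s t)).sub_eq
    have e : ∀ r : ℝ, exp (-I * lam * r) = exp (I * lam * r) * exp (-2 * I * lam * r) := by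
      intro r; rw [← Complex.exp_add]; ring_nf
    ext i
    fin_cases i
    · simp only [Fin.zero_eta, Pi.sub_apply, Pi.smul_apply, cons_val_zero, cons_val_one,
        smul_eq_mul]
      rw [h0]
      congr 1 with r
      ring
    · simp only [Fin.mk_one, Pi.sub_apply, Pi.smul_apply, cons_val_zero, cons_val_one,
        smul_eq_mul]
      rw [e t, e s, mul_assoc _ _ (w t), mul_assoc _ _ (w s), h1]
      congr 1 with r
      rw [e r]
      ring
  · have e : (fun t : ℝ => exp (I * lam * t) • exp (-I * lam * t) • ![x t, w t]) =
        fun t => ![x t, w t] := by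
      ext1 t
      rw [smul_smul, ← Complex.exp_add]
      simp
    rw [e, tendsto_pi_nhds]
    intro i
    fin_cases i
    · change Tendsto x atBot (𝓝 1)
      have : x = fun t => 1 + ∫ s in Set.Iic t, q s * w s := funext h.eq_x
      rw [this]
      simpa using (tendsto_integral_Iic_zero (f := fun s => q s * w s)
        (tendsto_id (x := (atBot : Filter ℝ)))).const_add 1
    · exact h.tendsto_w hq hl

theorem existsUnique_isJost (hq : Integrable q volume) {lam : ℂ} (hl : 0 ≤ lam.im) :
    ∃! v, IsJost q lam v := by
  refine ⟨_, (isVolterra_jost hq hl).isJost hq hl, fun v hv => ?_⟩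
  obtain ⟨h0, h1⟩ := (hv.isVolterra hq hl).unique hq hl (isVolterra_jost hq hl)
  ext t i
  have e : exp (-(I * lam * t)) * exp (I * lam * t) = 1 := by
    rw [← Complex.exp_add]; simp
  fin_cases i
  · have := congrFun h0 t
    simp [← this, ← mul_assoc, e]
  · have := congrFun h1 t
    simp [← this, ← mul_assoc, e]

/-- Uniqueness identifies the solution picked by choice with the Neumann series, so later arguments
can work with `jostX` and `jostW`. -/
theorem jost_eq (hq : Integrable q volume) {lam : ℂ} (hl : 0 ≤ lam.im) (t : ℝ) :
    jost q lam t = exp (-I * lam * t) • ![jostX q t lam, jostW q t lam] := by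
  have hex : ∃ v, IsJost q lam v := (existsUnique_isJost hq hl).exists
  have h1 : IsJost q lam (jost q lam) := by
    rw [jost, dif_pos hex]
    exact hex.choose_spec
  exact congrFun ((existsUnique_isJost hq hl).unique h1
    ((isVolterra_jost hq hl).isJost hq hl)) t

theorem u1_eq (hq : Integrable q volume) {lam : ℂ} (hl : 0 ≤ lam.im) (t : ℝ) :
    u1 q t lam = jostX q t lam := by
  rw [u1, jost_eq hq hl]
  simp only [Pi.smul_apply, cons_val_zero, smul_eq_mul]
  rw [mul_right_comm, ← Complex.exp_add]
  simp

theorem u2_eq (hq : Integrable q volume) {lam : ℂ} (hl : 0 ≤ lam.im) (t : ℝ) :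
    u2 q t lam = exp (-2 * I * lam * t) * jostW q t lam := by
  rw [u2, jost_eq hq hl]
  simp only [Pi.smul_apply, cons_val_one, cons_val_zero, smul_eq_mul]
  rw [mul_right_comm, ← Complex.exp_add]
  congr 1
  ring_nf

/-! ### The spectral functions -/

theorem integrable_mul_of_bdd {p φ : ℝ → ℂ} (hp : Integrable p volume) (hφ : Continuous φ)
    {C : ℝ} (hC : ∀ t, ‖φ t‖ ≤ C) : Integrable (fun s => p s * φ s) volume :=
  hp.mul_bdd hφ.aestronglyMeasurable (Eventually.of_forall hC)

theorem tendsto_setIntegral_Iic_atTop {f : ℝ → ℂ} (hf : Integrable f volume) :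
    Tendsto (fun t => ∫ s in Set.Iic t, f s) atTop (𝓝 (∫ s, f s)) :=
  (aecover_Iic tendsto_id).integral_tendsto_of_countably_generated hf

theorem tendsto_jostX (hq : Integrable q volume) {lam : ℂ} (hl : 0 ≤ lam.im) :
    Tendsto (fun t => jostX q t lam) atTop (𝓝 (1 + ∫ s, q s * jostW q s lam)) := by
  have h := isVolterra_jost hq hl
  rw [funext h.eq_x]
  exact (tendsto_setIntegral_Iic_atTop (integrable_mul_of_bdd hq h.cont_w
    fun t => norm_jostW_le hq t hl)).const_add 1

theorem a_eq (hq : Integrable q volume) {lam : ℂ} (hl : 0 ≤ lam.im) :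
    a q lam = 1 + ∫ s, q s * jostW q s lam := by
  refine Tendsto.limUnder_eq ?_
  simp only [u1_eq hq hl]
  exact tendsto_jostX hq hl

theorem tendsto_jostX_a (hq : Integrable q volume) {lam : ℂ} (hl : 0 ≤ lam.im) :
    Tendsto (fun t => jostX q t lam) atTop (𝓝 (a q lam)) :=
  a_eq hq hl ▸ tendsto_jostX hq hl

theorem tendsto_u1 (hq : Integrable q volume) {lam : ℂ} (hl : 0 ≤ lam.im) :
    Tendsto (fun t => u1 q t lam) atTop (𝓝 (a q lam)) := by
  simp only [u1_eq hq hl]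
  exact tendsto_jostX_a hq hl

theorem hol_a (hq : Integrable q volume) : Hol (a q) := by
  refine Hol.congr ((Hol.const 1).add (Hol.integral (F := fun s lam => q s * jostW q s lam)
    (g := fun s => ‖q s‖ * Real.exp (∫ s, ‖q s‖)) ?_ ?_ (hq.norm.mul_const _) ?_))
    fun z hz => a_eq hq hz
  · exact fun z hz => hq.1.mul (continuous_jostW hq hz).aestronglyMeasurable
  · refine Eventually.of_forall fun s z hz => ?_
    rw [norm_mul]
    gcongr
    exact norm_jostW_le hq s hz
  · exact Eventually.of_forall fun s => (Hol.const _).mul (hol_jostW hq s)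

theorem hol_u2 (hq : Integrable q volume) (t : ℝ) : Hol (u2 q t) :=
  Hol.congr ((Hol.of_differentiable (f := fun lam => exp (-2 * I * lam * t)) (by fun_prop)).mul
    (hol_jostW hq t)) fun _ hz => u2_eq hq hz t

theorem norm_exp_real (lam t : ℝ) : ‖exp (-2 * I * lam * t)‖ = 1 := by
  rw [show (-2 * I * lam * t : ℂ) = ((-2 * lam * t : ℝ) : ℂ) * I by push_cast; ring,
    Complex.norm_exp_ofReal_mul_I]

theorem tendsto_u2 (hq : Integrable q volume) (lam : ℝ) :
    Tendsto (fun t => u2 q t lam) atTop (𝓝 (b q lam)) := by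
  have hl : 0 ≤ (lam : ℂ).im := by simp
  have h := isVolterra_jost hq hl
  -- For real `lam` the exponential has modulus one, so the integrand giving `u2` is integrable over
  -- the whole line.
  have hi : Integrable (fun s : ℝ => exp (-2 * I * lam * s) *
      ((starRingEnd ℂ) (q s) * jostX q s lam)) volume :=
    Integrable.bdd_mul (c := 1) (integrable_mul_of_bdd (integrable_conj hq) h.cont_x
      fun t => norm_jostX_le hq t hl) (by fun_prop : Continuous fun s : ℝ =>
        exp (-2 * I * lam * s)).aestronglyMeasurable
      (Eventually.of_forall fun s => (norm_exp_real lam s).le)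
  have ht := tendsto_setIntegral_Iic_atTop hi.neg
  simp only [Pi.neg_apply, ← h.eq_u, ← u2_eq hq hl] at ht
  exact tendsto_nhds_limUnder ⟨_, ht⟩

/-- On the real line the quantity `|u₁|² + |u₂|²` is conserved. -/
theorem normSq_jost_eq_one (hq : Integrable q volume) (lam t : ℝ) :
    ‖u1 q t lam‖ ^ 2 + ‖u2 q t lam‖ ^ 2 = 1 := by
  have hl : 0 ≤ (lam : ℂ).im := by simp
  have h := isVolterra_jost hq hl
  have hc : ∀ s : ℝ, jostX q t lam * (starRingEnd ℂ) (jostX q t lam) +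
      u2 q t lam * (starRingEnd ℂ) (u2 q t lam) =
      jostX q s lam * (starRingEnd ℂ) (jostX q s lam) +
      u2 q s lam * (starRingEnd ℂ) (u2 q s lam) := by
    intro s
    have hu := h.isPrim_u hq hl s t
    simp only [← u2_eq hq hl] at hu
    have hx := h.isPrim_x hq s t
    have := ((hx.mul hx.conj).add (hu.mul hu.conj)).sub_eq
    rw [← sub_eq_zero, this]
    refine intervalIntegral.integral_zero_ae (Eventually.of_forall fun r _ => ?_)
    -- This is where `lam` must be real: conjugation inverts the exponential, and the cross terms in
    -- the derivative cancel.
    have e1 : (starRingEnd ℂ) (exp (-2 * I * lam * r)) = exp (2 * I * lam * r) := by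
      rw [← Complex.exp_conj]
      simp [map_ofNat (starRingEnd ℂ) 2]
    have e2 : exp (-2 * I * lam * r) * exp (2 * I * lam * r) = 1 := by
      rw [← Complex.exp_add]; ring_nf; simp
    simp only [u2_eq hq hl, map_mul, map_neg, Complex.conj_conj, e1]
    linear_combination (-q r * jostW q r lam * (starRingEnd ℂ) (jostX q r lam)
      - jostX q r lam * (starRingEnd ℂ) (q r) * (starRingEnd ℂ) (jostW q r lam)) * e2
  have h1 : Tendsto (fun s => jostX q s lam) atBot (𝓝 1) := by
    rw [funext h.eq_x]
    simpa using (tendsto_integral_Iic_zero (f := fun s => q s * jostW q s lam)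
        (tendsto_id (x := (atBot : Filter ℝ)))).const_add 1
  have h2 : Tendsto (fun s => u2 q s lam) atBot (𝓝 0) := by
    refine squeeze_zero_norm (a := fun s => ‖jostW q s lam‖) (fun s => ?_)
      (by simpa using (h.tendsto_w hq hl).norm)
    rw [u2_eq hq hl, norm_mul, norm_exp_real, one_mul]
  have h3 : Tendsto (fun s => jostX q s lam * (starRingEnd ℂ) (jostX q s lam) +
      u2 q s lam * (starRingEnd ℂ) (u2 q s lam)) atBot (𝓝 (1 * (starRingEnd ℂ) 1 +
        0 * (starRingEnd ℂ) 0)) :=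
    (h1.mul ((Complex.continuous_conj.tendsto _).comp h1)).add
      (h2.mul ((Complex.continuous_conj.tendsto _).comp h2))
  have h4 := tendsto_nhds_unique (tendsto_const_nhds.congr hc) h3
  rw [Complex.mul_conj, Complex.mul_conj, Complex.normSq_eq_norm_sq, Complex.normSq_eq_norm_sq,
    ← u1_eq hq hl] at h4
  simp only [map_one, map_zero, mul_zero, mul_one, add_zero] at h4
  exact_mod_cast h4

theorem norm_a_sq_add_norm_b_sq (hq : Integrable q volume) (lam : ℝ) :
    ‖a q lam‖ ^ 2 + ‖b q lam‖ ^ 2 = 1 := by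
  have hl : 0 ≤ (lam : ℂ).im := by simp
  have := (((tendsto_u1 hq hl).norm.pow 2).add ((tendsto_u2 hq lam).norm.pow 2))
  simp only [normSq_jost_eq_one hq] at this
  exact tendsto_nhds_unique this tendsto_const_nhds

/-! ### Behaviour at infinity -/

theorem exists_smooth_approx {f : ℝ → ℂ} (hf : Integrable f volume) {ε : ℝ} (hε : 0 < ε) :
    ∃ g : ℝ → ℂ, HasCompactSupport g ∧ ContDiff ℝ 1 g ∧ ∫ s, ‖f s - g s‖ ≤ ε := by
  obtain ⟨g, hg1, hg2, hg3⟩ := MeasureTheory.MemLp.exist_eLpNorm_sub_le (p := 1) (by simp) le_rfl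
    (memLp_one_iff_integrable.2 hf) hε
  have hg2' : ContDiff ℝ 1 g := hg2.of_le (by exact_mod_cast le_top)
  refine ⟨g, hg1, hg2', ?_⟩
  have hgi : Integrable g volume := hg2'.continuous.integrable_of_hasCompactSupport hg1
  rw [eLpNorm_one_eq_lintegral_enorm, ← ofReal_integral_norm_eq_lintegral_enorm (hf.sub hgi),
    ENNReal.ofReal_le_ofReal_iff hε.le] at hg3
  exact hg3

/-- Integration by parts in the oscillatory integral against a smooth function. -/
theorem norm_oscillatory_le (hq : Integrable q volume) {g : ℝ → ℂ} (hg : HasCompactSupport g)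
    (hg' : ContDiff ℝ 1 g) : ∃ C, ∀ lam : ℂ, 0 ≤ lam.im → ∀ t : ℝ,
      2 * ‖lam‖ * ‖∫ s in Set.Iic t, exp (2 * I * lam * (t - s)) * (g s * jostX q s lam)‖ ≤ C := by
  have hgc : Continuous g := hg'.continuous
  have hdc : Continuous (deriv g) := hg'.continuous_deriv le_rfl
  have hdi : Integrable (deriv g) volume := hdc.integrable_of_hasCompactSupport hg.deriv
  have hgi : Integrable g volume := hgc.integrable_of_hasCompactSupport hg
  obtain ⟨G, hG⟩ := hg.exists_bound_of_continuous hgc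
  set M := Real.exp (∫ s, ‖q s‖) with hM
  have hgq : Integrable (fun s => g s * q s) volume :=
    hq.bdd_mul hgc.aestronglyMeasurable (Eventually.of_forall hG)
  refine ⟨(∫ s, (‖deriv g s‖ * M + ‖g s * q s‖ * M)) + G * M, fun lam hl t => ?_⟩
  have h := isVolterra_jost hq hl
  set h' : ℝ → ℂ := fun s => deriv g s * jostX q s lam + g s * (q s * jostW q s lam) with hh'
  have hi1 : IntegrableOn (fun s => g s * jostX q s lam) (Set.Iic t) :=
    (integrable_mul_of_bdd hgi h.cont_x fun s => norm_jostX_le hq s hl).integrableOn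
  have hi2 : Integrable h' volume := by
    refine (integrable_mul_of_bdd hdi h.cont_x fun s => norm_jostX_le hq s hl).add ?_
    have := integrable_mul_of_bdd hgq h.cont_w fun s => norm_jostW_le hq s hl
    simpa only [mul_assoc] using this
  have hi1' := integrableOn_Iic_exp_mul hl hi1
  have hi2' := integrableOn_Iic_exp_mul hl (hi2.integrableOn (s := Set.Iic t))
  -- The product `e^{-2iλs} g x` is differentiated and integrated from a point left of the support
  -- of `g`, so there is no lower boundary term.
  have key : exp (-2 * I * lam * t) * (g t * jostX q t lam) =
      -2 * I * lam * (∫ s in Set.Iic t, exp (-2 * I * lam * s) * (g s * jostX q s lam)) +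
        ∫ s in Set.Iic t, exp (-2 * I * lam * s) * h' s := by
    have l1 := ((intervalIntegral_tendsto_integral_Iic t hi1' tendsto_id).const_mul
      (-2 * I * lam)).add (intervalIntegral_tendsto_integral_Iic t hi2' tendsto_id)
    refine tendsto_nhds_unique ?_ l1
    refine tendsto_const_nhds.congr' ?_
    obtain ⟨A, hA⟩ : ∃ A : ℝ, ∀ s ≤ A, g s = 0 := by
      obtain ⟨B, hB⟩ := hg.isCompact.bddBelow
      refine ⟨B - 1, fun s hs => ?_⟩
      by_contra hne
      have := hB (subset_tsupport g hne)
      linarith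
    filter_upwards [eventually_le_atBot A, eventually_le_atBot t] with s hs hst
    have hgp : IsPrim g (deriv g) s t :=
      IsPrim.of_hasDerivAt (fun x => ((hg'.differentiable one_ne_zero) x).hasDerivAt) hdc s t
    have := ((isPrim_exp (-2 * I * lam) s t).mul (hgp.mul (h.isPrim_x hq s t))).sub_eq
    rw [hA s hs, zero_mul, mul_zero, sub_zero] at this
    rw [this, ← intervalIntegral.integral_const_mul, ← intervalIntegral.integral_add]
    · congr 1 with r
      simp only [hh']
      ring
    · exact (((intervalIntegrable_iff_integrableOn_Ioc_of_le hst).2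
        (hi1'.mono_set Set.Ioc_subset_Iic_self))).const_mul _
    · exact (intervalIntegrable_iff_integrableOn_Ioc_of_le hst).2
        (hi2'.mono_set Set.Ioc_subset_Iic_self)
  -- Restoring the factor `e^{2iλt}` makes every remaining exponential bounded by one, hence the
  -- estimate uniform in `t` and `lam`.
  have key2 : 2 * I * lam *
      (∫ s in Set.Iic t, exp (2 * I * lam * (t - s)) * (g s * jostX q s lam)) =
      (∫ s in Set.Iic t, exp (2 * I * lam * (t - s)) * h' s) - g t * jostX q t lam := by
    rw [setIntegral_exp_sub_mul, setIntegral_exp_sub_mul]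
    have e : exp (2 * I * lam * t) * exp (-2 * I * lam * t) = 1 := by
      rw [← Complex.exp_add]; ring_nf; simp
    linear_combination exp (2 * I * lam * t) * key - g t * jostX q t lam * e
  have hn : 2 * ‖lam‖ * ‖∫ s in Set.Iic t, exp (2 * I * lam * (t - s)) * (g s * jostX q s lam)‖ =
      ‖2 * I * lam *
        (∫ s in Set.Iic t, exp (2 * I * lam * (t - s)) * (g s * jostX q s lam))‖ := by
    simp
  have hbi : Integrable (fun s => ‖deriv g s‖ * M + ‖g s * q s‖ * M) volume :=
    (hdi.norm.mul_const _).add (hgq.norm.mul_const _)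
  rw [hn, key2]
  refine (norm_sub_le _ _).trans (add_le_add ?_ ?_)
  · refine (norm_integral_le_of_norm_le (g := fun s => ‖deriv g s‖ * M + ‖g s * q s‖ * M)
      hbi.integrableOn ?_).trans (setIntegral_le_integral hbi
        (Eventually.of_forall fun s => by positivity))
    filter_upwards [ae_restrict_mem measurableSet_Iic] with s hs
    rw [norm_mul]
    refine (mul_le_of_le_one_left (norm_nonneg _) (norm_exp_two_I_mul_le hl hs)).trans ?_
    refine (norm_add_le _ _).trans (add_le_add ?_ ?_)
    · rw [norm_mul]
      gcongr
      exact norm_jostX_le hq s hl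
    · rw [← mul_assoc, norm_mul]
      gcongr
      exact norm_jostW_le hq s hl
  · rw [norm_mul]
    have : 0 ≤ G := (norm_nonneg _).trans (hG t)
    gcongr
    · exact hG t
    · exact norm_jostX_le hq t hl

/-- A Riemann-Lebesgue lemma uniform in `t`: `conj q` is replaced by a smooth compactly supported
`g` at small `L¹` cost, and integration by parts gives decay `1 / |λ|` for `g`. -/
theorem exists_norm_jostW_le (hq : Integrable q volume) {ε : ℝ} (hε : 0 < ε) :
    ∃ R : ℝ, ∀ lam : ℂ, 0 ≤ lam.im → R ≤ ‖lam‖ → ∀ t, ‖jostW q t lam‖ ≤ ε := by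
  set M := Real.exp (∫ s, ‖q s‖) with hM
  have hM0 : 0 < M := Real.exp_pos _
  obtain ⟨g, hg1, hg2, hg3⟩ := exists_smooth_approx (integrable_conj hq)
    (ε := ε / (2 * M)) (by positivity)
  obtain ⟨C, hC⟩ := norm_oscillatory_le hq hg1 hg2
  -- The approximation error costs `ε / (2M) * M = ε / 2`, and `|λ| ≥ C / ε` makes `C / (2|λ|)` at
  -- most `ε / 2`; the `1` ensures `λ ≠ 0`.
  refine ⟨max 1 (C / ε), fun lam hl hR t => ?_⟩
  have h1 : 1 ≤ ‖lam‖ := (le_max_left _ _).trans hR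
  have h2 : C / ε ≤ ‖lam‖ := (le_max_right _ _).trans hR
  have h := isVolterra_jost hq hl
  have hgi : Integrable g volume := hg2.continuous.integrable_of_hasCompactSupport hg1
  have i1 : Integrable (fun s => ((starRingEnd ℂ) (q s) - g s) * jostX q s lam) volume :=
    integrable_mul_of_bdd ((integrable_conj hq).sub hgi) h.cont_x fun s => norm_jostX_le hq s hl
  have i2 : Integrable (fun s => g s * jostX q s lam) volume :=
    integrable_mul_of_bdd hgi h.cont_x fun s => norm_jostX_le hq s hl
  have e : jostW q t lam =
      -((∫ s in Set.Iic t, exp (2 * I * lam * (t - s)) *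
        (((starRingEnd ℂ) (q s) - g s) * jostX q s lam)) +
      ∫ s in Set.Iic t, exp (2 * I * lam * (t - s)) * (g s * jostX q s lam)) := by
    have h3 := h.eq_w t
    rw [setIntegral_exp_sub_mul] at h3
    rw [h3, setIntegral_exp_sub_mul, setIntegral_exp_sub_mul, ← mul_add,
      ← integral_add (integrableOn_Iic_exp_mul hl i1.integrableOn)
        (integrableOn_Iic_exp_mul hl i2.integrableOn)]
    congr 3 with s
    ring
  have b1 : ‖∫ s in Set.Iic t, exp (2 * I * lam * (t - s)) *
        (((starRingEnd ℂ) (q s) - g s) * jostX q s lam)‖ ≤ ε / 2 := by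
    have hi : Integrable (fun s => ‖(starRingEnd ℂ) (q s) - g s‖ * M) volume :=
      ((integrable_conj hq).sub hgi).norm.mul_const _
    refine (norm_integral_le_of_norm_le
      (g := fun s => ‖(starRingEnd ℂ) (q s) - g s‖ * M) hi.integrableOn ?_).trans
      ((setIntegral_le_integral hi (Eventually.of_forall fun s => by positivity)).trans ?_)
    · filter_upwards [ae_restrict_mem measurableSet_Iic] with s hs
      rw [norm_mul]
      refine (mul_le_of_le_one_left (norm_nonneg _) (norm_exp_two_I_mul_le hl hs)).trans ?_
      rw [norm_mul]
      gcongr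
      exact norm_jostX_le hq s hl
    · rw [integral_mul_const]
      calc _ ≤ ε / (2 * M) * M := by gcongr
        _ = ε / 2 := by field_simp
  have b2 : ‖∫ s in Set.Iic t, exp (2 * I * lam * (t - s)) * (g s * jostX q s lam)‖ ≤ ε / 2 := by
    have h4 := hC lam hl t
    rw [div_le_iff₀ hε] at h2
    have h5 : 2 * ‖lam‖ * ‖∫ s in Set.Iic t,
        exp (2 * I * lam * (t - s)) * (g s * jostX q s lam)‖ ≤ 2 * ‖lam‖ * (ε / 2) := by
      linarith
    exact le_of_mul_le_mul_left h5 (by linarith)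
  rw [e, norm_neg]
  refine (norm_add_le _ _).trans ?_
  linarith

/-- `a → 1` at infinity in the closed upper half plane. -/
theorem exists_norm_a_sub_one_le (hq : Integrable q volume) {ε : ℝ} (hε : 0 < ε) :
    ∃ R : ℝ, ∀ lam : ℂ, 0 ≤ lam.im → R ≤ ‖lam‖ → ‖a q lam - 1‖ ≤ ε := by
  set N := (∫ s, ‖q s‖) with hN
  have hN0 : 0 ≤ N := integral_nonneg fun _ => norm_nonneg _
  obtain ⟨R, hR⟩ := exists_norm_jostW_le hq (ε := ε / (N + 1)) (by positivity)
  refine ⟨R, fun lam hl hlam => ?_⟩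
  rw [a_eq hq hl, add_sub_cancel_left]
  refine (norm_integral_le_of_norm_le (g := fun s => ‖q s‖ * (ε / (N + 1))) (hq.norm.mul_const _)
    (Eventually.of_forall fun s => ?_)).trans ?_
  · rw [norm_mul]
    gcongr
    exact hR lam hl hlam s
  · rw [integral_mul_const, ← hN, mul_div_assoc', div_le_iff₀ (by positivity)]
    nlinarith

theorem isPreconnected_upper : IsPreconnected {z : ℂ | 0 < z.im} :=
  (convex_halfSpace_im_gt 0).isPreconnected

/-- Infinite order at one point would make `a` vanish on the connected half plane, against `a → 1`
along the imaginary axis. -/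
theorem analyticOrderAt_a_ne_top (hq : Integrable q volume) {lam : ℂ} (hl : 0 < lam.im) :
    analyticOrderAt (a q) lam ≠ ⊤ := by
  intro h
  have h0 := (hol_a hq).analyticOnNhd.eqOn_zero_of_preconnected_of_eventuallyEq_zero
    isPreconnected_upper hl (analyticOrderAt_eq_top.1 h)
  obtain ⟨R, hR⟩ := exists_norm_a_sub_one_le hq (ε := 1 / 2) (by norm_num)
  have hp : 0 < (I * ((max R 1 : ℝ) : ℂ)).im := by simp
  have h1 := hR (I * ((max R 1 : ℝ) : ℂ)) hp.le (by
    rw [norm_mul, Complex.norm_I, one_mul, Complex.norm_real]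
    exact (le_max_left _ _).trans (le_abs_self _))
  rw [h0 hp] at h1
  norm_num at h1

theorem analyticOrderAt_a (hq : Integrable q volume) {lam : ℂ} (hl : 0 < lam.im) :
    analyticOrderAt (a q) lam = (mult q lam : ℕ∞) :=
  (Nat.cast_analyticOrderNatAt (analyticOrderAt_a_ne_top hq hl)).symm

theorem one_le_mult (hq : Integrable q volume) {lam : ℂ} (hl : lam ∈ eigenvalues q) :
    1 ≤ mult q lam := by
  have h := ((hol_a hq).analyticAt hl.1).analyticOrderAt_ne_zero.2 hl.2
  rw [analyticOrderAt_a hq hl.1] at h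
  exact Nat.one_le_iff_ne_zero.2 (by exact_mod_cast h)

/-! ### The Jost solution normalised at `+∞` -/

theorem IsPrim.comp_neg {F f : ℝ → ℂ} (h : ∀ a b, IsPrim F f a b) (a b : ℝ) :
    IsPrim (fun t => F (-t)) (fun t => -f (-t)) a b := by
  refine IsPrim.of_forall ?_ fun s t => ?_
  · have := (IntervalIntegrable.iff_comp_neg (by finiteness)).1 (h (-a) (-b)).int
    simp only [neg_neg] at this
    exact this.neg
  · rw [(h (-s) (-t)).sub_eq, intervalIntegral.integral_neg, intervalIntegral.integral_comp_neg,
      intervalIntegral.integral_symm]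

/-- The potential whose left Jost solution is the reflected right Jost solution of `q`. -/
def reflect (q : ℝ → ℂ) (s : ℝ) : ℂ := (starRingEnd ℂ) (q (-s))

theorem integrable_reflect (hq : Integrable q volume) : Integrable (reflect q) volume :=
  integrable_conj hq.comp_neg

/-- The second component of `e^{-i lam t} ψ(t, lam)` for the solution `ψ` normalised at `+∞`. -/
def jostY (q : ℝ → ℂ) (t : ℝ) (lam : ℂ) : ℂ := jostX (reflect q) (-t) lam

/-- The first component of `e^{-i lam t} ψ(t, lam)` for the solution `ψ` normalised at `+∞`. -/
def jostZ (q : ℝ → ℂ) (t : ℝ) (lam : ℂ) : ℂ := jostW (reflect q) (-t) lam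

/-- Reversing time, conjugating `q` and exchanging the two components carries the system to itself
and `-∞` to `+∞`; every estimate for the left solution is thereby available for the right one. -/
theorem isPrim_jostY (hq : Integrable q volume) {lam : ℂ} (hl : 0 ≤ lam.im) (a b : ℝ) :
    IsPrim (fun t => jostY q t lam) (fun t => -((starRingEnd ℂ) (q t) * jostZ q t lam)) a b := by
  have := IsPrim.comp_neg ((isVolterra_jost (integrable_reflect hq) hl).isPrim_x
    (integrable_reflect hq)) a b
  refine this.congr_deriv fun x _ => ?_
  simp only [reflect, neg_neg, jostZ]

theorem isPrim_exp_mul_jostZ (hq : Integrable q volume) {lam : ℂ} (hl : 0 ≤ lam.im) (a b : ℝ) :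
    IsPrim (fun t : ℝ => exp (2 * I * lam * t) * jostZ q t lam)
      (fun t => exp (2 * I * lam * t) * (q t * jostY q t lam)) a b := by
  have := IsPrim.comp_neg ((isVolterra_jost (integrable_reflect hq) hl).isPrim_u
    (integrable_reflect hq) hl) a b
  simp only [reflect, neg_neg, Complex.conj_conj, Complex.ofReal_neg, mul_neg, neg_mul] at this
  exact this

theorem isPrim_jostX (hq : Integrable q volume) {lam : ℂ} (hl : 0 ≤ lam.im) (a b : ℝ) :
    IsPrim (fun t => jostX q t lam) (fun t => q t * jostW q t lam) a b :=
  (isVolterra_jost hq hl).isPrim_x hq a b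

theorem isPrim_u2 (hq : Integrable q volume) {lam : ℂ} (hl : 0 ≤ lam.im) (a b : ℝ) :
    IsPrim (fun t => u2 q t lam)
      (fun t : ℝ => -(exp (-2 * I * lam * t) * ((starRingEnd ℂ) (q t) * jostX q t lam))) a b := by
  simp only [u2_eq hq hl]
  exact (isVolterra_jost hq hl).isPrim_u hq hl a b

theorem exp_two_mul_exp_neg_two (lam : ℂ) (t : ℝ) :
    exp (2 * I * lam * t) * exp (-2 * I * lam * t) = 1 := by
  rw [← Complex.exp_add]
  simp

theorem tendsto_jostX_atBot (hq : Integrable q volume) {lam : ℂ} (hl : 0 ≤ lam.im) :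
    Tendsto (fun s => jostX q s lam) atBot (𝓝 1) := by
  rw [funext (isVolterra_jost hq hl).eq_x]
  simpa using (tendsto_integral_Iic_zero (f := fun s => q s * jostW q s lam)
      (tendsto_id (x := (atBot : Filter ℝ)))).const_add 1

/-- The Wronskian has derivative zero, and its value is read off at `+∞`, where `y → 1`, `z → 0`, `x
→ a` and `w` stays bounded. -/
theorem wronskian_eq (hq : Integrable q volume) {lam : ℂ} (hl : 0 ≤ lam.im) (t : ℝ) :
    jostX q t lam * jostY q t lam - jostW q t lam * jostZ q t lam = a q lam := by
  have hc : ∀ s : ℝ, jostX q s lam * jostY q s lam - jostW q s lam * jostZ q s lam =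
      jostX q t lam * jostY q t lam - jostW q t lam * jostZ q t lam := by
    intro s
    have e : ∀ r : ℝ, jostW q r lam * jostZ q r lam =
        u2 q r lam * (exp (2 * I * lam * r) * jostZ q r lam) := by
      intro r
      rw [u2_eq hq hl]
      linear_combination (-jostW q r lam * jostZ q r lam) * exp_two_mul_exp_neg_two lam r
    rw [e, e, ← sub_eq_zero, (((isPrim_jostX hq hl t s).mul (isPrim_jostY hq hl t s)).sub
      ((isPrim_u2 hq hl t s).mul (isPrim_exp_mul_jostZ hq hl t s))).sub_eq]
    refine intervalIntegral.integral_zero_ae (Eventually.of_forall fun r _ => ?_)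
    rw [u2_eq hq hl]
    linear_combination ((starRingEnd ℂ) (q r) * jostX q r lam * jostZ q r lam
      - jostW q r lam * q r * jostY q r lam) * exp_two_mul_exp_neg_two lam r
  have hq' := integrable_reflect hq
  have h1 : Tendsto (fun s => jostY q s lam) atTop (𝓝 1) :=
    (tendsto_jostX_atBot hq' hl).comp tendsto_neg_atTop_atBot
  have h2 : Tendsto (fun s => jostZ q s lam) atTop (𝓝 0) :=
    ((isVolterra_jost hq' hl).tendsto_w hq' hl).comp tendsto_neg_atTop_atBot
  have h3 : Tendsto (fun s => jostW q s lam * jostZ q s lam) atTop (𝓝 0) := by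
    refine squeeze_zero_norm (a := fun s => Real.exp (∫ s, ‖q s‖) * ‖jostZ q s lam‖) (fun s => ?_)
      (by simpa using h2.norm.const_mul (Real.exp (∫ s, ‖q s‖)))
    rw [norm_mul]
    gcongr
    exact norm_jostW_le hq s hl
  have h4 := ((tendsto_jostX_a hq hl).mul h1).sub h3
  rw [mul_one, sub_zero] at h4
  exact tendsto_nhds_unique (tendsto_const_nhds.congr fun s => (hc s).symm) h4

/-- The error is bounded by a constant times the tail of `∫ |q|`, which does not involve `lam`. -/
theorem exists_norm_jostY_sub_one_le (hq : Integrable q volume) {ε : ℝ} (hε : 0 < ε) :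
    ∃ T : ℝ, ∀ t, T ≤ t → ∀ lam : ℂ, 0 ≤ lam.im → ‖jostY q t lam - 1‖ ≤ ε := by
  have hq' := integrable_reflect hq
  set M := Real.exp (∫ s, ‖reflect q s‖) with hM
  have hlim : Tendsto (fun t => M * cumNorm (reflect q) (-t)) atTop (𝓝 0) := by
    simpa using ((tendsto_cumNorm_atBot (reflect q)).comp tendsto_neg_atTop_atBot).const_mul M
  obtain ⟨T, hT⟩ := eventually_atTop.1 (hlim.eventually (ge_mem_nhds hε))
  refine ⟨T, fun t ht lam hl => le_trans ?_ (hT t ht)⟩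
  rw [jostY, (isVolterra_jost hq' hl).eq_x, add_sub_cancel_left]
  refine (norm_integral_le_of_norm_le (g := fun s => M * ‖reflect q s‖)
    (hq'.norm.const_mul _).integrableOn (Eventually.of_forall fun s => ?_)).trans ?_
  · rw [norm_mul, mul_comm]
    gcongr
    exact norm_jostW_le hq' s hl
  · rw [integral_const_mul]
    exact le_rfl

theorem hol_jostY (hq : Integrable q volume) (t : ℝ) : Hol (jostY q t) :=
  hol_jostX (integrable_reflect hq) (-t)

theorem continuous_jostY (hq : Integrable q volume) {lam : ℂ} (hl : 0 ≤ lam.im) :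
    Continuous fun t => jostY q t lam :=
  (continuous_jostX (integrable_reflect hq) hl).comp continuous_neg

theorem tendsto_jostY (hq : Integrable q volume) :
    TendstoUniformlyOn (fun t => jostY q t) (fun _ => 1) atTop {z : ℂ | 0 < z.im} := by
  rw [Metric.tendstoUniformlyOn_iff]
  intro ε hε
  obtain ⟨T, hT⟩ := exists_norm_jostY_sub_one_le hq (half_pos hε)
  filter_upwards [eventually_ge_atTop T] with t ht z hz
  rw [dist_comm, dist_eq_norm]
  exact (hT t ht z (le_of_lt hz)).trans_lt (half_lt_self hε)

/-- For large `t` the function `u₂(t, ·)` is, up to a holomorphic multiple of `a`, a product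
of `jostY q t` and a holomorphic function which does not depend on `t`. -/
theorem exists_u2_decomposition (hq : Integrable q volume) :
    ∃ (T : ℝ) (c : ℂ → ℂ), DifferentiableOn ℂ c {z | 0 < z.im} ∧ ∀ t, T ≤ t →
      ∃ h : ℂ → ℂ, DifferentiableOn ℂ h {z | 0 < z.im} ∧ ∀ z : ℂ, 0 < z.im →
        u2 q t z = jostY q t z * c z - a q z * h z := by
  obtain ⟨T, hT⟩ := exists_norm_jostY_sub_one_le hq (ε := 1 / 2) (by norm_num)
  have hY : ∀ t, T ≤ t → ∀ z : ℂ, 0 ≤ z.im → 1 / 2 ≤ ‖jostY q t z‖ := by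
    intro t ht z hz
    have h1 := hT t ht z hz
    have h2 := norm_sub_norm_le (1 : ℂ) (1 - jostY q t z)
    rw [norm_sub_rev 1, sub_sub_cancel, norm_one] at h2
    linarith
  have hY0 : ∀ t, T ≤ t → ∀ z : ℂ, 0 ≤ z.im → jostY q t z ≠ 0 := by
    intro t ht z hz h0
    have := hY t ht z hz
    rw [h0, norm_zero] at this
    norm_num at this
  -- Beyond `T` the function `jostY` has modulus at least `1 / 2`. The quotient `u2 / jostY` changes
  -- in time only by multiples of `a`, so its value at `T` serves as `c`.
  refine ⟨T, fun z => u2 q T z / jostY q T z, (hol_u2 hq T).diff.div (hol_jostY hq T).diff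
    fun z hz => hY0 T le_rfl z (le_of_lt hz), fun t ht => ?_⟩
  -- By the Wronskian identity `(u₂ / y)' = -a e^{-2izs} conj q / y²`. The factor `e^{-2izt}` is
  -- split off so that the exponential left in the integrand is bounded by one; `|y| ≥ 1 / 2` then
  -- gives the dominating function `4 |q|`.
  let G : ℂ → ℂ := fun z => ∫ s in Set.Ioc T t,
    exp (2 * I * z * (t - s)) * ((starRingEnd ℂ) (q s) * (jostY q s z ^ 2)⁻¹)
  have hG : Hol G := by
    refine Hol.integral (F := fun s z => exp (2 * I * z * (t - s)) *
      ((starRingEnd ℂ) (q s) * (jostY q s z ^ 2)⁻¹)) (g := fun s => ‖q s‖ * 4) ?_ ?_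
      (hq.norm.mul_const _).integrableOn ?_
    · intro z hz
      have hc : ContinuousOn (fun s => (jostY q s z ^ 2)⁻¹) (Set.Ioc T t) :=
        ((continuous_jostY hq hz).pow 2).continuousOn.inv₀ fun s hs =>
          pow_ne_zero 2 (hY0 s hs.1.le z hz)
      exact (by fun_prop : Continuous fun s : ℝ =>
        exp (2 * I * z * (t - s))).aestronglyMeasurable.mul
        ((integrable_conj hq).1.restrict.mul (hc.aestronglyMeasurable measurableSet_Ioc))
    · filter_upwards [ae_restrict_mem measurableSet_Ioc] with s hs z hz
      rw [norm_mul, norm_mul, RCLike.norm_conj, norm_inv, norm_pow]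
      refine (mul_le_of_le_one_left (by positivity) (norm_exp_two_I_mul_le hz hs.2)).trans ?_
      gcongr
      have := hY s hs.1.le z hz
      rw [inv_le_comm₀ (by positivity) (by norm_num)]
      nlinarith
    · filter_upwards [ae_restrict_mem measurableSet_Ioc] with s hs
      refine (Hol.of_differentiable (by fun_prop)).mul ((Hol.const _).mul ?_)
      have h2 := (hol_jostY hq s).mul (hol_jostY hq s)
      simp only [← pow_two] at h2
      exact ⟨h2.cont.inv₀ fun z hz => pow_ne_zero 2 (hY0 s hs.1.le z hz),
        h2.diff.inv fun z hz => pow_ne_zero 2 (hY0 s hs.1.le z (le_of_lt hz))⟩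
  refine ⟨fun z => jostY q t z * exp (-2 * I * z * t) * G z, ?_, fun z hz => ?_⟩
  · exact ((hol_jostY hq t).diff.mul (by fun_prop)).mul hG.diff
  · have hl : 0 ≤ z.im := le_of_lt hz
    have hp := ((isPrim_u2 hq hl T t).mul ((isPrim_jostY hq hl T t).inv fun s hs => by
      rw [Set.uIcc_of_le ht] at hs
      exact hY0 s hs.1 z hl)).sub_eq
    have e : ∀ s ∈ Set.uIcc T t,
        -(exp (-2 * I * z * s) * ((starRingEnd ℂ) (q s) * jostX q s z)) * (jostY q s z)⁻¹ +
          u2 q s z * (-(-((starRingEnd ℂ) (q s) * jostZ q s z)) / jostY q s z ^ 2) =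
        -(a q z * exp (-2 * I * z * t)) *
          (exp (2 * I * z * (t - s)) * ((starRingEnd ℂ) (q s) * (jostY q s z ^ 2)⁻¹)) := by
      intro s hs
      rw [Set.uIcc_of_le ht] at hs
      have h0 := hY0 s hs.1 z hl
      have e1 : exp (-2 * I * z * t) * exp (2 * I * z * (t - s)) = exp (-2 * I * z * s) := by
        rw [← Complex.exp_add]; ring_nf
      rw [← wronskian_eq hq hl s, u2_eq hq hl, ← e1]
      field_simp
      ring
    rw [intervalIntegral.integral_congr e, intervalIntegral.integral_const_mul,
      intervalIntegral.integral_of_le ht] at hp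
    have h1 := hY0 t ht z hl
    have h2 : u2 q t z = jostY q t z * (u2 q t z * (jostY q t z)⁻¹) := by
      field_simp
    rw [h2, sub_eq_iff_eq_add.1 hp]
    simp only [G]
    ring

/-! ### Limits of derivatives of `u2` at an eigenvalue. -/

theorem tendsto_iteratedDeriv {ι : Type*} {l : Filter ι} {F : ι → ℂ → ℂ} {f : ℂ → ℂ} {U : Set ℂ}
    (hU : IsOpen U) (hF : ∀ᶠ i in l, DifferentiableOn ℂ (F i) U)
    (h : TendstoLocallyUniformlyOn F f l U) (n : ℕ) :
    TendstoLocallyUniformlyOn (fun i => iteratedDeriv n (F i)) (iteratedDeriv n f) l U := by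
  have hd : ∀ {g : ℂ → ℂ} (m : ℕ), DifferentiableOn ℂ g U →
      DifferentiableOn ℂ (iteratedDeriv m g) U := by
    intro g m hg
    induction m with
    | zero => simpa using hg
    | succ m ih => rw [iteratedDeriv_succ]; exact ih.deriv hU
  induction n with
  | zero => simpa using h
  | succ n ih =>
    simp only [iteratedDeriv_succ]
    exact ih.deriv (hF.mono fun i hi => hd n hi) hU

theorem iteratedDeriv_mul_eq_zero {f g : ℂ → ℂ} {z : ℂ} (hf : AnalyticAt ℂ f z)
    (hg : AnalyticAt ℂ g z) {n : ℕ} (hn : n < analyticOrderAt f z) :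
    iteratedDeriv n (fun w => f w * g w) z = 0 := by
  have h1 : ((n + 1 : ℕ) : ℕ∞) ≤ analyticOrderAt (f * g) z := by
    rw [analyticOrderAt_mul hf hg, Nat.cast_add, Nat.cast_one]
    exact (Order.add_one_le_of_lt hn).trans le_self_add
  exact (natCast_le_analyticOrderAt_iff_iteratedDeriv_eq_zero (hf.mul hg)).1 h1 n (Nat.lt_succ_self n)

/-- In `u₂ = y c - a h` the second term has no derivatives of order below the multiplicity at `lam`,
and `y c → c` locally uniformly, so Weierstrass' theorem gives the limits even where `u₂` diverges
nearby. -/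
theorem tendsto_bDeriv (hq : Integrable q volume) {lam : ℂ} (hl : 0 < lam.im) {n : ℕ}
    (hn : n < mult q lam) :
    Tendsto (fun t => iteratedDeriv n (u2 q t) lam) atTop (𝓝 (bDeriv q lam n)) := by
  obtain ⟨T, c, hc, hT⟩ := exists_u2_decomposition hq
  have h1 : TendstoLocallyUniformlyOn (fun t z => jostY q t z * c z) (fun z => 1 * c z) atTop
      {z : ℂ | 0 < z.im} := by
    refine (tendsto_jostY hq).tendstoLocallyUniformlyOn.fun_mul₀ (G := fun _ => c) ?_
      continuousOn_const hc.continuousOn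
    exact TendstoUniformlyOn.tendstoLocallyUniformlyOn fun u hu =>
      Eventually.of_forall fun _ _ _ => refl_mem_uniformity hu
  have h2 := (tendsto_iteratedDeriv isOpen_upper (Eventually.of_forall fun t =>
    (hol_jostY hq t).diff.mul hc) h1 n).tendsto_at (a := lam) hl
  refine tendsto_nhds_limUnder ⟨_, h2.congr' ?_⟩
  filter_upwards [eventually_ge_atTop T] with t ht
  obtain ⟨h, hh, he⟩ := hT t ht
  have e : u2 q t =ᶠ[𝓝 lam] fun z => jostY q t z * c z - a q z * h z :=
    eventually_of_mem (upper_mem_nhds hl) fun z hz => he z hz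
  have ha : AnalyticAt ℂ (a q) lam := (hol_a hq).analyticAt hl
  have hha : AnalyticAt ℂ h lam := hh.analyticAt (upper_mem_nhds hl)
  have hYc : AnalyticAt ℂ (fun z => jostY q t z * c z) lam :=
    ((hol_jostY hq t).diff.mul hc).analyticAt (upper_mem_nhds hl)
  rw [e.iteratedDeriv_eq, iteratedDeriv_fun_sub (g := fun z => a q z * h z) hYc.contDiffAt
    (ha.mul hha).contDiffAt, iteratedDeriv_mul_eq_zero ha hha (by rw [analyticOrderAt_a hq hl]; exact_mod_cast hn),
    sub_zero]
  rfl

/-! ### Principal parts -/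

theorem exists_taylor {f : ℂ → ℂ} {z₀ : ℂ} (hf : AnalyticAt ℂ f z₀) (n : ℕ) :
    ∃ F : ℂ → ℂ, AnalyticAt ℂ F z₀ ∧ ∀ z, f z =
      (∑ i ∈ Finset.range n, iteratedDeriv i f z₀ / i.factorial * (z - z₀) ^ i) +
        (z - z₀) ^ n * F z := by
  have h0 : AnalyticAt ℂ (fun z => f (z + z₀)) 0 := by
    refine AnalyticAt.fun_comp (f := fun z : ℂ => z + z₀) (by simpa using hf) (by fun_prop)
  obtain ⟨F, hF, h⟩ := h0.exists_eq_sum_add_pow_mul n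
  refine ⟨fun z => F (z - z₀), AnalyticAt.fun_comp (by simpa using hF) (by fun_prop), fun z => ?_⟩
  have := h (z - z₀)
  simp only [sub_add_cancel, iteratedDeriv_comp_add_const, zero_add, smul_eq_mul] at this
  rw [this]
  congr 1
  exact Finset.sum_congr rfl fun i _ => by ring

theorem AnalyticAt.isBigO_one_punctured {f : ℂ → ℂ} {z₀ : ℂ} (hf : AnalyticAt ℂ f z₀) :
    f =O[𝓝[≠] z₀] (fun _ => (1 : ℝ)) :=
  (hf.continuousAt.norm.isBoundedUnder_le.mono nhdsWithin_le_nhds).isBigO_one ℝ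

theorem IsPrincipalPart.congr_isBigO {f g : ℂ → ℂ} {z₀ : ℂ} {L : ℕ} {r : ℕ → ℂ}
    (h : IsPrincipalPart f z₀ L r)
    (hfg : (fun z => g z - f z) =O[𝓝[≠] z₀] (fun _ => (1 : ℝ))) :
    IsPrincipalPart g z₀ L r := by
  refine (hfg.add h).congr_left fun z => ?_
  ring

theorem tendsto_sub_punctured (z₀ : ℂ) : Tendsto (fun z => z - z₀) (𝓝[≠] z₀) (𝓝 0) := by
  have : ContinuousAt (fun z => z - z₀) z₀ := by fun_prop
  simpa using this.tendsto.mono_left nhdsWithin_le_nhds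

/-- Multiplication by `(z - z₀)^(L+1)` isolates the coefficient of the highest pole in the limit; it
must be zero, and induction removes the others. -/
theorem eq_zero_of_isBigO_one {z₀ : ℂ} (d : ℕ → ℂ) (L : ℕ)
    (h : (fun z => ∑ l ∈ Finset.range L, d l / (z - z₀) ^ (l + 1)) =O[𝓝[≠] z₀]
      (fun _ => (1 : ℝ))) : ∀ l < L, d l = 0 := by
  induction L with
  | zero => simp
  | succ L ih =>
    have h0 : Tendsto (fun z => (z - z₀) ^ (L + 1) *
        ∑ l ∈ Finset.range (L + 1), d l / (z - z₀) ^ (l + 1)) (𝓝[≠] z₀) (𝓝 0) := by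
      have h1 : Tendsto (fun z => (z - z₀) ^ (L + 1)) (𝓝[≠] z₀) (𝓝 0) := by
        simpa using (tendsto_sub_punctured z₀).pow (L + 1)
      have h2 := (isBigO_norm_right.2
        (isBigO_refl (fun z => (z - z₀) ^ (L + 1)) (𝓝[≠] z₀))).mul h
      refine h2.trans_tendsto ?_
      simpa using h1.norm
    have h3 : Tendsto (fun z => ∑ l ∈ Finset.range (L + 1), d l * (z - z₀) ^ (L - l)) (𝓝[≠] z₀)
        (𝓝 (d L)) := by
      have hc : ContinuousAt (fun z => ∑ l ∈ Finset.range (L + 1), d l * (z - z₀) ^ (L - l)) z₀ := by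
        fun_prop
      have e : ∑ l ∈ Finset.range (L + 1), d l * (z₀ - z₀) ^ (L - l) = d L := by
        rw [Finset.sum_eq_single L]
        · simp
        · intro l hl hlL
          rw [sub_self, zero_pow (by have := Finset.mem_range.1 hl; lia), mul_zero]
        · simp
      have := hc.tendsto.mono_left (nhdsWithin_le_nhds (s := {z₀}ᶜ))
      rwa [e] at this
    have h4 : d L = 0 := by
      refine tendsto_nhds_unique h3 (h0.congr' ?_)
      filter_upwards [self_mem_nhdsWithin] with z hz
      rw [Finset.mul_sum]
      refine Finset.sum_congr rfl fun l hl => ?_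
      have h5 : z - z₀ ≠ 0 := sub_ne_zero.2 hz
      have h6 : L + 1 = (L - l) + (l + 1) := by have := Finset.mem_range.1 hl; lia
      rw [h6, pow_add]
      field_simp
    intro l hl
    rcases Nat.lt_succ_iff_lt_or_eq.1 hl with h5 | rfl
    · refine ih (h.congr_left fun z => ?_) l h5
      rw [Finset.sum_range_succ, h4]
      simp
    · exact h4

theorem IsPrincipalPart.unique {f : ℂ → ℂ} {z₀ : ℂ} {L : ℕ} {r r' : ℕ → ℂ}
    (h : IsPrincipalPart f z₀ L r) (h' : IsPrincipalPart f z₀ L r') : ∀ l < L, r l = r' l := by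
  intro l hl
  refine sub_eq_zero.1 (eq_zero_of_isBigO_one (z₀ := z₀) (fun l => r l - r' l) L ?_ l hl)
  refine (h'.sub h).congr_left fun z => ?_
  simp only [sub_div, Finset.sum_sub_distrib]
  ring

theorem exists_isPrincipalPart_div {p g : ℂ → ℂ} {z₀ : ℂ} (hp : AnalyticAt ℂ p z₀)
    (hg : AnalyticAt ℂ g z₀) {L : ℕ} (hL : analyticOrderAt g z₀ = L) :
    ∃ r, IsPrincipalPart (fun z => p z / g z) z₀ L r := by
  obtain ⟨k, hk, hk0, he⟩ := hg.analyticOrderAt_eq_natCast.1 hL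
  obtain ⟨F, hF, h⟩ := exists_taylor (hp.div hk hk0) L
  -- With `g = (z - z₀)^L k`, the Taylor term of `p / k` of degree `L - 1 - l` is the one divided
  -- down to a pole of order `l + 1`.
  refine ⟨fun l => iteratedDeriv (L - 1 - l) (p / k) z₀ / (L - 1 - l).factorial, ?_⟩
  refine (AnalyticAt.isBigO_one_punctured hF).congr' ?_ EventuallyEq.rfl
  filter_upwards [self_mem_nhdsWithin, he.filter_mono nhdsWithin_le_nhds] with z hz hez
  have hz0 : z - z₀ ≠ 0 := sub_ne_zero.2 hz
  have h1 : p z / g z = (p / k) z / (z - z₀) ^ L := by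
    rw [hez, smul_eq_mul, Pi.div_apply, div_div, mul_comm]
  rw [h1, h z, add_div, mul_div_cancel_left₀ _ (pow_ne_zero L hz0), Finset.sum_div,
    ← Finset.sum_range_reflect, eq_sub_iff_add_eq, add_comm]
  congr 1
  refine Finset.sum_congr rfl fun l hl => ?_
  have hl' := Finset.mem_range.1 hl
  have h2 : L = (L - 1 - l) + (l + 1) := by lia
  rw [mul_div_assoc, div_eq_mul_inv _ ((z - z₀) ^ (l + 1))]
  congr 1
  have h3 : (z - z₀) ^ L = (z - z₀) ^ (L - 1 - l) * (z - z₀) ^ (l + 1) := by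
    rw [← pow_add, ← h2]
  rw [h3, div_mul_cancel_left₀ (pow_ne_zero _ hz0)]

theorem isBigO_div_of_iteratedDeriv_eq_zero {p g : ℂ → ℂ} {z₀ : ℂ} (hp : AnalyticAt ℂ p z₀)
    (hg : AnalyticAt ℂ g z₀) {L : ℕ} (hL : analyticOrderAt g z₀ = L)
    (h0 : ∀ n < L, iteratedDeriv n p z₀ = 0) :
    (fun z => p z / g z) =O[𝓝[≠] z₀] (fun _ => (1 : ℝ)) := by
  obtain ⟨k, hk, hk0, he⟩ := hg.analyticOrderAt_eq_natCast.1 hL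
  obtain ⟨F, hF, h⟩ := exists_taylor hp L
  refine (AnalyticAt.isBigO_one_punctured (hF.div hk hk0)).congr' ?_ EventuallyEq.rfl
  filter_upwards [self_mem_nhdsWithin, he.filter_mono nhdsWithin_le_nhds] with z hz hez
  have hz0 : z - z₀ ≠ 0 := sub_ne_zero.2 hz
  rw [h z, Finset.sum_eq_zero fun i hi => by rw [h0 i (Finset.mem_range.1 hi)]; simp, zero_add,
    hez, smul_eq_mul, mul_div_mul_left _ _ (pow_ne_zero L hz0), Pi.div_apply]

/-- Cauchy product of the Taylor series of `E` with the principal part: a pole of order `l + 1`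
contributes to those of order `m + 1` with `m ≤ l`, and the rest is bounded. -/
theorem IsPrincipalPart.analytic_mul {f E : ℂ → ℂ} {z₀ : ℂ} {L : ℕ} {r : ℕ → ℂ}
    (h : IsPrincipalPart f z₀ L r) (hE : AnalyticAt ℂ E z₀) :
    IsPrincipalPart (fun z => E z * f z) z₀ L fun m => ∑ l ∈ Finset.Ico m L,
      iteratedDeriv (l - m) E z₀ / (l - m).factorial * r l := by
  -- The Taylor remainder of order `l + 1` is precisely the regular part of `E / (z - z₀)^(l+1)`.
  choose F hF hT using fun n => exists_taylor hE n
  have h1 : (fun z => E z * (f z - ∑ l ∈ Finset.range L, r l / (z - z₀) ^ (l + 1)))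
      =O[𝓝[≠] z₀] (fun _ => (1 : ℝ)) := by
    simpa using (AnalyticAt.isBigO_one_punctured hE).mul h
  have h2 : AnalyticAt ℂ (fun z => ∑ l ∈ Finset.range L, r l * F (l + 1) z) z₀ :=
    Finset.analyticAt_fun_sum _ fun l _ => analyticAt_const.mul (hF (l + 1))
  refine (h1.add (AnalyticAt.isBigO_one_punctured h2)).congr' ?_ EventuallyEq.rfl
  filter_upwards [self_mem_nhdsWithin] with z hz
  have hz0 : z - z₀ ≠ 0 := sub_ne_zero.2 hz
  have h3 : ∀ l, F (l + 1) z = E z / (z - z₀) ^ (l + 1) -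
      ∑ m ∈ Finset.range (l + 1),
        iteratedDeriv (l - m) E z₀ / (l - m).factorial / (z - z₀) ^ (m + 1) := by
    intro l
    rw [eq_sub_iff_add_eq, eq_div_iff (pow_ne_zero _ hz0), hT (l + 1) z, add_mul, add_comm,
      Finset.sum_mul, mul_comm (F (l + 1) z), ← Finset.sum_range_reflect]
    congr 1
    refine Finset.sum_congr rfl fun m hm => ?_
    have hm' := Finset.mem_range.1 hm
    rw [show l + 1 - 1 - m = l - m by lia, show l - (l - m) = m by lia]
    have h6 : (z - z₀) ^ (l + 1) = (z - z₀) ^ m * (z - z₀) ^ (l - m + 1) := by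
      rw [← pow_add]; congr 1; lia
    rw [h6]
    field_simp
  have h4 : ∑ m ∈ Finset.range L, (∑ l ∈ Finset.Ico m L,
      iteratedDeriv (l - m) E z₀ / (l - m).factorial * r l) / (z - z₀) ^ (m + 1) =
      ∑ l ∈ Finset.range L, r l * ∑ m ∈ Finset.range (l + 1),
        iteratedDeriv (l - m) E z₀ / (l - m).factorial / (z - z₀) ^ (m + 1) := by
    simp only [Finset.sum_div, Finset.mul_sum]
    rw [Finset.sum_sigma', Finset.sum_sigma']
    refine Finset.sum_bij' (fun x _ => ⟨x.2, x.1⟩) (fun x _ => ⟨x.2, x.1⟩) ?_ ?_ ?_ ?_ ?_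
    · intro x hx
      simp only [Finset.mem_sigma, Finset.mem_range, Finset.mem_Ico] at hx ⊢
      lia
    · intro x hx
      simp only [Finset.mem_sigma, Finset.mem_range, Finset.mem_Ico] at hx ⊢
      lia
    · intro x _; rfl
    · intro x _; rfl
    · intro x _
      ring
  rw [h4]
  simp only [h3, mul_sub, Finset.sum_sub_distrib, Finset.mul_sum]
  have h5 : ∀ l, E z * (r l / (z - z₀) ^ (l + 1)) = r l * (E z / (z - z₀) ^ (l + 1)) := fun l => by
    ring
  simp only [h5]
  ring

theorem iteratedDeriv_bTaylor (q : ℝ → ℂ) (lamk : ℂ) {n : ℕ} (hn : n < mult q lamk) :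
    iteratedDeriv n (bTaylor q lamk) lamk = bDeriv q lamk n := by
  have e : bTaylor q lamk = fun z => (fun y => ∑ i ∈ Finset.range (mult q lamk),
    bDeriv q lamk i / (i.factorial : ℂ) * y ^ i) (z - lamk) := rfl
  rw [e, congrFun (iteratedDeriv_comp_sub_const n (fun y => ∑ i ∈ Finset.range (mult q lamk),
    bDeriv q lamk i / (i.factorial : ℂ) * y ^ i) lamk) lamk, sub_self, iteratedDeriv_fun_sum fun i _ => by fun_prop]
  have h : ∀ i, iteratedDeriv n (fun y : ℂ => bDeriv q lamk i / (i.factorial : ℂ) * y ^ i) 0 =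
      if n = i then bDeriv q lamk i else 0 := by
    intro i
    rw [iteratedDeriv_const_mul_field, iteratedDeriv_fun_pow_zero]
    have : (i.factorial : ℂ) ≠ 0 := Nat.cast_ne_zero.2 i.factorial_ne_zero
    split_ifs
    · field_simp
    · simp
  simp only [h]
  rw [Finset.sum_ite_eq, if_pos (Finset.mem_range.2 hn)]

theorem analyticAt_bTaylor (q : ℝ → ℂ) (lamk z : ℂ) : AnalyticAt ℂ (bTaylor q lamk) z := by
  have : Differentiable ℂ (bTaylor q lamk) := by
    unfold bTaylor
    fun_prop
  exact this.analyticAt z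

theorem isPrincipalPart_residueCoeff (hq : Integrable q volume) {lamk : ℂ} (hl : 0 < lamk.im) :
    IsPrincipalPart (fun z => bTaylor q lamk z / a q z) lamk (mult q lamk)
      (residueCoeff q lamk) := by
  have h := exists_isPrincipalPart_div (analyticAt_bTaylor q lamk lamk)
    ((hol_a hq).analyticAt hl) (analyticOrderAt_a hq hl)
  rw [residueCoeff, dif_pos h]
  exact h.choose_spec

/-- Any analytic function with the right derivatives gives the same principal part. -/
theorem isPrincipalPart_of_iteratedDeriv (hq : Integrable q volume) {lamk : ℂ}
    (hl : 0 < lamk.im) {p : ℂ → ℂ} (hp : AnalyticAt ℂ p lamk)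
    (h : ∀ n < mult q lamk, iteratedDeriv n p lamk = bDeriv q lamk n) :
    IsPrincipalPart (fun z => p z / a q z) lamk (mult q lamk) (residueCoeff q lamk) := by
  refine (isPrincipalPart_residueCoeff hq hl).congr_isBigO ?_
  refine (isBigO_div_of_iteratedDeriv_eq_zero (hp.sub (analyticAt_bTaylor q lamk lamk))
    ((hol_a hq).analyticAt hl) (analyticOrderAt_a hq hl) fun n hn => ?_).congr_left fun z => ?_
  · rw [iteratedDeriv_sub hp.contDiffAt (analyticAt_bTaylor q lamk lamk).contDiffAt,
      iteratedDeriv_bTaylor q lamk hn, h n hn, sub_self]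
  · rw [Pi.sub_apply, sub_div]

/-- Where `u2` converges locally uniformly, its derivatives converge to those of `b`, so `b` has the
Taylor coefficients `bDeriv`. Intersecting with the half plane secures holomorphy of `u2`. -/
theorem isPrincipalPart_b (hq : Integrable q volume) {lamk : ℂ} (hl : 0 < lamk.im) {U : Set ℂ}
    (hU : IsOpen U) (hlU : lamk ∈ U) (h : TendstoLocallyUniformlyOn (u2 q) (b q) atTop U) :
    IsPrincipalPart (fun z => b q z / a q z) lamk (mult q lamk) (residueCoeff q lamk) := by
  have hV : IsOpen (U ∩ {z : ℂ | 0 < z.im}) := hU.inter isOpen_upper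
  have hd : ∀ᶠ t in (atTop : Filter ℝ), DifferentiableOn ℂ (u2 q t) (U ∩ {z : ℂ | 0 < z.im}) :=
    Eventually.of_forall fun t => (hol_u2 hq t).diff.mono Set.inter_subset_right
  have h' := h.mono (Set.inter_subset_left (t := {z : ℂ | 0 < z.im}))
  refine isPrincipalPart_of_iteratedDeriv hq hl
    ((h'.differentiableOn hd hV).analyticAt (hV.mem_nhds ⟨hlU, hl⟩)) fun n hn => ?_
  exact tendsto_nhds_unique ((tendsto_iteratedDeriv hV hd h' n).tendsto_at ⟨hlU, hl⟩)
    (tendsto_bDeriv hq hl hn)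

/-! ### Affine changes of the spectral parameter -/

theorem iteratedDeriv_comp_mul_left (c : ℂ) (g : ℂ → ℂ) (n : ℕ) :
    iteratedDeriv n (fun z => g (c * z)) = fun z => c ^ n * iteratedDeriv n g (c * z) := by
  induction n with
  | zero => simp
  | succ n ih =>
    funext z
    have := deriv_comp_mul_left c (iteratedDeriv n g) z
    rw [smul_eq_mul] at this
    rw [iteratedDeriv_succ, ih, deriv_const_mul_field, this, iteratedDeriv_succ, pow_succ, mul_assoc]

theorem iteratedDeriv_comp_affine (c d : ℂ) (g : ℂ → ℂ) (n : ℕ) (z : ℂ) :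
    iteratedDeriv n (fun z => g (c * z + d)) z = c ^ n * iteratedDeriv n g (c * z + d) := by
  have h := congrFun (iteratedDeriv_comp_mul_left c (fun y => g (y + d)) n) z
  rw [iteratedDeriv_comp_add_const] at h
  exact h

theorem IsPrincipalPart.comp_affine {f : ℂ → ℂ} {c d z₀ : ℂ} {L : ℕ} {r : ℕ → ℂ}
    (h : IsPrincipalPart f (c * z₀ + d) L r) (hc : c ≠ 0) :
    IsPrincipalPart (fun z => f (c * z + d)) z₀ L fun l => r l / c ^ (l + 1) := by
  have ht : Tendsto (fun z => c * z + d) (𝓝[≠] z₀) (𝓝[≠] (c * z₀ + d)) := by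
    refine tendsto_nhdsWithin_iff.2 ⟨?_, ?_⟩
    · have : ContinuousAt (fun z => c * z + d) z₀ := by fun_prop
      exact this.tendsto.mono_left nhdsWithin_le_nhds
    · filter_upwards [self_mem_nhdsWithin] with z hz
      simpa [hc] using hz
  refine (h.comp_tendsto ht).congr_left fun z => ?_
  simp only [Function.comp_apply]
  congr 1
  refine Finset.sum_congr rfl fun l _ => ?_
  rw [add_sub_add_right_eq_sub, ← mul_sub, mul_pow, div_div]

/-- The scattering solution of `q'` at `lam` is the one of `q` at `α * lam + β`, up to the
reparametrisation `σ` of time and the factor `E` of the second component. -/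
structure SpectralMap (q q' : ℝ → ℂ) (α β : ℝ) (E : ℂ → ℂ) (σ : ℝ → ℝ) : Prop where
  int : Integrable q volume
  int' : Integrable q' volume
  pos : 0 < α
  diff : Differentiable ℂ E
  tendsto : Tendsto σ atTop atTop
  jostX_eq : ∀ (t : ℝ) (lam : ℂ), 0 ≤ lam.im →
    jostX q' t lam = jostX q (σ t) (α * lam + β)
  u2_eq : ∀ (t : ℝ) (lam : ℂ), 0 ≤ lam.im →
    u2 q' t lam = E lam * u2 q (σ t) (α * lam + β)

namespace SpectralMap

variable {q' : ℝ → ℂ} {α β : ℝ} {E : ℂ → ℂ} {σ : ℝ → ℝ}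

theorem im_affine (α β : ℝ) (lam : ℂ) : (α * lam + β : ℂ).im = α * lam.im := by
  simp

theorem a_eq (h : SpectralMap q q' α β E σ) {lam : ℂ} (hl : 0 ≤ lam.im) :
    a q' lam = a q (α * lam + β) := by
  have hl' : 0 ≤ (α * lam + β : ℂ).im := by
    rw [im_affine]
    exact mul_nonneg h.pos.le hl
  refine tendsto_nhds_unique (tendsto_jostX_a h.int' hl) ?_
  simp only [h.jostX_eq _ lam hl]
  exact (tendsto_jostX_a h.int hl').comp h.tendsto

theorem Qc_eq (h : SpectralMap q q' α β E σ) (lam : ℝ) :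
    Qc q' lam = E lam * Qc q (α * lam + β) := by
  have hb : b q' lam = E lam * b q ((α * lam + β : ℝ) : ℂ) := by
    refine tendsto_nhds_unique (tendsto_u2 h.int' lam) ?_
    simp only [h.u2_eq _ (lam : ℂ) (by simp)]
    have := ((tendsto_u2 h.int (α * lam + β)).comp h.tendsto).const_mul (E lam)
    push_cast at this ⊢
    exact this
  rw [Qc, Qc, hb, h.a_eq (by simp), mul_div_assoc]
  push_cast
  rfl

theorem mem_eigenvalues_iff (h : SpectralMap q q' α β E σ) (lam : ℂ) :
    lam ∈ eigenvalues q' ↔ (α * lam + β : ℂ) ∈ eigenvalues q := by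
  simp only [eigenvalues, Set.mem_ofPred_eq, im_affine, mul_pos_iff_of_pos_left h.pos]
  exact and_congr_right fun hl => by rw [h.a_eq hl.le]

theorem a_eventuallyEq (h : SpectralMap q q' α β E σ) {lam : ℂ} (hl : 0 < lam.im) :
    a q' =ᶠ[𝓝 lam] fun z => a q (α * z + β) := by
  filter_upwards [isOpen_upper.mem_nhds hl] with z hz using h.a_eq (le_of_lt hz)

/-- An affine map with nonzero slope preserves orders of vanishing. -/
theorem mult_eq (h : SpectralMap q q' α β E σ) {lam : ℂ} (hl : 0 < lam.im) :
    mult q' lam = mult q (α * lam + β) := by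
  have hα : (α : ℂ) ≠ 0 := Complex.ofReal_ne_zero.2 h.pos.ne'
  have hd : HasDerivAt (fun z : ℂ => α * z + β) α lam := by
    simpa using ((hasDerivAt_id lam).const_mul (α : ℂ)).add_const (β : ℂ)
  rw [mult, mult, analyticOrderNatAt, analyticOrderNatAt,
    analyticOrderAt_congr (h.a_eventuallyEq hl)]
  congr 1
  exact analyticOrderAt_comp_of_deriv_ne_zero (f := a q) (g := fun z : ℂ => α * z + β)
    (by fun_prop) (by rwa [hd.deriv])

theorem iteratedDeriv_u2 (h : SpectralMap q q' α β E σ) {lam : ℂ} (hl : 0 < lam.im) (t : ℝ)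
    (n : ℕ) : iteratedDeriv n (u2 q' t) lam = ∑ i ∈ Finset.range (n + 1),
      n.choose i * iteratedDeriv i E lam *
        ((α : ℂ) ^ (n - i) * iteratedDeriv (n - i) (u2 q (σ t)) (α * lam + β)) := by
  have e : u2 q' t =ᶠ[𝓝 lam] fun z => E z * u2 q (σ t) (α * z + β) := by
    filter_upwards [isOpen_upper.mem_nhds hl] with z hz using h.u2_eq t z (le_of_lt hz)
  have hl' : 0 < (α * lam + β : ℂ).im := by
    rw [im_affine]
    exact mul_pos h.pos hl
  have ha : AnalyticAt ℂ (fun z : ℂ => u2 q (σ t) (α * z + β)) lam :=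
    ((hol_u2 h.int (σ t)).analyticAt hl').fun_comp (f := fun z : ℂ => α * z + β) (by fun_prop)
  rw [e.iteratedDeriv_eq, iteratedDeriv_fun_mul (h.diff.analyticAt lam).contDiffAt ha.contDiffAt]
  simp only [iteratedDeriv_comp_affine]

theorem bDeriv_eq (h : SpectralMap q q' α β E σ) {lam : ℂ} (hl : 0 < lam.im) {n : ℕ}
    (hn : n < mult q' lam) : bDeriv q' lam n = ∑ i ∈ Finset.range (n + 1),
      n.choose i * iteratedDeriv i E lam *
        ((α : ℂ) ^ (n - i) * bDeriv q (α * lam + β) (n - i)) := by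
  refine tendsto_nhds_unique (tendsto_bDeriv h.int' hl hn) ?_
  simp only [h.iteratedDeriv_u2 hl]
  have hl' : 0 < (α * lam + β : ℂ).im := by
    rw [im_affine]
    exact mul_pos h.pos hl
  rw [h.mult_eq hl] at hn
  exact tendsto_finsetSum _ fun i _ => (((tendsto_bDeriv h.int hl'
    (lt_of_le_of_lt (Nat.sub_le n i) hn)).comp h.tendsto).const_mul _).const_mul _

/-- By the Leibniz rule, `E` times the transported Taylor polynomial of `q` has the derivatives
`bDeriv q'` below the multiplicity, so it may replace `bTaylor q'`. The factor `E` then acts by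
`IsPrincipalPart.analytic_mul`. -/
theorem residueCoeff_eq (h : SpectralMap q q' α β E σ) {lam : ℂ} (hl : 0 < lam.im) {m : ℕ}
    (hm : m < mult q' lam) :
    residueCoeff q' lam m = ∑ l ∈ Finset.Ico m (mult q' lam),
      iteratedDeriv (l - m) E lam / (l - m).factorial *
        (residueCoeff q (α * lam + β) l / (α : ℂ) ^ (l + 1)) := by
  have hα : (α : ℂ) ≠ 0 := Complex.ofReal_ne_zero.2 h.pos.ne'
  have hl' : 0 < (α * lam + β : ℂ).im := by
    rw [im_affine]
    exact mul_pos h.pos hl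
  have hT : AnalyticAt ℂ (fun z : ℂ => bTaylor q (α * lam + β) (α * z + β)) lam :=
    (analyticAt_bTaylor q _ _).fun_comp (f := fun z : ℂ => α * z + β) (by fun_prop)
  have h1 := isPrincipalPart_of_iteratedDeriv h.int' hl
    ((h.diff.analyticAt lam).fun_mul hT) fun n hn => by
      rw [iteratedDeriv_fun_mul (h.diff.analyticAt lam).contDiffAt hT.contDiffAt, h.bDeriv_eq hl hn]
      refine Finset.sum_congr rfl fun i _ => ?_
      rw [iteratedDeriv_comp_affine, iteratedDeriv_bTaylor]
      rw [h.mult_eq hl] at hn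
      exact lt_of_le_of_lt (Nat.sub_le n i) hn
  have h2 := ((isPrincipalPart_residueCoeff h.int hl').comp_affine hα).analytic_mul
    (h.diff.analyticAt lam)
  rw [← h.mult_eq hl] at h2
  refine h1.unique (r' := fun m => ∑ l ∈ Finset.Ico m (mult q' lam),
    iteratedDeriv (l - m) E lam / (l - m).factorial *
      (residueCoeff q (α * lam + β) l / (α : ℂ) ^ (l + 1))) (h2.congr' ?_ EventuallyEq.rfl) m hm
  filter_upwards [(h.a_eventuallyEq hl).filter_mono nhdsWithin_le_nhds] with z hz
  rw [hz, mul_div_assoc]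

theorem residueCoeff_eq_of_const {c : ℂ} (h : SpectralMap q q' α β (fun _ => c) σ) {lam : ℂ}
    (hl : 0 < lam.im) {m : ℕ} (hm : m < mult q' lam) :
    residueCoeff q' lam m = c * (residueCoeff q (α * lam + β) m / (α : ℂ) ^ (m + 1)) := by
  rw [h.residueCoeff_eq hl hm, Finset.sum_eq_single m]
  · simp
  · intro l hl hlm
    have := Finset.mem_Ico.1 hl
    rw [iteratedDeriv_const, if_neg (by lia)]
    simp
  · intro h'
    exact absurd (Finset.mem_Ico.2 ⟨le_rfl, hm⟩) h'

end SpectralMap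

/-! ### Shifts, modulations and dilations of the signal -/

theorem setIntegral_Iic_comp_div_add {α : ℝ} (hα : 0 < α) (τ t : ℝ) (g : ℝ → ℂ) :
    ∫ s in Set.Iic t, g (s / α + τ) = α * ∫ r in Set.Iic (t / α + τ), g r := by
  rw [← integral_indicator measurableSet_Iic, ← integral_indicator measurableSet_Iic]
  have e : Set.indicator (Set.Iic t) (fun s => g (s / α + τ)) =
      fun s => Set.indicator (Set.Iic (t / α + τ)) g (s / α + τ) := by
    funext s
    simp only [Set.indicator_apply, Set.mem_Iic, add_le_add_iff_right,
      div_le_div_iff_of_pos_right hα]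
  rw [e, Measure.integral_comp_div (fun s => Set.indicator (Set.Iic (t / α + τ)) g (s + τ)),
    integral_add_right_eq_self, abs_of_pos hα, Complex.real_smul]

/-- Substitution shows that the transformed Jost functions of `q` solve the Volterra system of `q'`;
uniqueness does the rest. The time-dependent exponentials cancel between the two versions of `u₂`,
which leaves `E`. -/
theorem SpectralMap.of_eq (hq : Integrable q volume) {q' : ℝ → ℂ} {α : ℝ} (hα : 0 < α)
    (τ ω φ : ℝ)
    (h : ∀ t : ℝ, q' t = 1 / α * q (t / α + τ) * exp (-2 * I * ω * t + I * φ)) :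
    SpectralMap q q' α (-(α * ω)) (fun lam => exp (-I * φ + 2 * I * (α * lam - α * ω) * τ))
      (fun t => t / α + τ) := by
  have hα' : (α : ℂ) ≠ 0 := Complex.ofReal_ne_zero.2 hα.ne'
  have hint : Integrable q' volume := by
    have h1 : Integrable (fun t => q (t / α + τ)) volume := (hq.comp_add_right τ).comp_div hα.ne'
    refine ((h1.const_mul (1 / (α : ℂ))).mul_bdd (c := 1)
      (g := fun t : ℝ => exp (-2 * I * ω * t + I * φ))
      (by fun_prop : Continuous fun t : ℝ => exp (-2 * I * ω * t + I * φ)).aestronglyMeasurable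
      (Eventually.of_forall fun t => ?_)).congr (Eventually.of_forall fun t => (h t).symm)
    rw [show (-2 * I * ω * t + I * φ : ℂ) = ((-2 * ω * t + φ : ℝ) : ℂ) * I by push_cast; ring,
      Complex.norm_exp_ofReal_mul_I]
  have hF : ∀ t : ℝ, exp (-2 * I * ω * t + I * φ) * exp (2 * I * ω * t - I * φ) = 1 := fun t => by
    rw [← Complex.exp_add, ← Complex.exp_zero]
    ring_nf
  have hFn : ∀ t : ℝ, ‖exp (2 * I * ω * t - I * φ)‖ = 1 := fun t => by
    rw [show (2 * I * ω * t - I * φ : ℂ) = ((2 * ω * t - φ : ℝ) : ℂ) * I by push_cast; ring,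
      Complex.norm_exp_ofReal_mul_I]
  have hconj : ∀ t : ℝ, (starRingEnd ℂ) (q' t) =
      1 / α * ((starRingEnd ℂ) (q (t / α + τ)) * exp (2 * I * ω * t - I * φ)) := fun t => by
    rw [h, map_mul, map_mul, ← Complex.exp_conj, map_div₀, map_one, Complex.conj_ofReal, mul_assoc]
    simp only [map_add, map_mul, map_neg, Complex.conj_I, Complex.conj_ofReal, map_ofNat]
    ring_nf
  have hV : ∀ lam : ℂ, 0 ≤ lam.im → IsVolterra q' lam
      (fun t => jostX q (t / α + τ) (α * lam + (-(α * ω) : ℝ)))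
      (fun t => exp (2 * I * ω * t - I * φ) *
        jostW q (t / α + τ) (α * lam + (-(α * ω) : ℝ))) := by
    intro lam hl
    have hl' : 0 ≤ (α * lam + (-(α * ω) : ℝ) : ℂ).im := by
      rw [im_affine]
      exact mul_nonneg hα.le hl
    have hJ := isVolterra_jost hq hl'
    have hσ : Continuous fun t : ℝ => t / α + τ := by fun_prop
    refine ⟨hJ.cont_x.comp hσ, (by fun_prop : Continuous fun t : ℝ =>
      exp (2 * I * ω * t - I * φ)).mul (hJ.cont_w.comp hσ), fun T => ⟨Real.exp (∫ s, ‖q s‖),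
      fun t _ => ⟨norm_jostX_le hq _ hl', ?_⟩⟩, fun t => ?_, fun t => ?_⟩
    · rw [norm_mul, hFn, one_mul]
      exact norm_jostW_le hq _ hl'
    · rw [hJ.eq_x]
      congr 1
      have e : ∀ s : ℝ, q' s * (exp (2 * I * ω * s - I * φ) *
          jostW q (s / α + τ) (α * lam + (-(α * ω) : ℝ))) =
          (fun r => 1 / α * (q r * jostW q r (α * lam + (-(α * ω) : ℝ)))) (s / α + τ) := by
        intro s
        rw [h]
        linear_combination (1 / α * q (s / α + τ) *
          jostW q (s / α + τ) (α * lam + (-(α * ω) : ℝ))) * hF s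
      simp only [e]
      rw [setIntegral_Iic_comp_div_add hα τ t fun r =>
        1 / α * (q r * jostW q r (α * lam + (-(α * ω) : ℝ))), integral_const_mul, ← mul_assoc,
        mul_one_div_cancel hα', one_mul]
    · rw [hJ.eq_w, mul_neg]
      congr 1
      have e : ∀ s : ℝ, exp (2 * I * lam * (t - s)) * ((starRingEnd ℂ) (q' s) *
          jostX q (s / α + τ) (α * lam + (-(α * ω) : ℝ))) =
          (fun r : ℝ => 1 / α * exp (2 * I * ω * t - I * φ) *
            (exp (2 * I * (α * lam + (-(α * ω) : ℝ)) * ((t / α + τ : ℝ) - r)) *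
            ((starRingEnd ℂ) (q r) * jostX q r (α * lam + (-(α * ω) : ℝ))))) (s / α + τ) := by
        intro s
        have e2 : exp (2 * I * lam * (t - s)) * exp (2 * I * ω * s - I * φ) =
            exp (2 * I * ω * t - I * φ) * exp (2 * I * (α * lam + (-(α * ω) : ℝ)) *
              ((t / α + τ : ℝ) - (s / α + τ : ℝ))) := by
          rw [← Complex.exp_add, ← Complex.exp_add]
          congr 1
          push_cast
          field_simp
          ring
        rw [hconj]
        linear_combination (1 / α * (starRingEnd ℂ) (q (s / α + τ)) *
          jostX q (s / α + τ) (α * lam + (-(α * ω) : ℝ))) * e2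
      simp only [e]
      rw [setIntegral_Iic_comp_div_add hα τ t fun r : ℝ => 1 / α * exp (2 * I * ω * t - I * φ) *
            (exp (2 * I * (α * lam + (-(α * ω) : ℝ)) * ((t / α + τ : ℝ) - r)) *
            ((starRingEnd ℂ) (q r) * jostX q r (α * lam + (-(α * ω) : ℝ)))),
        integral_const_mul, ← mul_assoc, ← mul_assoc, mul_one_div_cancel hα', one_mul]
  have hJ' := fun (lam : ℂ) (hl : 0 ≤ lam.im) =>
    (isVolterra_jost hint hl).unique hint hl (hV lam hl)
  refine ⟨hq, hint, hα, by fun_prop, ?_, fun t lam hl => congrFun (hJ' lam hl).1 t,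
    fun t lam hl => ?_⟩
  · exact tendsto_atTop_add_const_right _ _ (tendsto_id.atTop_div_const hα)
  · have hl' : 0 ≤ (α * lam + (-(α * ω) : ℝ) : ℂ).im := by
      rw [im_affine]
      exact mul_nonneg hα.le hl
    rw [GNFT.u2_eq hint hl, GNFT.u2_eq hq hl', congrFun (hJ' lam hl).2 t, ← mul_assoc, ← mul_assoc,
      ← Complex.exp_add, ← Complex.exp_add]
    congr 2
    push_cast
    field_simp
    ring

theorem phaseShift (hq : Integrable q volume) (φ₀ : ℝ) (q' : ℝ → ℂ)
    (h : ∀ t, q' t = q t * exp (I * φ₀)) :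
    (∀ lam : ℝ, Qc q' lam = Qc q lam * exp (-I * φ₀)) ∧ eigenvalues q' = eigenvalues q ∧
      ∀ lamk ∈ eigenvalues q, mult q' lamk = mult q lamk ∧
        ∀ l < mult q lamk, norming q' lamk l = norming q lamk l * exp (-I * φ₀) := by
  have H : SpectralMap q q' 1 0 (fun _ => exp (-I * φ₀)) (fun t => t / 1 + 0) := by
    simpa using SpectralMap.of_eq hq one_pos 0 0 φ₀ (q' := q') (by simpa using h)
  refine ⟨fun lam => ?_, Set.ext fun lam => ?_, fun lamk hk => ?_⟩
  · simpa [mul_comm] using H.Qc_eq lam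
  · simpa using H.mem_eigenvalues_iff lam
  · have hm : mult q' lamk = mult q lamk := by simpa using H.mult_eq hk.1
    refine ⟨hm, fun l hl => ?_⟩
    have := H.residueCoeff_eq_of_const hk.1 (hm ▸ hl)
    simp only [Complex.ofReal_one, one_mul, Complex.ofReal_zero, add_zero, one_pow, div_one] at this
    rw [norming, norming, this]
    ring

theorem frequencyShift (hq : Integrable q volume) (ω₀ : ℝ) (q' : ℝ → ℂ)
    (h : ∀ t : ℝ, q' t = q t * exp (-2 * I * ω₀ * t)) :
    (∀ lam : ℝ, Qc q' lam = Qc q (lam - ω₀)) ∧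
      eigenvalues q' = (fun lam => lam + (ω₀ : ℂ)) '' eigenvalues q ∧
      ∀ lamk ∈ eigenvalues q, mult q' (lamk + ω₀) = mult q lamk ∧
        ∀ l < mult q lamk, norming q' (lamk + ω₀) l = norming q lamk l := by
  have H : SpectralMap q q' 1 (-ω₀) (fun _ => 1) (fun t => t / 1 + 0) := by
    simpa using SpectralMap.of_eq hq one_pos 0 ω₀ 0 (q' := q') (by simpa using h)
  refine ⟨fun lam => ?_, Set.ext fun lam => ?_, fun lamk hk => ?_⟩
  · simpa [sub_eq_add_neg] using H.Qc_eq lam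
  · rw [H.mem_eigenvalues_iff, Set.mem_image]
    simp only [Complex.ofReal_one, one_mul, Complex.ofReal_neg, ← sub_eq_add_neg]
    refine ⟨fun hl => ⟨_, hl, sub_add_cancel _ _⟩, ?_⟩
    rintro ⟨x, hx, rfl⟩
    rwa [add_sub_cancel_right]
  · have hl : 0 < (lamk + ω₀).im := by simpa using hk.1
    have hm : mult q' (lamk + ω₀) = mult q lamk := by simpa using H.mult_eq hl
    refine ⟨hm, fun l hl' => ?_⟩
    have := H.residueCoeff_eq_of_const hl (hm ▸ hl')
    simp only [Complex.ofReal_one, one_mul, Complex.ofReal_neg, add_neg_cancel_right, one_pow,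
      div_one] at this
    rw [norming, norming, this]

theorem timeDilation (hq : Integrable q volume) (T : ℝ) (q' : ℝ → ℂ) (hT : 0 < T)
    (h : ∀ t, q' t = 1 / (T : ℂ) * q (t / T)) :
    (∀ lam : ℝ, Qc q' lam = Qc q (T * lam)) ∧
      eigenvalues q' = (fun lam => lam / (T : ℂ)) '' eigenvalues q ∧
      ∀ lamk ∈ eigenvalues q, mult q' (lamk / T) = mult q lamk ∧
        ∀ l < mult q lamk, norming q' (lamk / T) l = norming q lamk l / (T : ℂ) ^ (l + 1) := by
  have hT' : (T : ℂ) ≠ 0 := Complex.ofReal_ne_zero.2 hT.ne'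
  have H : SpectralMap q q' T 0 (fun _ => 1) (fun t => t / T + 0) := by
    simpa using SpectralMap.of_eq hq hT 0 0 0 (q' := q') (by simpa using h)
  refine ⟨fun lam => ?_, Set.ext fun lam => ?_, fun lamk hk => ?_⟩
  · simpa using H.Qc_eq lam
  · rw [H.mem_eigenvalues_iff, Set.mem_image]
    simp only [Complex.ofReal_zero, add_zero]
    refine ⟨fun hl => ⟨_, hl, mul_div_cancel_left₀ _ hT'⟩, ?_⟩
    rintro ⟨x, hx, rfl⟩
    rwa [mul_div_cancel₀ _ hT']
  · have hl : 0 < (lamk / T).im := by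
      rw [Complex.div_ofReal_im]
      exact div_pos hk.1 hT
    have e : (T : ℂ) * (lamk / T) + (0 : ℝ) = lamk := by
      rw [mul_div_cancel₀ _ hT', Complex.ofReal_zero, add_zero]
    have hm : mult q' (lamk / T) = mult q lamk := by rw [H.mult_eq hl, e]
    refine ⟨hm, fun l hl' => ?_⟩
    rw [norming, norming, H.residueCoeff_eq_of_const hl (hm ▸ hl'), e, one_mul, mul_div_assoc]

/-! ### Time shifts and exponentials of Jordan blocks -/

/-- The matrix with ones on the first superdiagonal. -/
def superdiag (L : ℕ) : Matrix (Fin L) (Fin L) ℂ :=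
  Matrix.of fun i j => if (i : ℕ) + 1 = (j : ℕ) then 1 else 0

theorem superdiag_pow_apply (L n : ℕ) (i j : Fin L) :
    (superdiag L ^ n) i j = if (i : ℕ) + n = (j : ℕ) then 1 else 0 := by
  induction n generalizing j with
  | zero => simp [Matrix.one_apply, Fin.ext_iff]
  | succ n ih =>
    rw [pow_succ, Matrix.mul_apply]
    simp only [ih]
    simp only [superdiag, Matrix.of_apply, ite_mul, one_mul, zero_mul]
    by_cases h : (i : ℕ) + (n + 1) = j
    · rw [if_pos h, Finset.sum_eq_single ⟨i + n, by have := j.2; lia⟩]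
      · simp [← h, add_assoc]
      · intro k _ hk
        rw [if_neg]
        intro hik
        exact hk (Fin.ext hik.symm)
      · simp
    · rw [if_neg h]
      refine Finset.sum_eq_zero fun k _ => ?_
      split_ifs <;> first | rfl | lia

theorem LambdaBlock_eq (lam : ℂ) (L : ℕ) :
    LambdaBlock lam L = algebraMap ℂ (Matrix (Fin L) (Fin L) ℂ) (-I * lam) - superdiag L := by
  ext i j
  rw [Matrix.sub_apply, Matrix.algebraMap_matrix_apply]
  simp only [LambdaBlock, superdiag, Matrix.of_apply]
  by_cases h : i = j
  · subst h
    simp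
  · simp only [if_neg h]
    split_ifs <;> simp

/-- The matrix is nilpotent, so the exponential series stops before index `L`, and each power fills
a single superdiagonal. -/
theorem exp_smul_superdiag_apply (c : ℂ) (L : ℕ) (i j : Fin L) :
    NormedSpace.exp (c • superdiag L) i j =
      if i ≤ j then c ^ ((j : ℕ) - i) / ((j : ℕ) - i).factorial else 0 := by
  have h0 : ∀ n ∉ Finset.range L, ((n.factorial : ℂ)⁻¹) • (c • superdiag L) ^ n = 0 := by
    intro n hn
    ext i j
    rw [smul_pow, Matrix.smul_apply, Matrix.smul_apply, superdiag_pow_apply, if_neg]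
    · simp
    · have := j.2
      have := Finset.mem_range.not.1 hn
      lia
  rw [NormedSpace.exp_eq_tsum ℂ]
  simp only []
  rw [tsum_eq_sum h0, Matrix.sum_apply]
  simp only [smul_pow, Matrix.smul_apply, superdiag_pow_apply, smul_eq_mul]
  split_ifs with h
  · rw [Finset.sum_eq_single ((j : ℕ) - i)]
    · rw [if_pos (by have : (i : ℕ) ≤ j := h; lia)]
      ring
    · intro n _ hn
      rw [if_neg (by lia)]
      simp
    · intro hn
      have := j.2
      have := Finset.mem_range.not.1 hn
      lia
  · refine Finset.sum_eq_zero fun n _ => ?_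
    rw [if_neg (by have : ¬ (i : ℕ) ≤ j := h; lia)]
    simp

/-- The scalar and nilpotent parts commute, so the exponential factors. -/
theorem exp_smul_LambdaBlock_apply (c lam : ℂ) (L : ℕ) (i j : Fin L) :
    NormedSpace.exp (c • LambdaBlock lam L) i j =
      if i ≤ j then exp (-I * lam * c) * ((-c) ^ ((j : ℕ) - i) / ((j : ℕ) - i).factorial)
      else 0 := by
  have e : c • LambdaBlock lam L =
      algebraMap ℂ (Matrix (Fin L) (Fin L) ℂ) (-I * lam * c) + (-c) • superdiag L := by
    rw [LambdaBlock_eq, smul_sub, neg_smul, sub_eq_add_neg, mul_comm _ c, map_mul _ c,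
      Algebra.smul_def]
  rw [e, Matrix.exp_add_of_commute _ _ (Algebra.commute_algebraMap_left _ _),
    Matrix.algebraMap_eq_diagonal, Matrix.exp_diagonal, Matrix.diagonal_mul,
    exp_smul_superdiag_apply]
  have e2 : NormedSpace.exp (algebraMap ℂ (Fin L → ℂ) (-I * lam * c)) i = exp (-I * lam * c) := by
    rw [Pi.coe_exp, Complex.exp_eq_exp_ℂ]
    rfl
  rw [e2, mul_ite, mul_zero]

theorem iteratedDeriv_exp_mul_const (c d z : ℂ) (n : ℕ) :
    iteratedDeriv n (fun z => exp (c * z + d)) z = c ^ n * exp (c * z + d) := by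
  rw [iteratedDeriv_comp_affine c d exp n z, iteratedDeriv_eq_iterate, Complex.iter_deriv_exp]

/-- Here `E(λ) = e^{-2iλt₀}` has Taylor coefficients `(-2it₀)^n E / n!`. The weights `i^l` in the
norming constants absorb the powers of `i`, leaving `(-2t₀)^n / n!`, the superdiagonals of the
matrix exponential. -/
theorem timeShift (hq : Integrable q volume) (t₀ : ℝ) (q' : ℝ → ℂ)
    (h : ∀ t, q' t = q (t - t₀)) :
    (∀ lam : ℝ, Qc q' lam = Qc q lam * exp (-2 * I * lam * t₀)) ∧
      eigenvalues q' = eigenvalues q ∧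
      ∀ lamk ∈ eigenvalues q, mult q' lamk = mult q lamk ∧
        normingRow q' lamk (mult q lamk) = normingRow q lamk (mult q lamk) ᵥ*
          NormedSpace.exp ((2 * t₀ : ℂ) • LambdaBlock lamk (mult q lamk)) := by
  have H : SpectralMap q q' 1 0 (fun lam => exp ((-2 * I * t₀) * lam + 0))
      (fun t => t / 1 + -t₀) := by
    convert SpectralMap.of_eq hq one_pos (-t₀) 0 0 (q' := q') (by simpa [sub_eq_add_neg] using h)
      using 2
    · simp
    · push_cast; ring_nf
  refine ⟨fun lam => ?_, Set.ext fun lam => ?_, fun lamk hk => ?_⟩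
  · rw [H.Qc_eq lam, mul_comm]
    simp only [one_mul, add_zero]
    ring_nf
  · simpa using H.mem_eigenvalues_iff lam
  · have hm : mult q' lamk = mult q lamk := by simpa using H.mult_eq hk.1
    refine ⟨hm, ?_⟩
    ext j
    have hj := j.2
    have hr := H.residueCoeff_eq hk.1 (m := mult q lamk - 1 - j) (by lia)
    simp only [Complex.ofReal_one, one_mul, Complex.ofReal_zero, add_zero, one_pow, div_one,
      hm] at hr
    rw [normingRow, norming, hr, Finset.mul_sum]
    simp only [Matrix.vecMul, dotProduct, exp_smul_LambdaBlock_apply, normingRow, norming]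
    have e0 := fun n => iteratedDeriv_exp_mul_const (-2 * I * t₀) 0 lamk n
    simp only [add_zero] at e0
    rw [← Finset.sum_filter_add_sum_filter_not Finset.univ (fun i => i ≤ j),
      Finset.sum_eq_zero (s := Finset.univ.filter fun i => ¬ i ≤ j), add_zero]
    · symm
      -- The row lists the norming constants in decreasing order, so position `i` carries index `L -
      -- 1 - i`, and `i ≤ j` becomes `l ≥ m`.
      refine Finset.sum_bij' (fun i _ => mult q lamk - 1 - i)
        (fun l hl => ⟨mult q lamk - 1 - l, by have := Finset.mem_Ico.1 hl; lia⟩) ?_ ?_ ?_ ?_ ?_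
      · intro i hi
        have h1 : (i : ℕ) ≤ j := (Finset.mem_filter.1 hi).2
        exact Finset.mem_Ico.2 ⟨by lia, by lia⟩
      · intro l hl
        have := Finset.mem_Ico.1 hl
        refine Finset.mem_filter.2 ⟨Finset.mem_univ _, Fin.le_def.2 ?_⟩
        simp only
        lia
      · intro i hi
        have := i.2
        exact Fin.ext (by simp only; lia)
      · intro l hl
        have := Finset.mem_Ico.1 hl
        simp only
        lia
      · intro i hi
        have h1 : i ≤ j := (Finset.mem_filter.1 hi).2
        have h2 : (i : ℕ) ≤ j := h1
        have h3 : mult q lamk - 1 - i - (mult q lamk - 1 - j) = (j : ℕ) - i := by lia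
        have h4 : mult q lamk - 1 - i = (mult q lamk - 1 - j) + ((j : ℕ) - i) := by lia
        rw [if_pos h1, h3, e0]
        nth_rewrite 1 [h4]
        rw [pow_add, show (-2 * I * t₀ : ℂ) = I * -(2 * t₀) by ring, mul_pow,
          show -I * lamk * (2 * t₀) = I * -(2 * t₀) * lamk by ring]
        ring
    · intro i hi
      rw [if_neg (Finset.mem_filter.1 hi).2, mul_zero]

/-! ### Autocorrelations and the behaviour of `a` high up on the imaginary axis -/

/-- The autocorrelation is an inner product of `q` with a translate, and translation is continuous
in `L²`. -/
theorem tendsto_autocorrelation (h2 : MemLp q 2 volume) :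
    Tendsto (fun τ : ℝ => ∫ s, q s * (starRingEnd ℂ) (q (s - τ))) (𝓝 0)
      (𝓝 ((∫ s, ‖q s‖ ^ 2 : ℝ) : ℂ)) := by
  set F := h2.toLp q with hF
  have e : ∀ τ : ℝ, ∫ s, q s * (starRingEnd ℂ) (q (s - τ)) =
      inner ℂ (DomAddAct.mk (-τ) +ᵥ F) F := by
    intro τ
    rw [L2.inner_def]
    have h1 := DomAddAct.vadd_Lp_ae_eq (DomAddAct.mk (-τ)) F
    have h3 := (measurePreserving_add_left volume (-τ)).quasiMeasurePreserving.ae_eq_comp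
      h2.coeFn_toLp
    refine integral_congr_ae ?_
    filter_upwards [h1, h3, h2.coeFn_toLp] with s hs1 hs2 hs3
    rw [RCLike.inner_apply, hs1, hs3]
    simp only [Function.comp_apply] at hs2
    rw [Equiv.symm_apply_apply, vadd_eq_add, hs2, sub_eq_neg_add]
  have : Fact ((2 : ENNReal) ≠ ⊤) := ⟨by simp⟩
  have hc : Continuous fun τ : ℝ => inner ℂ (DomAddAct.mk (-τ) +ᵥ F) F := by
    have h1 : Continuous fun τ : ℝ => DomAddAct.mk (-τ) +ᵥ F :=
      (DomAddAct.continuous_mk.comp continuous_neg).vadd continuous_const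
    exact h1.inner continuous_const
  have h0 := hc.tendsto 0
  rw [← e 0] at h0
  simp only [← e, sub_zero, Complex.mul_conj', ← Complex.ofReal_pow, integral_complex_ofReal] at h0
  exact h0

theorem integrable_norm_sq (h2 : MemLp q 2 volume) : Integrable (fun s => ‖q s‖ ^ 2) volume :=
  h2.integrable_norm_pow two_ne_zero

theorem integrable_norm_mul_norm_shift (h2 : MemLp q 2 volume) (τ : ℝ) :
    Integrable (fun s => ‖q s‖ * ‖q (s - τ)‖) volume :=
  MemLp.integrable_mul h2.norm
    (h2.comp_measurePreserving (measurePreserving_sub_right volume τ)).norm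

theorem integral_norm_mul_norm_shift_le (h2 : MemLp q 2 volume) (τ : ℝ) :
    ∫ s, ‖q s‖ * ‖q (s - τ)‖ ≤ ∫ s, ‖q s‖ ^ 2 := by
  have h1 := integrable_norm_sq h2
  have h3 : Integrable (fun s => ‖q (s - τ)‖ ^ 2) volume := h1.comp_sub_right τ
  calc ∫ s, ‖q s‖ * ‖q (s - τ)‖
      ≤ ∫ s, (‖q s‖ ^ 2 + ‖q (s - τ)‖ ^ 2) / 2 :=
        integral_mono (integrable_norm_mul_norm_shift h2 τ) ((h1.add h3).div_const 2) fun s => by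
          have := sq_nonneg (‖q s‖ - ‖q (s - τ)‖)
          simp only
          linarith
    _ = ∫ s, ‖q s‖ ^ 2 := by
        rw [integral_div, integral_add h1 h3,
          integral_sub_right_eq_self (fun s => ‖q s‖ ^ 2) τ]
        ring

/-- The correlation of `q` with the integrand `conj q * x` of the Volterra equation. -/
def correlation (q : ℝ → ℂ) (lam : ℂ) (τ : ℝ) : ℂ :=
  ∫ s, q s * ((starRingEnd ℂ) (q (s - τ)) * jostX q (s - τ) lam)

theorem norm_correlation_le (hq : Integrable q volume) (h2 : MemLp q 2 volume) {lam : ℂ}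
    (hl : 0 ≤ lam.im) (τ : ℝ) :
    ‖correlation q lam τ‖ ≤ Real.exp (∫ s, ‖q s‖) * ∫ s, ‖q s‖ ^ 2 := by
  refine (norm_integral_le_of_norm_le ((integrable_norm_mul_norm_shift h2 τ).const_mul
    (Real.exp (∫ s, ‖q s‖))) (Eventually.of_forall fun s => ?_)).trans ?_
  · rw [norm_mul, norm_mul, RCLike.norm_conj, ← mul_assoc, mul_comm]
    gcongr
    exact norm_jostX_le hq _ hl
  · rw [integral_const_mul]
    exact mul_le_mul_of_nonneg_left (integral_norm_mul_norm_shift_le h2 τ) (Real.exp_nonneg _)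

theorem norm_correlation_sub_le (hq : Integrable q volume) (h2 : MemLp q 2 volume) {lam : ℂ}
    (hl : 0 ≤ lam.im) {ε : ℝ} (hε : ∀ t, ‖jostX q t lam - 1‖ ≤ ε) (τ : ℝ) :
    ‖correlation q lam τ - ∫ s, q s * (starRingEnd ℂ) (q (s - τ))‖ ≤ ε * ∫ s, ‖q s‖ ^ 2 := by
  have hε0 : 0 ≤ ε := (norm_nonneg _).trans (hε 0)
  have hi : Integrable (fun s => q s * (starRingEnd ℂ) (q (s - τ))) volume :=
    MemLp.integrable_mul h2
      (h2.comp_measurePreserving (measurePreserving_sub_right volume τ)).star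
  have hj : Integrable (fun s => q s * ((starRingEnd ℂ) (q (s - τ)) * jostX q (s - τ) lam))
      volume := by
    simp only [← mul_assoc]
    exact integrable_mul_of_bdd (φ := fun s => jostX q (s - τ) lam) hi
      ((continuous_jostX hq hl).comp (continuous_sub_right τ)) fun t => norm_jostX_le hq _ hl
  rw [correlation, ← integral_sub hj hi]
  refine (norm_integral_le_of_norm_le ((integrable_norm_mul_norm_shift h2 τ).const_mul ε)
    (Eventually.of_forall fun s => ?_)).trans ?_
  · rw [show q s * ((starRingEnd ℂ) (q (s - τ)) * jostX q (s - τ) lam) -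
      q s * (starRingEnd ℂ) (q (s - τ)) =
      (q s * (starRingEnd ℂ) (q (s - τ))) * (jostX q (s - τ) lam - 1) by ring, norm_mul, norm_mul,
      RCLike.norm_conj, mul_comm]
    gcongr
    exact hε _
  · rw [integral_const_mul]
    exact mul_le_mul_of_nonneg_left (integral_norm_mul_norm_shift_le h2 τ) hε0

/-- Smallness of `w` at large `|λ|` passes to `x - 1` through `x = 1 + ∫ q w`, uniformly in `t`. -/
theorem exists_norm_jostX_sub_one_le (hq : Integrable q volume) {ε : ℝ} (hε : 0 < ε) :
    ∃ R : ℝ, ∀ lam : ℂ, 0 ≤ lam.im → R ≤ ‖lam‖ → ∀ t, ‖jostX q t lam - 1‖ ≤ ε := by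
  set N := (∫ s, ‖q s‖) with hN
  have hN0 : 0 ≤ N := integral_nonneg fun _ => norm_nonneg _
  obtain ⟨R, hR⟩ := exists_norm_jostW_le hq (ε := ε / (N + 1)) (by positivity)
  refine ⟨R, fun lam hl hlam t => ?_⟩
  rw [(isVolterra_jost hq hl).eq_x, add_sub_cancel_left]
  refine (norm_integral_le_of_norm_le (g := fun s => ‖q s‖ * (ε / (N + 1)))
    (hq.norm.mul_const _).integrableOn (Eventually.of_forall fun s => ?_)).trans ?_
  · rw [norm_mul]
    gcongr
    exact hR lam hl hlam s
  · rw [integral_mul_const]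
    calc (∫ s in Set.Iic t, ‖q s‖) * (ε / (N + 1)) ≤ N * (ε / (N + 1)) := by
          gcongr
          exact cumNorm_le hq t
      _ ≤ ε := by
          rw [mul_div_assoc', div_le_iff₀ (by positivity)]
          nlinarith

/-- The convolution kernel of the Volterra equation. -/
def expKernel (lam : ℂ) : ℝ → ℂ := Set.indicator (Set.Ici 0) fun τ => exp (2 * I * lam * τ)

theorem measurable_expKernel (lam : ℂ) : Measurable (expKernel lam) :=
  (by fun_prop : Continuous fun τ : ℝ => exp (2 * I * lam * τ)).measurable.indicator
    measurableSet_Ici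

theorem norm_expKernel_le {lam : ℂ} (hl : 0 ≤ lam.im) (τ : ℝ) : ‖expKernel lam τ‖ ≤ 1 := by
  rw [expKernel, Set.indicator_apply]
  split_ifs with h
  · simpa using norm_exp_two_I_mul_le hl (Set.mem_Ici.1 h)
  · simp

theorem jostW_eq_integral_expKernel (hq : Integrable q volume) {lam : ℂ} (hl : 0 ≤ lam.im)
    (t : ℝ) : jostW q t lam =
      -∫ τ, expKernel lam τ * ((starRingEnd ℂ) (q (t - τ)) * jostX q (t - τ) lam) := by
  rw [(isVolterra_jost hq hl).eq_w, ← integral_indicator measurableSet_Iic,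
    ← integral_sub_left_eq_self _ volume t]
  congr 2 with τ
  simp only [expKernel, Set.indicator_apply, Set.mem_Iic, Set.mem_Ici, sub_le_self_iff, ite_mul,
    zero_mul]
  push_cast
  rw [sub_sub_cancel]

theorem integrable_correlation_integrand (hq : Integrable q volume) {lam : ℂ} (hl : 0 ≤ lam.im) :
    Integrable (fun p : ℝ × ℝ => q p.2 * ((starRingEnd ℂ) (q (p.2 - p.1)) *
      jostX q (p.2 - p.1) lam)) (volume.prod volume) := by
  have hp : Integrable (fun s => (starRingEnd ℂ) (q s) * jostX q s lam) volume :=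
    integrable_mul_of_bdd (integrable_conj hq) (continuous_jostX hq hl)
      fun t => norm_jostX_le hq t hl
  have := hq.convolution_integrand (ContinuousLinearMap.mul ℝ ℂ) hp.comp_neg
  simpa using this

/-- Insert the equation for `w` into `a = 1 + ∫ q w` and apply Fubini, collecting pairs of times by
their lag `τ`. -/
theorem one_sub_a_eq (hq : Integrable q volume) {lam : ℂ} (hl : 0 ≤ lam.im) :
    1 - a q lam = ∫ τ, expKernel lam τ * correlation q lam τ := by
  have h := integrable_correlation_integrand hq hl
  have h' : Integrable (Function.uncurry fun s τ : ℝ => expKernel lam τ *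
      (q s * ((starRingEnd ℂ) (q (s - τ)) * jostX q (s - τ) lam))) (volume.prod volume) :=
    h.swap.bdd_mul (c := 1) ((measurable_expKernel lam).comp measurable_snd).aestronglyMeasurable
      (Eventually.of_forall fun p => norm_expKernel_le hl _)
  simp only [correlation, ← integral_const_mul]
  rw [← integral_integral_swap h', a_eq hq hl, sub_add_cancel_left, ← integral_neg]
  congr 1 with s
  rw [jostW_eq_integral_expKernel hq hl, mul_neg, neg_neg, ← integral_const_mul]
  congr 1 with τ
  ring

/-- With `λ = iy` and `τ = u / y` the kernel becomes `e^{-2u}` on `u ≥ 0`, of integral `1 / 2`,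
while the lag `u / y` tends to zero and the correlation to `‖q‖₂²`. -/
theorem tendsto_mul_one_sub_a (hq : Integrable q volume) (h2 : MemLp q 2 volume) :
    Tendsto (fun y : ℝ => (y : ℂ) * (1 - a q (I * y))) atTop
      (𝓝 (((∫ s, ‖q s‖ ^ 2) / 2 : ℝ) : ℂ)) := by
  set N := ∫ s, ‖q s‖ ^ 2 with hN
  set M := Real.exp (∫ s, ‖q s‖) with hM
  have hl : ∀ y : ℝ, 0 < y → 0 ≤ (I * y : ℂ).im := fun y hy => by simpa using hy.le
  have e : ∀ᶠ y : ℝ in atTop, ∫ u, expKernel I u * correlation q (I * y) (u / y) =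
      (y : ℂ) * (1 - a q (I * y)) := by
    filter_upwards [eventually_gt_atTop 0] with y hy
    have := Measure.integral_comp_div
      (fun τ => expKernel (I * y) τ * correlation q (I * y) τ) y
    rw [abs_of_pos hy, Complex.real_smul, ← one_sub_a_eq hq (hl y hy)] at this
    rw [← this]
    congr 1 with u
    congr 1
    simp only [expKernel, Set.indicator_apply, Set.mem_Ici, le_div_iff₀ hy, zero_mul]
    refine if_congr Iff.rfl ?_ rfl
    congr 1
    have : (y : ℂ) ≠ 0 := Complex.ofReal_ne_zero.2 hy.ne'
    push_cast
    field_simp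
  have hk : Integrable (expKernel I) volume := by
    rw [expKernel, integrable_indicator_iff measurableSet_Ici, integrableOn_Ici_iff_integrableOn_Ioi]
    exact integrableOn_exp_mul_complex_Ioi (by simp) 0
  have hk1 : ∫ u, expKernel I u = 1 / 2 := by
    rw [expKernel, integral_indicator measurableSet_Ici, integral_Ici_eq_integral_Ioi,
      integral_exp_mul_complex_Ioi (by simp)]
    rw [show (2 * I * I : ℂ) = -2 by rw [mul_assoc, I_mul_I]; norm_num]
    simp
  have hlim : ∫ u, expKernel I u * (N : ℂ) = ((N / 2 : ℝ) : ℂ) := by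
    rw [integral_mul_const, hk1]
    push_cast
    ring
  rw [← hlim]
  refine Tendsto.congr' e (tendsto_integral_filter_of_dominated_convergence
    (fun u => ‖expKernel I u‖ * (M * N)) ?_ ?_ (hk.norm.mul_const _) ?_)
  · filter_upwards [eventually_gt_atTop 0] with y hy
    have h1 : Integrable (correlation q (I * y)) volume :=
      (integrable_correlation_integrand hq (hl y hy)).integral_prod_left
    exact hk.1.mul (h1.comp_div hy.ne').1
  · filter_upwards [eventually_gt_atTop 0] with y hy
    refine Eventually.of_forall fun u => ?_
    rw [norm_mul]
    gcongr
    exact norm_correlation_le hq h2 (hl y hy) _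
  -- Two limits are combined: `x → 1` uniformly turns the correlation into the autocorrelation,
  -- which is continuous at lag zero.
  · refine Eventually.of_forall fun u => Tendsto.const_mul _ ?_
    have h1 : Tendsto (fun y : ℝ => u / y) atTop (𝓝 0) := tendsto_const_nhds.div_atTop tendsto_id
    have h3 := (tendsto_autocorrelation h2).comp h1
    have h4 : Tendsto (fun y : ℝ => correlation q (I * y) (u / y) -
        ∫ s, q s * (starRingEnd ℂ) (q (s - u / y))) atTop (𝓝 0) := by
      have hN0 : 0 ≤ N := integral_nonneg fun s => by positivity
      rw [Metric.tendsto_nhds]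
      intro ε hε
      obtain ⟨R, hR⟩ := exists_norm_jostX_sub_one_le hq (ε := ε / (N + 1)) (by positivity)
      filter_upwards [eventually_gt_atTop 0, eventually_ge_atTop R] with y hy hyR
      rw [dist_zero_right]
      refine (norm_correlation_sub_le hq h2 (hl y hy) (hR _ (hl y hy) ?_) _).trans_lt ?_
      · rw [norm_mul, Complex.norm_I, one_mul, Complex.norm_real]
        exact hyR.trans (le_abs_self y)
      · rw [← hN, div_mul_eq_mul_div, div_lt_iff₀ (by positivity)]
        nlinarith
    simpa using h4.add h3

theorem tendsto_mul_log_norm_a (hq : Integrable q volume) (h2 : MemLp q 2 volume) :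
    Tendsto (fun y : ℝ => y * Real.log ‖a q (I * y)‖) atTop (𝓝 (-((∫ s, ‖q s‖ ^ 2) / 2))) := by
  have h1 : Tendsto (fun y : ℝ => (y : ℂ) * (a q (I * y) - 1)) atTop
      (𝓝 (-(((∫ s, ‖q s‖ ^ 2) / 2 : ℝ) : ℂ))) :=
    (tendsto_mul_one_sub_a hq h2).neg.congr fun y => by ring
  have h3 := (Complex.continuous_re.tendsto _).comp
    (Complex.tendsto_mul_log_one_add_of_tendsto h1)
  refine (h3.congr fun y => ?_).trans_eq (by simp)
  rw [Function.comp_apply, Complex.re_ofReal_mul, Complex.log_re, add_sub_cancel]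

/-! ### The Poisson formula on the imaginary axis for nonvanishing functions -/

/-- The Cayley transform from the disc to the upper half plane which maps `0` to `i y`. -/
def cayley (y : ℝ) (ζ : ℂ) : ℂ := I * y * ((1 + ζ) / (1 - ζ))

theorem cayley_im (y : ℝ) (ζ : ℂ) :
    (cayley y ζ).im = y * ((1 - ‖ζ‖ ^ 2) / ‖1 - ζ‖ ^ 2) := by
  have e : (cayley y ζ).im = y * ((1 + ζ) / (1 - ζ)).re := by
    simp [cayley, Complex.mul_im]
  rw [e, Complex.div_re, ← Complex.normSq_eq_norm_sq, ← Complex.normSq_eq_norm_sq, ← add_div]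
  congr 2
  simp [Complex.normSq_apply]
  ring

theorem cayley_im_nonneg {y : ℝ} (hy : 0 < y) {ζ : ℂ} (hζ : ‖ζ‖ ≤ 1) : 0 ≤ (cayley y ζ).im := by
  rw [cayley_im]
  have : 0 ≤ 1 - ‖ζ‖ ^ 2 := by nlinarith [norm_nonneg ζ]
  positivity

theorem cayley_im_pos {y : ℝ} (hy : 0 < y) {ζ : ℂ} (hζ : ‖ζ‖ < 1) : 0 < (cayley y ζ).im := by
  rw [cayley_im]
  have h1 : 0 < 1 - ‖ζ‖ ^ 2 := by nlinarith [norm_nonneg ζ]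
  have h2 : 1 - ζ ≠ 0 := sub_ne_zero.2 fun h => by simp [← h] at hζ
  positivity

/-- The boundary point `1` corresponds to infinity, so it is there that the behaviour of `A` at
infinity enters. -/
theorem tendsto_cayley {y : ℝ} (hy : 0 < y) :
    Tendsto (cayley y) (𝓝[≠] 1) (cocompact ℂ) := by
  have h1 : Tendsto (fun ζ : ℂ => (1 - ζ)⁻¹) (𝓝[≠] 1) (cocompact ℂ) := by
    rw [← Metric.cobounded_eq_cocompact]
    refine tendsto_inv₀_nhdsNE_zero.comp (tendsto_nhdsWithin_iff.2 ⟨?_, ?_⟩)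
    · have : ContinuousAt (fun ζ : ℂ => 1 - ζ) 1 := by fun_prop
      simpa using this.tendsto.mono_left nhdsWithin_le_nhds
    · filter_upwards [self_mem_nhdsWithin] with ζ hζ
      exact sub_ne_zero.2 (Ne.symm hζ)
  rw [← Metric.cobounded_eq_cocompact, ← tendsto_norm_atTop_iff_cobounded] at *
  have h2 : Tendsto (fun ζ : ℂ => ‖I * y * (1 + ζ)‖) (𝓝[≠] 1) (𝓝 ‖I * y * (1 + 1)‖) := by
    have : ContinuousAt (fun ζ : ℂ => ‖I * y * (1 + ζ)‖) 1 := by fun_prop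
    exact this.tendsto.mono_left nhdsWithin_le_nhds
  have h3 : 0 < ‖I * y * (1 + 1 : ℂ)‖ := by
    have : (y : ℂ) ≠ 0 := Complex.ofReal_ne_zero.2 hy.ne'
    rw [norm_pos_iff]
    norm_num [this]
  refine (h2.pos_mul_atTop h3 h1).congr fun ζ => ?_
  rw [← norm_mul, cayley, mul_assoc (I * (y : ℂ)), div_eq_mul_inv]

/-- With `θ = arctan (s / y)` the boundary point is `-e^{2iθ}`, and `i (1 - e^{2iθ}) / (1 + e^{2iθ})
= tan θ`. The added `π` makes the angle sweep `(0, 2π)`, omitting only the point `1`. -/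
theorem cayley_exp_arctan {y : ℝ} (hy : 0 < y) (s : ℝ) :
    cayley y (exp ((2 * Real.arctan (s / y) + Real.pi : ℝ) * I)) = s := by
  have hy' : (y : ℂ) ≠ 0 := Complex.ofReal_ne_zero.2 hy.ne'
  have hc : Complex.cos (Real.arctan (s / y)) ≠ 0 := by
    rw [← Complex.ofReal_cos]
    exact Complex.ofReal_ne_zero.2 (Real.cos_arctan_pos _).ne'
  have ht : Complex.sin (Real.arctan (s / y)) = s / y * Complex.cos (Real.arctan (s / y)) := by
    rw [← Complex.ofReal_cos, ← Complex.ofReal_sin, ← Complex.ofReal_div, ← Complex.ofReal_mul]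
    congr 1
    conv_lhs => rw [← Real.tan_mul_cos (Real.cos_arctan_pos _).ne', Real.tan_arctan]
  set α := ((Real.arctan (s / y) : ℝ) : ℂ) with hα
  have e : exp ((2 * Real.arctan (s / y) + Real.pi : ℝ) * I) = -(exp (α * I)) ^ 2 := by
    rw [← Complex.exp_nat_mul]
    rw [Complex.ofReal_add, Complex.ofReal_mul, ← hα, add_mul, Complex.exp_add,
      Complex.exp_pi_mul_I, mul_neg_one]
    push_cast
    ring_nf
  have e2 : exp (α * I) = Complex.cos α * (1 + s / y * I) := by
    rw [Complex.exp_mul_I, ht]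
    ring
  have e3 : Complex.cos α ^ 2 * (1 + (s / y) ^ 2) = 1 := by
    have := Complex.cos_sq_add_sin_sq α
    rw [ht] at this
    linear_combination this
  have h1 : 1 + (exp (α * I)) ^ 2 ≠ 0 := by
    rw [e2]
    have : (1 + (Complex.cos α * (1 + s / y * I)) ^ 2 : ℂ) =
        2 * Complex.cos α ^ 2 * (1 + s / y * I) := by
      linear_combination (-1 : ℂ) * e3 + (Complex.cos α ^ 2 * (s / y) ^ 2) * I_sq
    rw [this]
    refine mul_ne_zero (mul_ne_zero two_ne_zero (pow_ne_zero _ hc)) fun h => ?_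
    have := congrArg Complex.re h
    simp [← Complex.ofReal_div] at this
  rw [cayley, e, sub_neg_eq_add, mul_div_assoc', div_eq_iff h1, e2]
  have h4 : (s : ℂ) = y * (s / y) := by field_simp
  generalize (s / y : ℂ) = u at *
  rw [h4]
  linear_combination (-(I * y - y * u)) * e3 -
    (y * Complex.cos α ^ 2 * (I * u ^ 2 + 2 * u + u ^ 3)) * I_sq

/-- Circle averages as integrals over the real line. -/
theorem circleAverage_eq_integral_line {y : ℝ} (hy : 0 < y) (F : ℂ → ℝ) :
    Real.circleAverage F 0 1 = 1 / Real.pi * ∫ s : ℝ, y / (s ^ 2 + y ^ 2) *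
      F (exp ((2 * Real.arctan (s / y) + Real.pi : ℝ) * I)) := by
  set φ : ℝ → ℝ := fun s => 2 * Real.arctan (s / y) + Real.pi with hφ
  -- The Jacobian is twice the Poisson kernel at `iy` up to `π`; with the `1 / (2π)` of the average
  -- this leaves `1 / π`.
  have hd : ∀ s, HasDerivAt φ (2 * (y / (s ^ 2 + y ^ 2))) s := by
    intro s
    have h1 := (((Real.hasDerivAt_arctan (s / y)).comp s ((hasDerivAt_id s).div_const y)).const_mul
      2).add_const Real.pi
    refine h1.congr_deriv ?_
    have : s ^ 2 + y ^ 2 ≠ 0 := by positivity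
    field_simp
    ring
  have hinj : Function.Injective φ := by
    intro s t h
    have : Real.arctan (s / y) = Real.arctan (t / y) := by simpa [hφ] using h
    have := Real.arctan_injective this
    field_simp at this
    exact this
  have him : φ '' Set.univ = Set.Ioo 0 (2 * Real.pi) := by
    ext θ
    simp only [Set.image_univ, Set.mem_range, Set.mem_Ioo]
    constructor
    · rintro ⟨s, rfl⟩
      have h1 := Real.arctan_lt_pi_div_two (s / y)
      have h2 := Real.neg_pi_div_two_lt_arctan (s / y)
      constructor <;> simp only [hφ] <;> linarith
    · rintro ⟨h1, h2⟩
      refine ⟨y * Real.tan ((θ - Real.pi) / 2), ?_⟩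
      simp only [hφ]
      rw [mul_div_cancel_left₀ _ hy.ne', Real.arctan_tan (by linarith) (by linarith)]
      ring
  have h := integral_image_eq_integral_abs_deriv_smul MeasurableSet.univ
    (fun s _ => (hd s).hasDerivWithinAt) hinj.injOn fun θ => F (exp ((θ : ℝ) * I))
  rw [him, Measure.restrict_univ] at h
  rw [Real.circleAverage_def, intervalIntegral.integral_of_le (by positivity),
    integral_Ioc_eq_integral_Ioo]
  simp only [circleMap, Complex.ofReal_one, one_mul, zero_add]
  rw [h, smul_eq_mul, ← integral_const_mul, ← integral_const_mul]
  congr 1 with s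
  have : 0 < s ^ 2 + y ^ 2 := by positivity
  rw [abs_of_nonneg (by positivity), smul_eq_mul]
  simp only [hφ]
  generalize F _ = r
  field_simp

/-- Transplanted to the disc, `log |A|` is harmonic and extends continuously to the closed disc, so
its value at the centre is its average over the circle. -/
theorem log_norm_eq_poisson {A : ℂ → ℂ} (hA : Hol A) (h0 : ∀ z : ℂ, 0 ≤ z.im → A z ≠ 0)
    (hinf : Tendsto A (cocompact ℂ ⊓ 𝓟 {z | 0 ≤ z.im}) (𝓝 1)) {y : ℝ} (hy : 0 < y) :
    Real.log ‖A (I * y)‖ = 1 / Real.pi * ∫ s : ℝ, y / (s ^ 2 + y ^ 2) * Real.log ‖A s‖ := by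
  classical
  -- The value `0 = log 1` at `ζ = 1` is the limit dictated by `A → 1` at infinity.
  set G : ℂ → ℝ := fun ζ => if ζ = 1 then 0 else Real.log ‖A (cayley y ζ)‖ with hG
  have hca : ∀ ζ : ℂ, ζ ≠ 1 → AnalyticAt ℂ (cayley y) ζ := fun ζ hζ =>
    analyticAt_const.mul ((analyticAt_const.add analyticAt_id).div
      (analyticAt_const.sub analyticAt_id) (sub_ne_zero.2 hζ.symm))
  have hGe : ∀ ζ : ℂ, ζ ≠ 1 → (fun ζ => Real.log ‖A (cayley y ζ)‖) =ᶠ[𝓝 ζ] G := by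
    intro ζ hζ
    filter_upwards [isOpen_ne.mem_nhds hζ] with ξ hξ
    simp only [hG, if_neg (show ξ ≠ 1 from hξ)]
  have hharm : InnerProductSpace.HarmonicContOnCl G (Metric.ball 0 |1|) := by
    refine ⟨fun ζ hζ => ?_, ?_⟩
    · have hζ1 : ‖ζ‖ < 1 := by simpa using hζ
      have hne : ζ ≠ 1 := by rintro rfl; simp at hζ1
      refine (InnerProductSpace.harmonicAt_congr_nhds (hGe ζ hne)).1
        (AnalyticAt.harmonicAt_log_norm (f := fun ζ => A (cayley y ζ)) ?_
          (h0 _ (cayley_im_nonneg hy hζ1.le)))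
      exact (hA.analyticAt (cayley_im_pos hy hζ1)).fun_comp (hca ζ hne)
    · rw [abs_one, closure_ball _ one_ne_zero]
      intro ζ hζ
      have hmaps : ∀ ξ ∈ Metric.closedBall (0 : ℂ) 1, 0 ≤ (cayley y ξ).im := fun ξ hξ =>
        cayley_im_nonneg hy (by simpa using hξ)
      by_cases hne : ζ = 1
      · subst hne
        rw [← continuousWithinAt_sdiff_self, ContinuousWithinAt]
        have h1 : Tendsto (cayley y) (𝓝[Metric.closedBall 0 1 \ {1}] 1)
            (cocompact ℂ ⊓ 𝓟 {z | 0 ≤ z.im}) := by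
          refine tendsto_inf.2 ⟨(tendsto_cayley hy).mono_left (nhdsWithin_mono _ fun ξ hξ => hξ.2),
            tendsto_principal.2 ?_⟩
          filter_upwards [self_mem_nhdsWithin] with ξ hξ using hmaps ξ hξ.1
        have h2 := (hinf.comp h1).norm.log (by simp)
        rw [norm_one, Real.log_one] at h2
        rw [show G 1 = 0 by simp [hG]]
        refine h2.congr' ?_
        filter_upwards [self_mem_nhdsWithin] with ξ hξ
        simp only [hG, if_neg (show ξ ≠ 1 from hξ.2), Function.comp_apply]
      · refine ContinuousWithinAt.congr_of_eventuallyEq (f := fun ζ => Real.log ‖A (cayley y ζ)‖) ?_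
          ((hGe ζ hne).symm.filter_mono nhdsWithin_le_nhds) (hGe ζ hne).symm.eq_of_nhds
        refine ContinuousWithinAt.log ?_ (norm_ne_zero_iff.2 (h0 _ (hmaps ζ hζ)))
        exact ((hA.cont _ (hmaps ζ hζ)).comp (hca ζ hne).continuousAt.continuousWithinAt
          hmaps).norm
  have h := hharm.circleAverage_eq
  rw [circleAverage_eq_integral_line hy] at h
  have hG0 : G 0 = Real.log ‖A (I * y)‖ := by simp [hG, cayley]
  rw [← hG0, ← h]
  congr 1
  refine integral_congr_ae (Eventually.of_forall fun s => ?_)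
  have hne : exp ((2 * Real.arctan (s / y) + Real.pi : ℝ) * I) ≠ 1 := by
    intro h1
    have h2 := cayley_exp_arctan hy s
    rw [h1] at h2
    have h3 : s = 0 := by simpa [cayley] using h2.symm
    rw [h3] at h1
    norm_num [Complex.exp_pi_mul_I] at h1
  simp only [hG, if_neg hne, cayley_exp_arctan hy]

/-! ### Removing the zeros of `a` -/

/-- As `a → 1` at infinity, the zeros lie in a compact set. An accumulation point in the open half
plane contradicts the identity theorem, and one on the real line would by continuity be a real zero.
-/
theorem finite_eigenvalues (hq : Integrable q volume) (h0 : ∀ lam : ℝ, a q lam ≠ 0) :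
    (eigenvalues q).Finite := by
  by_contra hinf
  obtain ⟨R, hR⟩ := exists_norm_a_sub_one_le hq (ε := 1 / 2) (by norm_num)
  have hclosed : IsClosed {z : ℂ | 0 ≤ z.im} := isClosed_le continuous_const Complex.continuous_im
  have hsub : eigenvalues q ⊆ Metric.closedBall 0 R ∩ {z : ℂ | 0 ≤ z.im} := by
    intro z hz
    refine ⟨?_, hz.1.le⟩
    by_contra h
    have := hR z hz.1.le (by simpa using (not_le.1 (by simpa using h) : R < ‖z‖).le)
    rw [hz.2] at this
    norm_num at this
  obtain ⟨z, ⟨-, hz⟩, hacc⟩ := Set.Infinite.exists_accPt_of_subset_isCompact hinf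
    ((isCompact_closedBall 0 R).inter_right hclosed) hsub
  have hfreq : ∃ᶠ w in 𝓝[≠] z, w ∈ eigenvalues q := accPt_iff_frequently_nhdsNE.1 hacc
  have haz : a q z = 0 := by
    have h1 : Tendsto (a q) (𝓝[≠] z ⊓ 𝓟 (eigenvalues q)) (𝓝 (a q z)) :=
      ((hol_a hq).cont z hz).mono_left
        (inf_le_inf inf_le_left (principal_mono.2 fun w hw => le_of_lt hw.1))
    have : (𝓝[≠] z ⊓ 𝓟 (eigenvalues q)).NeBot := hacc
    refine tendsto_nhds_unique h1 (tendsto_const_nhds.congr' ?_)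
    filter_upwards [mem_inf_of_right (mem_principal_self _)] with w hw using hw.2.symm
  rcases (show (0 : ℝ) ≤ z.im from hz).eq_or_lt with h | h
  · refine h0 z.re ?_
    rwa [show ((z.re : ℝ) : ℂ) = z from Complex.ext rfl (by simpa using h)]
  · exact analyticOrderAt_a_ne_top hq h (analyticOrderAt_eq_top.2
      (((hol_a hq).analyticAt h).frequently_zero_iff_eventually_zero.1
        (hfreq.mono fun w hw => hw.2)))

theorem tendsto_a_cocompact (hq : Integrable q volume) :
    Tendsto (a q) (cocompact ℂ ⊓ 𝓟 {z | 0 ≤ z.im}) (𝓝 1) := by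
  rw [Metric.tendsto_nhds]
  intro ε hε
  obtain ⟨R, hR⟩ := exists_norm_a_sub_one_le hq (half_pos hε)
  have h1 := (tendsto_norm_cocompact_atTop (E := ℂ)).eventually_ge_atTop R
  filter_upwards [mem_inf_of_left h1, mem_inf_of_right (mem_principal_self _)] with z hz hz'
  rw [dist_eq_norm]
  exact (hR z hz' hz).trans_lt (half_lt_self hε)

theorem exists_eq_prod_mul (hq : Integrable q volume) (hfin : (eigenvalues q).Finite) :
    ∃ g : ℂ → ℂ, AnalyticOnNhd ℂ g {z | 0 < z.im} ∧ (∀ z : ℂ, 0 < z.im → g z ≠ 0) ∧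
      ∀ z : ℂ, 0 < z.im → a q z = (∏ k ∈ hfin.toFinset, (z - k) ^ mult q k) * g z := by
  classical
  have ha : AnalyticOnNhd ℂ (a q) {z : ℂ | 0 < z.im} := (hol_a hq).analyticOnNhd
  have hdiv : ∀ u : ℂ, MeromorphicOn.divisor (a q) {z : ℂ | 0 < z.im} u =
      if u ∈ eigenvalues q then (mult q u : ℤ) else 0 := by
    intro u
    by_cases hu : 0 < u.im
    · rw [MeromorphicOn.AnalyticOnNhd.divisor_apply ha hu, analyticOrderAt_a hq hu]
      split_ifs with h
      · rfl
      · have h1 : analyticOrderAt (a q) u = 0 :=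
          (ha u hu).analyticOrderAt_eq_zero.2 fun h2 => h ⟨hu, h2⟩
        rw [analyticOrderAt_a hq hu] at h1
        rw [h1]
        rfl
    · rw [if_neg fun h => hu h.1]
      exact Function.locallyFinsuppWithin.apply_eq_zero_of_notMem _ hu
  have hsupp : (MeromorphicOn.divisor (a q) {z : ℂ | 0 < z.im}).support ⊆ eigenvalues q := by
    intro u hu
    by_contra h
    exact hu (by rw [hdiv, if_neg h])
  obtain ⟨g, hg, hg0, he⟩ := MeromorphicOn.extract_zeros_poles ha.meromorphicOn
    (fun u => by
      rw [(ha u u.2).meromorphicOrderAt_eq, analyticOrderAt_a hq u.2]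
      exact WithTop.coe_ne_top) (hfin.subset hsupp)
  have hprod : (∏ᶠ u, (fun z => z - u) ^ MeromorphicOn.divisor (a q) {z : ℂ | 0 < z.im} u) =
      fun z => ∏ k ∈ hfin.toFinset, (z - k) ^ mult q k := by
    rw [finprod_eq_prod_of_mulSupport_subset (s := hfin.toFinset)]
    · funext z
      rw [Finset.prod_apply]
      refine Finset.prod_congr rfl fun k hk => ?_
      rw [Pi.pow_apply, hdiv, if_pos (hfin.mem_toFinset.1 hk), zpow_natCast]
    · intro u hu
      rw [hfin.coe_toFinset]
      by_contra h
      refine hu ?_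
      simp only [hdiv, if_neg h, zpow_zero]
  rw [hprod] at he
  refine ⟨g, hg, fun z hz => hg0 ⟨z, hz⟩, fun z hz => ?_⟩
  have hP : AnalyticAt ℂ ((fun z => ∏ k ∈ hfin.toFinset, (z - k) ^ mult q k) • g) z := by
    have : Differentiable ℂ fun z => ∏ k ∈ hfin.toFinset, (z - k) ^ mult q k := by fun_prop
    exact (this.analyticAt z).smul (hg z hz)
  -- The factorisation holds off a discrete set only; both sides are continuous, so it holds
  -- everywhere in the half plane.
  have h1 := (ha z hz).meromorphicAt.eventuallyEq_nhdsNE_of_eventuallyEq_codiscreteWithin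
    hP.meromorphicAt hz (by
      rw [accPt_iff_frequently_nhdsNE]
      exact Eventually.frequently (mem_nhdsWithin_of_mem_nhds (isOpen_upper.mem_nhds hz))) he
  exact (((ha z hz).continuousAt.eventuallyEq_nhds_iff_eventuallyEq_nhdsNE
    hP.continuousAt).1 h1).eq_of_nhds

/-- The Blaschke product with the poles `k ∈ S` of order `L k`. -/
def blaschke (S : Finset ℂ) (L : ℂ → ℕ) (z : ℂ) : ℂ :=
  ∏ k ∈ S, ((z - (starRingEnd ℂ) k) / (z - k)) ^ L k

theorem tendsto_blaschke (S : Finset ℂ) (L : ℂ → ℕ) :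
    Tendsto (blaschke S L) (cocompact ℂ) (𝓝 1) := by
  have h1 : ∀ k : ℂ, Tendsto (fun z => (z - (starRingEnd ℂ) k) / (z - k)) (cocompact ℂ) (𝓝 1) := by
    intro k
    have h2 : Tendsto (fun z : ℂ => z - k) (cocompact ℂ) (cocompact ℂ) :=
      (Homeomorph.subRight k).isClosedEmbedding.tendsto_cocompact
    have h3 : Tendsto (fun z : ℂ => 1 + (k - (starRingEnd ℂ) k) * (z - k)⁻¹) (cocompact ℂ)
        (𝓝 (1 + (k - (starRingEnd ℂ) k) * 0)) :=
      ((tendsto_inv₀_cobounded.comp (Metric.cobounded_eq_cocompact (α := ℂ) ▸ h2)).const_mul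
        _).const_add 1
    rw [mul_zero, add_zero] at h3
    refine h3.congr' ?_
    filter_upwards [(isCompact_singleton (x := k)).compl_mem_cocompact] with z hz
    have : z - k ≠ 0 := sub_ne_zero.2 hz
    field_simp
    ring
  have := tendsto_finsetProd S fun k _ => (h1 k).pow (L k)
  simp only [one_pow, Finset.prod_const_one] at this
  exact this

/-- On the real line numerator and denominator of each factor are conjugate, so `log |a|` is
unaffected there by the product. -/
theorem norm_blaschke_real (S : Finset ℂ) (hS : ∀ k ∈ S, 0 < k.im) (L : ℂ → ℕ) (s : ℝ) :
    ‖blaschke S L s‖ = 1 := by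
  rw [blaschke, norm_prod]
  refine Finset.prod_eq_one fun k hk => ?_
  have h1 : (s : ℂ) - (starRingEnd ℂ) k = (starRingEnd ℂ) (s - k) := by simp
  have h2 : (s : ℂ) - k ≠ 0 := fun h => (hS k hk).ne' (by simpa using congrArg Complex.im h)
  rw [norm_pow, norm_div, h1, RCLike.norm_conj, div_self (norm_ne_zero_iff.2 h2), one_pow]

theorem sub_conj_ne_zero {k z : ℂ} (hk : 0 < k.im) (hz : 0 ≤ z.im) :
    z - (starRingEnd ℂ) k ≠ 0 := fun h => by
  have := congrArg Complex.im h
  simp at this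
  linarith

theorem blaschke_ne_zero {S : Finset ℂ} (hS : ∀ k ∈ S, 0 < k.im) (L : ℂ → ℕ) {z : ℂ}
    (hz : 0 ≤ z.im) (hzS : z ∉ S) : blaschke S L z ≠ 0 :=
  Finset.prod_ne_zero_iff.2 fun k hk => pow_ne_zero _ (div_ne_zero
    (sub_conj_ne_zero (hS k hk) hz) (sub_ne_zero.2 fun h => hzS (h ▸ hk)))

theorem continuousAt_blaschke {S : Finset ℂ} (L : ℂ → ℕ) {z : ℂ} (hzS : z ∉ S) :
    ContinuousAt (blaschke S L) z := by
  refine tendsto_finsetProd S fun k hk => Tendsto.pow (Tendsto.div ?_ ?_ ?_) _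
  · exact (continuous_sub_right _).tendsto z
  · exact (continuous_sub_right _).tendsto z
  · exact sub_ne_zero.2 fun h => hzS (h ▸ hk)

theorem exists_nonvanishing_factor (hq : Integrable q volume) (h0 : ∀ lam : ℝ, a q lam ≠ 0)
    (hfin : (eigenvalues q).Finite) :
    ∃ A : ℂ → ℂ, Hol A ∧ (∀ z : ℂ, 0 ≤ z.im → A z ≠ 0) ∧
      Tendsto A (cocompact ℂ ⊓ 𝓟 {z | 0 ≤ z.im}) (𝓝 1) ∧
      ∀ z : ℂ, 0 ≤ z.im → z ∉ eigenvalues q →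
        A z = a q z * blaschke hfin.toFinset (mult q) z := by
  obtain ⟨g, hg, hg0, hag⟩ := exists_eq_prod_mul hq hfin
  set S := hfin.toFinset with hS
  have hS0 : ∀ k ∈ S, 0 < k.im := fun k hk => (hfin.mem_toFinset.1 hk).1
  -- At an eigenvalue the product `a * blaschke` takes the default value zero from division by zero;
  -- the cofactor `g` supplies the correct nonzero value.
  set A : ℂ → ℂ := fun z => if 0 < z.im then
    (∏ k ∈ S, (z - (starRingEnd ℂ) k) ^ mult q k) * g z else a q z * blaschke S (mult q) z with hA
  have hAe : ∀ z : ℂ, z ∉ eigenvalues q → A z = a q z * blaschke S (mult q) z := by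
    intro z hz
    simp only [hA]
    split_ifs with h
    · rw [hag z h, blaschke]
      simp only [div_pow, Finset.prod_div_distrib]
      have : ∏ k ∈ S, (z - k) ^ mult q k ≠ 0 := Finset.prod_ne_zero_iff.2 fun k hk =>
        pow_ne_zero _ (sub_ne_zero.2 fun h => hz (h ▸ hfin.mem_toFinset.1 hk))
      field_simp
    · rfl
  have hAd : DifferentiableOn ℂ A {z | 0 < z.im} := by
    have h1 : Differentiable ℂ fun z => ∏ k ∈ S, (z - (starRingEnd ℂ) k) ^ mult q k := by fun_prop
    exact (h1.differentiableOn.mul hg.differentiableOn).congr fun z hz => if_pos hz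
  have hreal : ∀ z : ℂ, ¬ 0 < z.im → z ∉ eigenvalues q := fun z hz h => hz h.1
  refine ⟨A, ⟨fun z hz => ?_, hAd⟩, fun z hz => ?_, ?_, fun z _ => hAe z⟩
  · by_cases h : 0 < z.im
    · exact (hAd.differentiableAt (isOpen_upper.mem_nhds h)).continuousAt.continuousWithinAt
    · have hzS : z ∉ S := fun hk => hreal z h (hfin.mem_toFinset.1 hk)
      refine (((hol_a hq).cont z hz).mul
        (continuousAt_blaschke (mult q) hzS).continuousWithinAt).congr_of_eventuallyEq ?_
        (hAe z (hreal z h))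
      filter_upwards [mem_nhdsWithin_of_mem_nhds
        (hfin.isClosed.isOpen_compl.mem_nhds (hreal z h))] with w hw using hAe w hw
  · by_cases h : 0 < z.im
    · simp only [hA, if_pos h]
      exact mul_ne_zero (Finset.prod_ne_zero_iff.2 fun k hk =>
        pow_ne_zero _ (sub_conj_ne_zero (hS0 k hk) hz)) (hg0 z h)
    · rw [hAe z (hreal z h)]
      refine mul_ne_zero ?_ (blaschke_ne_zero hS0 _ hz
        fun hk => hreal z h (hfin.mem_toFinset.1 hk))
      have := h0 z.re
      rwa [show ((z.re : ℝ) : ℂ) = z from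
        Complex.ext rfl (by simpa using le_antisymm hz (not_lt.1 h))] at this
  · have h1 := (tendsto_a_cocompact hq).mul
      ((tendsto_blaschke S (mult q)).mono_left (inf_le_left (b := 𝓟 {z : ℂ | 0 ≤ z.im})))
    rw [mul_one] at h1
    refine h1.congr' ?_
    filter_upwards [mem_inf_of_left hfin.isCompact.compl_mem_cocompact] with z hz
    exact (hAe z hz).symm

/-! ### Parseval's theorem -/

theorem log_one_add_norm_Qc_sq (hq : Integrable q volume) {lam : ℝ} (h0 : a q lam ≠ 0) :
    Real.log (1 + ‖Qc q lam‖ ^ 2) = -2 * Real.log ‖a q lam‖ := by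
  have h1 := norm_a_sq_add_norm_b_sq hq lam
  have h2 : ‖a q lam‖ ≠ 0 := norm_ne_zero_iff.2 h0
  have h3 : 1 + ‖Qc q lam‖ ^ 2 = (‖a q lam‖ ^ 2)⁻¹ := by
    rw [Qc, norm_div]
    field_simp
    linarith
  rw [h3, Real.log_inv, Real.log_pow]
  push_cast
  ring

theorem tendsto_ofReal_cocompact :
    Tendsto (fun s : ℝ => (s : ℂ)) (cocompact ℝ) (cocompact ℂ ⊓ 𝓟 {z | 0 ≤ z.im}) :=
  tendsto_inf.2 ⟨Complex.isometry_ofReal.isClosedEmbedding.tendsto_cocompact,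
    tendsto_principal.2 (Eventually.of_forall fun s => by simp)⟩

theorem continuous_log_norm_a (hq : Integrable q volume) (h0 : ∀ lam : ℝ, a q lam ≠ 0) :
    Continuous fun s : ℝ => Real.log ‖a q s‖ := by
  have h1 : Continuous fun s : ℝ => a q s :=
    (hol_a hq).cont.comp_continuous Complex.continuous_ofReal fun s => by simp
  exact h1.norm.log fun s => norm_ne_zero_iff.2 (h0 s)

theorem exists_abs_log_norm_a_le (hq : Integrable q volume) (h0 : ∀ lam : ℝ, a q lam ≠ 0) :
    ∃ C, ∀ s : ℝ, ‖Real.log ‖a q s‖‖ ≤ C := by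
  have h1 : Tendsto (fun s : ℝ => Real.log ‖a q s‖) (cocompact ℝ) (𝓝 0) := by
    have := ((tendsto_a_cocompact hq).comp tendsto_ofReal_cocompact).norm.log (by simp)
    simpa using this
  let f : ZeroAtInftyContinuousMap ℝ ℝ := ⟨⟨_, continuous_log_norm_a hq h0⟩, h1⟩
  exact ⟨‖f.toBCF‖, fun s => f.toBCF.norm_coe_le_norm s⟩

theorem integrable_poisson_mul_log (hq : Integrable q volume) (h0 : ∀ lam : ℝ, a q lam ≠ 0)
    {y : ℝ} (hy : 0 < y) :
    Integrable (fun s : ℝ => (1 + (s / y) ^ 2)⁻¹ * Real.log (1 + ‖Qc q s‖ ^ 2)) volume := by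
  obtain ⟨C, hC⟩ := exists_abs_log_norm_a_le hq h0
  simp only [fun s => log_one_add_norm_Qc_sq hq (h0 s)]
  refine (integrable_inv_one_add_sq.comp_div hy.ne').mul_bdd (c := 2 * C)
    ((continuous_log_norm_a hq h0).const_mul (-2)).aestronglyMeasurable
    (Eventually.of_forall fun s => ?_)
  rw [norm_mul]
  norm_num
  exact hC s

/-- Each factor at `iy` is `1 + (k - conj k) / (iy - k)`, and `y` times the deviation from one tends
to `2i Im k / i = 2 Im k`. -/
theorem tendsto_mul_log_norm_blaschke (S : Finset ℂ) (hS : ∀ k ∈ S, 0 < k.im) (L : ℂ → ℕ) :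
    Tendsto (fun y : ℝ => y * Real.log ‖blaschke S L (I * y)‖) atTop
      (𝓝 (∑ k ∈ S, L k * (2 * k.im))) := by
  have h1 : ∀ k ∈ S, Tendsto (fun y : ℝ => (L k : ℝ) *
      (y * Real.log ‖(I * y - (starRingEnd ℂ) k) / (I * y - k)‖)) atTop
      (𝓝 (L k * (2 * k.im))) := by
    intro k hk
    refine Tendsto.const_mul _ ?_
    have h2 : Tendsto (fun y : ℝ => (y : ℂ) * ((k - (starRingEnd ℂ) k) / (I * y - k))) atTop
        (𝓝 ((2 * k.im : ℝ) : ℂ)) := by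
      have h3 : Tendsto (fun y : ℝ => (k - (starRingEnd ℂ) k) / (I - k * ((y⁻¹ : ℝ) : ℂ))) atTop
          (𝓝 ((k - (starRingEnd ℂ) k) / (I - k * ((0 : ℝ) : ℂ)))) := by
        refine tendsto_const_nhds.div (tendsto_const_nhds.sub (Tendsto.const_mul k
          ((Complex.continuous_ofReal.tendsto 0).comp tendsto_inv_atTop_zero))) ?_
        simp
      have h4 : (k - (starRingEnd ℂ) k) / (I - k * ((0 : ℝ) : ℂ)) = ((2 * k.im : ℝ) : ℂ) := by
        rw [Complex.sub_conj]
        push_cast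
        rw [mul_zero, sub_zero, mul_div_cancel_right₀ _ I_ne_zero]
      rw [h4] at h3
      refine h3.congr' ?_
      filter_upwards [eventually_gt_atTop 0] with y hy
      have hy' : (y : ℂ) ≠ 0 := Complex.ofReal_ne_zero.2 hy.ne'
      have h5 : (I * y - k : ℂ) = y * (I - k * ((y⁻¹ : ℝ) : ℂ)) := by
        push_cast
        field_simp
      rw [h5, mul_div_assoc', mul_div_mul_left _ _ hy']
    have h6 := (Complex.continuous_re.tendsto _).comp
      (Complex.tendsto_mul_log_one_add_of_tendsto h2)
    rw [Complex.ofReal_re] at h6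
    refine h6.congr' ?_
    have h7 : ∀ᶠ y : ℝ in atTop, I * y - k ≠ 0 := by
      filter_upwards [eventually_gt_atTop k.im] with y hy h
      have := congrArg Complex.im h
      simp at this
      linarith
    filter_upwards [h7] with y hy
    rw [Function.comp_apply, Complex.re_ofReal_mul, Complex.log_re]
    congr 3
    field_simp
    ring
  refine (tendsto_finsetSum S h1).congr' ?_
  have h8 : ∀ᶠ y : ℝ in atTop, ∀ k ∈ S, I * y - k ≠ 0 := by
    rw [Filter.eventually_all_finset]
    intro k _
    filter_upwards [eventually_gt_atTop k.im] with y hy h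
    have := congrArg Complex.im h
    simp at this
    linarith
  filter_upwards [h8, eventually_ge_atTop 0] with y hy hy0
  rw [blaschke, norm_prod, Real.log_prod, Finset.mul_sum]
  · refine Finset.sum_congr rfl fun k _ => ?_
    rw [norm_pow, Real.log_pow]
    ring
  · intro k hk
    exact norm_ne_zero_iff.2 (pow_ne_zero _ (div_ne_zero
      (sub_conj_ne_zero (hS k hk) (by simpa using hy0)) (hy k hk)))

/-- Multiply the Poisson formula at `iy` by `-2πy`: the kernel becomes `y² / (s² + y²) = (1 +
(s/y)²)⁻¹` and `-2 log |a|` becomes `log (1 + |Q_c|²)`. -/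
theorem tendsto_poisson_integral (hq : Integrable q volume) (h2 : MemLp q 2 volume)
    (h0 : ∀ lam : ℝ, a q lam ≠ 0) (hfin : (eigenvalues q).Finite) :
    Tendsto (fun y : ℝ => ∫ s : ℝ, (1 + (s / y) ^ 2)⁻¹ * Real.log (1 + ‖Qc q s‖ ^ 2)) atTop
      (𝓝 (Real.pi * ((∫ t, ‖q t‖ ^ 2) -
        4 * ∑ k ∈ hfin.toFinset, (mult q k : ℝ) * k.im))) := by
  obtain ⟨A, hA, hA0, hinf, hAa⟩ := exists_nonvanishing_factor hq h0 hfin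
  have hS : ∀ k ∈ hfin.toFinset, 0 < k.im := fun k hk => (hfin.mem_toFinset.1 hk).1
  have h3 := (((tendsto_mul_log_norm_a hq h2).add
    (tendsto_mul_log_norm_blaschke hfin.toFinset hS (mult q))).const_mul (-2 * Real.pi))
  have e : -2 * Real.pi * (-((∫ s, ‖q s‖ ^ 2) / 2) +
      ∑ k ∈ hfin.toFinset, (mult q k : ℝ) * (2 * k.im)) = Real.pi * ((∫ t, ‖q t‖ ^ 2) -
        4 * ∑ k ∈ hfin.toFinset, (mult q k : ℝ) * k.im) := by
    have : ∑ k ∈ hfin.toFinset, (mult q k : ℝ) * (2 * k.im) =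
        2 * ∑ k ∈ hfin.toFinset, (mult q k : ℝ) * k.im := by
      rw [Finset.mul_sum]
      exact Finset.sum_congr rfl fun k _ => by ring
    rw [this]
    ring
  rw [e] at h3
  refine h3.congr' ?_
  have h4 : ∀ᶠ y : ℝ in atTop, I * y ∉ eigenvalues q := by
    have : ∀ᶠ y : ℝ in atTop, ∀ k ∈ hfin.toFinset, I * y ≠ k := by
      rw [Filter.eventually_all_finset]
      intro k _
      filter_upwards [eventually_gt_atTop k.im] with y hy h
      rw [← h] at hy
      simp at hy
    filter_upwards [this] with y hy h
    exact hy _ (hfin.mem_toFinset.2 h) rfl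
  filter_upwards [h4, eventually_gt_atTop 0] with y hy hy0
  have hl : 0 ≤ (I * y : ℂ).im := by simpa using hy0.le
  have ha : a q (I * y) ≠ 0 := fun h => hy ⟨by simpa using hy0, h⟩
  have hyS : I * (y : ℂ) ∉ hfin.toFinset := fun h => hy (hfin.mem_toFinset.1 h)
  have hp := log_norm_eq_poisson hA hA0 hinf hy0
  have hr : ∀ s : ℝ, ‖A s‖ = ‖a q s‖ := fun s => by
    rw [hAa s (by simp) fun h => absurd h.1 (by simp), norm_mul, norm_blaschke_real _ hS, mul_one]
  simp only [hr] at hp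
  rw [hAa _ hl hy, norm_mul, Real.log_mul (norm_ne_zero_iff.2 ha)
    (norm_ne_zero_iff.2 (blaschke_ne_zero hS _ hl hyS))] at hp
  rw [← mul_add, hp]
  simp only [fun s => log_one_add_norm_Qc_sq hq (h0 s)]
  rw [← integral_const_mul, ← integral_const_mul, ← integral_const_mul]
  congr 1 with s
  have : s ^ 2 + y ^ 2 ≠ 0 := by positivity
  generalize Real.log _ = r
  field_simp
  ring

/-- The weight in `tendsto_poisson_integral` tends to one. Convergence of the weighted integrals
first bounds the unweighted one, which then serves as its own dominating function in the passage to
the limit. -/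
theorem parseval (hq : Integrable q volume) (h2 : MemLp q 2 volume)
    (h0 : ∀ lam : ℝ, a q lam ≠ 0) :
    ∃ hfin : (eigenvalues q).Finite,
      Integrable (fun lam : ℝ => Real.log (1 + ‖Qc q lam‖ ^ 2)) volume ∧
      (∫ t : ℝ, ‖q t‖ ^ 2) =
        1 / Real.pi * (∫ lam : ℝ, Real.log (1 + ‖Qc q lam‖ ^ 2)) +
          4 * ∑ lamk ∈ hfin.toFinset, (mult q lamk : ℝ) * lamk.im := by
  have hfin := finite_eigenvalues hq h0
  have hlim := tendsto_poisson_integral hq h2 h0 hfin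
  have hnn : ∀ s : ℝ, 0 ≤ Real.log (1 + ‖Qc q s‖ ^ 2) := fun s =>
    Real.log_nonneg (by nlinarith [sq_nonneg ‖Qc q s‖])
  have hc : Continuous fun s : ℝ => Real.log (1 + ‖Qc q s‖ ^ 2) := by
    simp only [fun s => log_one_add_norm_Qc_sq hq (h0 s)]
    exact (continuous_log_norm_a hq h0).const_mul (-2)
  set P := Real.pi * ((∫ t, ‖q t‖ ^ 2) - 4 * ∑ k ∈ hfin.toFinset, (mult q k : ℝ) * k.im) with hP
  have hint : Integrable (fun s : ℝ => Real.log (1 + ‖Qc q s‖ ^ 2)) volume := by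
    refine (aecover_Icc tendsto_neg_atTop_atBot
      (tendsto_id (x := (atTop : Filter ℝ)))).integrable_of_integral_bounded_of_nonneg_ae
      -- On `[-y, y]` the weight is at least `1 / 2`, and for large `y` the weighted integral is at
      -- most `P + 1`.
      (2 * (P + 1)) (fun y => hc.integrableOn_Icc) (Eventually.of_forall hnn) ?_
    filter_upwards [hlim.eventually (ge_mem_nhds (lt_add_one P)), eventually_gt_atTop 0] with y hy hy0
    have hi := integrable_poisson_mul_log hq h0 hy0
    calc ∫ s in Set.Icc (-y) y, Real.log (1 + ‖Qc q s‖ ^ 2)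
        ≤ ∫ s in Set.Icc (-y) y, 2 * ((1 + (s / y) ^ 2)⁻¹ * Real.log (1 + ‖Qc q s‖ ^ 2)) := by
          refine setIntegral_mono_on hc.integrableOn_Icc (hi.const_mul 2).integrableOn
            measurableSet_Icc fun s hs => ?_
          have h1 : (s / y) ^ 2 ≤ 1 := by
            rw [div_pow, div_le_one (by positivity)]
            exact sq_le_sq' hs.1 hs.2
          have h3 : 1 ≤ 2 * (1 + (s / y) ^ 2)⁻¹ := by
            rw [← div_eq_mul_inv, le_div_iff₀ (by positivity)]
            linarith
          rw [← mul_assoc]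
          exact le_mul_of_one_le_left (hnn s) h3
      _ ≤ ∫ s, 2 * ((1 + (s / y) ^ 2)⁻¹ * Real.log (1 + ‖Qc q s‖ ^ 2)) :=
          setIntegral_le_integral (hi.const_mul 2) (Eventually.of_forall fun s => by
            have := hnn s
            positivity)
      _ ≤ 2 * (P + 1) := by
          rw [integral_const_mul]
          linarith
  have hlim2 : Tendsto (fun y : ℝ => ∫ s : ℝ, (1 + (s / y) ^ 2)⁻¹ * Real.log (1 + ‖Qc q s‖ ^ 2))
      atTop (𝓝 (∫ s : ℝ, Real.log (1 + ‖Qc q s‖ ^ 2))) := by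
    refine tendsto_integral_filter_of_dominated_convergence
      (fun s => Real.log (1 + ‖Qc q s‖ ^ 2)) ?_ ?_ hint ?_
    · filter_upwards [eventually_gt_atTop 0] with y hy using (integrable_poisson_mul_log hq h0 hy).1
    · refine Eventually.of_forall fun y => Eventually.of_forall fun s => ?_
      have h1 : (1 + (s / y) ^ 2)⁻¹ ≤ 1 := inv_le_one_of_one_le₀ (by nlinarith [sq_nonneg (s / y)])
      rw [Real.norm_of_nonneg (mul_nonneg (by positivity) (hnn s))]
      exact mul_le_of_le_one_left (hnn s) h1
    · refine Eventually.of_forall fun s => ?_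
      have h1 : Tendsto (fun y : ℝ => s / y) atTop (𝓝 0) := tendsto_const_nhds.div_atTop tendsto_id
      have h3 := (((h1.pow 2).const_add 1).inv₀ (by norm_num)).mul_const
        (Real.log (1 + ‖Qc q s‖ ^ 2))
      simpa using h3
  refine ⟨hfin, hint, ?_⟩
  rw [tendsto_nhds_unique hlim2 hlim, hP, ← mul_assoc, one_div_mul_cancel Real.pi_ne_zero]
  ring

end GNFT

end

theorem mainTheorem1 (q : ℝ → ℂ) (hq : Integrable q volume) :
    -- the objects in the definition of the transform are well defined
    ((∀ lam : ℂ, 0 ≤ lam.im → ∃! v : ℝ → Fin 2 → ℂ, GNFT.IsJost q lam v) ∧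
      (∀ lam : ℂ, 0 ≤ lam.im →
        Tendsto (fun t : ℝ => GNFT.u1 q t lam) atTop (𝓝 (GNFT.a q lam))) ∧
      (∀ lam : ℝ,
        Tendsto (fun t : ℝ => GNFT.u2 q t (lam : ℂ)) atTop (𝓝 (GNFT.b q (lam : ℂ)))) ∧
      AnalyticOnNhd ℂ (GNFT.a q) {lam : ℂ | 0 < lam.im} ∧
      (∀ t : ℝ, AnalyticOnNhd ℂ (GNFT.u2 q t) {lam : ℂ | 0 < lam.im}) ∧
      (∀ lamk ∈ GNFT.eigenvalues q,
        1 ≤ GNFT.mult q lamk ∧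
        analyticOrderAt (GNFT.a q) lamk = (GNFT.mult q lamk : ℕ∞) ∧
        (∀ n < GNFT.mult q lamk,
          Tendsto (fun t : ℝ => iteratedDeriv n (GNFT.u2 q t) lamk) atTop
            (𝓝 (GNFT.bDeriv q lamk n))) ∧
        GNFT.IsPrincipalPart (fun z => GNFT.bTaylor q lamk z / GNFT.a q z) lamk
          (GNFT.mult q lamk) (GNFT.residueCoeff q lamk) ∧
        -- where `b` itself exists near `lamk`, this is the principal part of `b / a`
        (∀ U : Set ℂ, IsOpen U → lamk ∈ U →
          TendstoLocallyUniformlyOn (GNFT.u2 q) (GNFT.b q) atTop U →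
          GNFT.IsPrincipalPart (fun z => GNFT.b q z / GNFT.a q z) lamk
            (GNFT.mult q lamk) (GNFT.residueCoeff q lamk)))) ∧
    -- phase shift
    (∀ (φ₀ : ℝ) (q' : ℝ → ℂ), (∀ t, q' t = q t * exp (I * φ₀)) →
      (∀ lam : ℝ, GNFT.Qc q' lam = GNFT.Qc q lam * exp (-I * φ₀)) ∧
      GNFT.eigenvalues q' = GNFT.eigenvalues q ∧
      ∀ lamk ∈ GNFT.eigenvalues q,
        GNFT.mult q' lamk = GNFT.mult q lamk ∧
        ∀ l < GNFT.mult q lamk,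
          GNFT.norming q' lamk l = GNFT.norming q lamk l * exp (-I * φ₀)) ∧
    -- time shift
    (∀ (t₀ : ℝ) (q' : ℝ → ℂ), (∀ t, q' t = q (t - t₀)) →
      (∀ lam : ℝ, GNFT.Qc q' lam = GNFT.Qc q lam * exp (-2 * I * lam * t₀)) ∧
      GNFT.eigenvalues q' = GNFT.eigenvalues q ∧
      ∀ lamk ∈ GNFT.eigenvalues q,
        GNFT.mult q' lamk = GNFT.mult q lamk ∧
        GNFT.normingRow q' lamk (GNFT.mult q lamk) =
          GNFT.normingRow q lamk (GNFT.mult q lamk) ᵥ*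
            NormedSpace.exp ((2 * t₀ : ℂ) • GNFT.LambdaBlock lamk (GNFT.mult q lamk))) ∧
    -- frequency shift
    (∀ (ω₀ : ℝ) (q' : ℝ → ℂ), (∀ t : ℝ, q' t = q t * exp (-2 * I * ω₀ * t)) →
      (∀ lam : ℝ, GNFT.Qc q' lam = GNFT.Qc q (lam - ω₀)) ∧
      GNFT.eigenvalues q' = (fun lam => lam + (ω₀ : ℂ)) '' GNFT.eigenvalues q ∧
      ∀ lamk ∈ GNFT.eigenvalues q,
        GNFT.mult q' (lamk + ω₀) = GNFT.mult q lamk ∧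
        ∀ l < GNFT.mult q lamk,
          GNFT.norming q' (lamk + ω₀) l = GNFT.norming q lamk l) ∧
    -- time dilation
    (∀ (T : ℝ) (q' : ℝ → ℂ), 0 < T → (∀ t, q' t = 1 / (T : ℂ) * q (t / T)) →
      (∀ lam : ℝ, GNFT.Qc q' lam = GNFT.Qc q (T * lam)) ∧
      GNFT.eigenvalues q' = (fun lam => lam / (T : ℂ)) '' GNFT.eigenvalues q ∧
      ∀ lamk ∈ GNFT.eigenvalues q,
        GNFT.mult q' (lamk / T) = GNFT.mult q lamk ∧
        ∀ l < GNFT.mult q lamk,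
          GNFT.norming q' (lamk / T) l = GNFT.norming q lamk l / (T : ℂ) ^ (l + 1)) ∧
    -- Parseval's theorem, for signals of finite energy without real zeros of `a`
    (MemLp q 2 volume → (∀ lam : ℝ, GNFT.a q (lam : ℂ) ≠ 0) →
      ∃ hfin : (GNFT.eigenvalues q).Finite,
        Integrable (fun lam : ℝ => Real.log (1 + ‖GNFT.Qc q lam‖ ^ 2)) volume ∧
        (∫ t : ℝ, ‖q t‖ ^ 2) =
          1 / Real.pi * (∫ lam : ℝ, Real.log (1 + ‖GNFT.Qc q lam‖ ^ 2)) +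
            4 * ∑ lamk ∈ hfin.toFinset, (GNFT.mult q lamk : ℝ) * lamk.im) := by
  refine ⟨⟨fun lam hl => GNFT.existsUnique_isJost hq hl, fun lam hl => GNFT.tendsto_u1 hq hl,
    GNFT.tendsto_u2 hq, (GNFT.hol_a hq).analyticOnNhd, fun t => (GNFT.hol_u2 hq t).analyticOnNhd,
    fun lamk hk => ⟨GNFT.one_le_mult hq hk, GNFT.analyticOrderAt_a hq hk.1,
      fun n hn => GNFT.tendsto_bDeriv hq hk.1 hn, GNFT.isPrincipalPart_residueCoeff hq hk.1,
      fun U hU hkU h => GNFT.isPrincipalPart_b hq hk.1 hU hkU h⟩⟩,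
    GNFT.phaseShift hq, GNFT.timeShift hq, GNFT.frequencyShift hq, GNFT.timeDilation hq,
    GNFT.parseval hq⟩
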